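/- Let $m$ be a square-free positive integer, let $\mathcal O$ be the ring of integers of $K=\mathbb{Q}(\sqrt{-m})$, and suppose that the only units of $\mathcal O$ are $\pm1$. Let $\omega=\tfrac{-1+\sqrt{-m}}2$ if $m\equiv 3 \bmod 4$ and $\omega=\sqrt{-m}$ otherwise, so that $\mathcal O=\mathbb{Z}[\omega]$. Let $\Gamma=\mathrm{SL}_2(\mathcal O)$ act on hyperbolic space $\mathcal H=\{(z,\zeta)\in\mathbb{C}\times\mathbb{R} : \zeta>0\}$. Let $P$ be the Bianchi fundamental polyhedron, i.e. the set of all $(z,\zeta)\in\mathcal H$ such that $z=s+t\omega$ with $s,t$ real, $|s|\le\frac12$, $0\le t\le1$, and $|cz+d|^2+|c|^2\zeta^2\ge1$ for all $c,d\in\mathcal O$ with $c\mathcal O+d\mathcal O=\mathcal O$. Let $\widehat{\mathcal H}$ be the Borel--Serre bordification of $\mathcal H$, which attaches to $\mathcal H$ at every cusp $c\in\mathbb{P}^1(K)$ the plane $\mathbb{P}^1(\mathbb{C})\setminus\{c\}$ of geodesics emanating from $c$; then ${}_\Gamma\backslash\widehat{\mathcal H}$ is the Borel--Serre compactification of ${}_\Gamma\backslash\mathcal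 H$, and the image in it of the plane at the cusp $\infty$ is the torus $\mathbf T_\infty$ attached at infinity. Give $\widehat{\mathcal H}$ the cell structure induced by the closure $\widehat P$ of $P$ and its translates: its open cells are the connected components of the sets of points which lie in the same translates of $\widehat P$, have the same stabiliser in $\Gamma$, and lie either all in $\mathcal H$ or all in $\widehat{\mathcal H}\setminus\mathcal H$. Give ${}_\Gamma\backslash\widehat{\mathcal H}$ the induced cell structure. Under the $\mathrm{SL}_2(\mathbb{Z})$-equivariant embedding $x+iy\mapsto(x,y)$ of the upper half-plane onto the real upper half-plane $\{(z,\zeta)\in\mathcal H : \operatorname{Im} z=0\}$, the set $\sigma$ of the points of $P$ in the real upper half-plane is the image of the fundamental domain $\{\tau : |\tau|\ge 1,\ |\operatorname{Re}\tau|\le\frac12\}$ for $\mathrm{SL}_2(\mathbb{Z})$; it is contained in the boundary of $P$. The closure $\widehat\sigma$ of $\sigma$ in $\widehat{\mathcal H}$ is a closed $2$-cell of the cell structure (a closed disc whose interior is an open cell), whose boundary circle runs successively through finitely many oriented edges. One of these edges, the top edge, is the intersection of $\widehat\sigma$ with the plane attached at the cusp $\infty$; all the others lie in $\mathcal H$,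 up to ideal end points. The boundary of $\widehat\sigma$ passes to the quotient by $\Gamma$ as follows. The edges in $\mathcal H$ appear in pairs of distinct edges which are identified by an element of $\Gamma$ with opposite orientations. So in the cellular $1$-chains of ${}_\Gamma\backslash\widehat{\mathcal H}$, the boundary of $\widehat\sigma$ equals the top edge, which is a non-zero chain. The image of the top edge lies in $\mathbf T_\infty$, and it is a loop, since its two end points are identified by $\Gamma$. -/

import Mathlib

open scoped NumberField MatrixGroups OnePoint unitInterval

noncomputable section

namespace Bianchi

/-! ## Hyperbolic 3-space -/

/-- The upper half-space model `{(z, ζ) ∈ ℂ × ℝ | ζ > 0}` of hyperbolic 3-space. -/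
def H3 : Type := {p : ℂ × ℝ // 0 < p.2}

instance : TopologicalSpace H3 := inferInstanceAs (TopologicalSpace {p : ℂ × ℝ // 0 < p.2})

/-- The coordinate `z`. -/
def H3.z (p : H3) : ℂ := p.1.1

/-- The coordinate `ζ`. -/
def H3.ζ (p : H3) : ℝ := p.1.2

lemma H3.ζ_pos (p : H3) : 0 < p.ζ := p.2

@[ext] lemma H3.ext {p q : H3} (h₁ : p.z = q.z) (h₂ : p.ζ = q.ζ) : p = q :=
  Subtype.ext (Prod.ext h₁ h₂)

/-- `|c z + d|² + |c|² ζ²`. -/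
def factor (c d : ℂ) (p : H3) : ℝ :=
  Complex.normSq (c * p.z + d) + Complex.normSq c * p.ζ ^ 2

/-- `(a z + b) conj(c z + d) + a conj(c) ζ²`. -/
def numer (g : SL(2, ℂ)) (p : H3) : ℂ :=
  (g 0 0 * p.z + g 0 1) * (starRingEnd ℂ) (g 1 0 * p.z + g 1 1) +
    g 0 0 * (starRingEnd ℂ) (g 1 0) * (p.ζ : ℂ) ^ 2

lemma factor_pos (g : SL(2, ℂ)) (p : H3) : 0 < factor (g 1 0) (g 1 1) p := by
  have hdet := Matrix.det_fin_two g.1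
  rw [g.2] at hdet
  unfold factor
  by_cases hc : g 1 0 = 0
  · have hd : g 1 1 ≠ 0 := by
      intro hd
      have h1 : g.1 1 0 = 0 := hc
      have h2 : g.1 1 1 = 0 := hd
      rw [h1, h2] at hdet
      simp at hdet
    simp only [hc, zero_mul, zero_add, map_zero, add_zero]
    exact Complex.normSq_pos.2 hd
  · have h1 := Complex.normSq_pos.2 hc
    have h2 := Complex.normSq_nonneg (g 1 0 * p.z + g 1 1)
    have h3 := p.ζ_pos
    positivity

/-- The isometric action of `SL₂(ℂ)` on hyperbolic 3-space (Poincaré extension of the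
Möbius transformations). -/
def act (g : SL(2, ℂ)) (p : H3) : H3 :=
  ⟨(numer g p / (factor (g 1 0) (g 1 1) p : ℂ), p.ζ / factor (g 1 0) (g 1 1) p),
    div_pos p.ζ_pos (factor_pos g p)⟩

lemma act_z (g : SL(2, ℂ)) (p : H3) :
    (act g p).z = numer g p / (factor (g 1 0) (g 1 1) p : ℂ) := rfl

lemma act_ζ (g : SL(2, ℂ)) (p : H3) :
    (act g p).ζ = p.ζ / factor (g 1 0) (g 1 1) p := rfl

lemma factor_cast (c d : ℂ) (p : H3) :
    (factor c d p : ℂ) = (c * p.z + d) * ((starRingEnd ℂ) c * (starRingEnd ℂ) p.z +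
      (starRingEnd ℂ) d) + c * (starRingEnd ℂ) c * (p.ζ : ℂ) ^ 2 := by
  unfold factor
  push_cast
  rw [← Complex.mul_conj, ← Complex.mul_conj]
  simp

lemma mul_conj_numer (g : SL(2, ℂ)) (p : H3) :
    numer g p * (starRingEnd ℂ) (numer g p) + (p.ζ : ℂ) ^ 2 =
      (factor (g 1 0) (g 1 1) p : ℂ) * (factor (g 0 0) (g 0 1) p : ℂ) := by
  have hdet : g 0 0 * g 1 1 - g 0 1 * g 1 0 = 1 := by
    have := Matrix.det_fin_two g.1
    rw [g.2] at this
    exact this.symm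
  have hdet' := congrArg (starRingEnd ℂ) hdet
  simp only [map_sub, map_mul, map_one] at hdet'
  rw [factor_cast, factor_cast]
  unfold numer
  simp only [map_add, map_mul, Complex.conj_conj, map_pow, Complex.conj_ofReal]
  linear_combination (-(p.ζ : ℂ) ^ 2) * hdet -
    (p.ζ : ℂ) ^ 2 * (g 0 0 * g 1 1 - g 0 1 * g 1 0) * hdet'

lemma mul_entries (g h : SL(2, ℂ)) (i j : Fin 2) :
    (g * h) i j = g i 0 * h 0 j + g i 1 * h 1 j := by
  simp [Matrix.mul_apply, Fin.sum_univ_two]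

lemma factor_mul_aux (h : SL(2, ℂ)) (p : H3) (c d : ℂ) :
    factor c d (act h p) * factor (h 1 0) (h 1 1) p =
      factor (c * h 0 0 + d * h 1 0) (c * h 0 1 + d * h 1 1) p := by
  have hD : (factor (h 1 0) (h 1 1) p : ℂ) ≠ 0 := by
    exact_mod_cast (factor_pos h p).ne'
  have key := mul_conj_numer h p
  apply Complex.ofReal_injective
  push_cast
  rw [factor_cast c d (act h p), act_z, act_ζ]
  push_cast
  simp only [map_div₀, Complex.conj_ofReal]
  have e1 := factor_cast (h 1 0) (h 1 1) p
  have e2 := factor_cast (h 0 0) (h 0 1) p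
  have e3 := factor_cast (c * h 0 0 + d * h 1 0) (c * h 0 1 + d * h 1 1) p
  generalize hDD : (factor (h 1 0) (h 1 1) p : ℂ) = D at *
  generalize (factor (h 0 0) (h 0 1) p : ℂ) = N at *
  rw [e3]
  generalize hA : numer h p = A at *
  generalize hB : (starRingEnd ℂ) A = B at *
  have hA' : A = (h 0 0 * p.z + h 0 1) * (starRingEnd ℂ) (h 1 0 * p.z + h 1 1) +
    h 0 0 * (starRingEnd ℂ) (h 1 0) * (p.ζ : ℂ) ^ 2 := hA.symm
  have hB' : B = (starRingEnd ℂ) (h 0 0 * p.z + h 0 1) * (h 1 0 * p.z + h 1 1) +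
    (starRingEnd ℂ) (h 0 0) * (h 1 0) * (p.ζ : ℂ) ^ 2 := by
    rw [← hB, hA']; simp
  simp only [map_add, map_mul] at *
  have step : ((c * (A / D) + d) * ((starRingEnd ℂ) c * (B / D) + (starRingEnd ℂ) d) +
      c * (starRingEnd ℂ) c * ((p.ζ : ℂ) / D) ^ 2) * D =
      c * (starRingEnd ℂ) c * N + c * (starRingEnd ℂ) d * A + d * (starRingEnd ℂ) c * B +
        d * (starRingEnd ℂ) d * D := by
    field_simp
    linear_combination (c * (starRingEnd ℂ) c) * key
  rw [step, e1, e2, hA', hB']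
  ring

lemma numer_mul_aux (g h : SL(2, ℂ)) (p : H3) :
    numer g (act h p) * (factor (h 1 0) (h 1 1) p : ℂ) = numer (g * h) p := by
  have hD : (factor (h 1 0) (h 1 1) p : ℂ) ≠ 0 := by
    exact_mod_cast (factor_pos h p).ne'
  have key := mul_conj_numer h p
  have e1 := factor_cast (h 1 0) (h 1 1) p
  have e2 := factor_cast (h 0 0) (h 0 1) p
  unfold numer at key ⊢
  rw [act_z, act_ζ, mul_entries, mul_entries, mul_entries, mul_entries]
  change _ = _ at key
  have hA' : numer h p = (h 0 0 * p.z + h 0 1) * (starRingEnd ℂ) (h 1 0 * p.z + h 1 1) +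
    h 0 0 * (starRingEnd ℂ) (h 1 0) * (p.ζ : ℂ) ^ 2 := rfl
  rw [← hA'] at key
  have hB' : (starRingEnd ℂ) (numer h p) =
    (starRingEnd ℂ) (h 0 0 * p.z + h 0 1) * (h 1 0 * p.z + h 1 1) +
    (starRingEnd ℂ) (h 0 0) * (h 1 0) * (p.ζ : ℂ) ^ 2 := by
    rw [hA']; simp
  push_cast
  simp only [map_add, map_mul, map_div₀, Complex.conj_ofReal] at *
  generalize (factor (h 1 0) (h 1 1) p : ℂ) = D at *
  generalize (factor (h 0 0) (h 0 1) p : ℂ) = N at *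
  generalize numer h p = A at *
  generalize (starRingEnd ℂ) A = B at *
  have step : ((g 0 0 * (A / D) + g 0 1) * ((starRingEnd ℂ) (g 1 0) * (B / D) +
      (starRingEnd ℂ) (g 1 1)) +
      g 0 0 * (starRingEnd ℂ) (g 1 0) * ((p.ζ : ℂ) / D) ^ 2) * D =
      g 0 0 * (starRingEnd ℂ) (g 1 0) * N + g 0 0 * (starRingEnd ℂ) (g 1 1) * A +
        g 0 1 * (starRingEnd ℂ) (g 1 0) * B + g 0 1 * (starRingEnd ℂ) (g 1 1) * D := by
    field_simp
    linear_combination (g 0 0 * (starRingEnd ℂ) (g 1 0)) * key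
  rw [step, e1, e2, hA', hB']
  ring

instance : MulAction SL(2, ℂ) H3 where
  smul := act
  one_smul p := by
    change act 1 p = p
    apply H3.ext
    · simp [act_z, numer, factor]
    · simp [act_ζ, factor]
  mul_smul g h p := by
    change act (g * h) p = act g (act h p)
    have hf : factor ((g * h) 1 0) ((g * h) 1 1) p =
        factor (g 1 0) (g 1 1) (act h p) * factor (h 1 0) (h 1 1) p := by
      rw [factor_mul_aux h, mul_entries, mul_entries]
    have hn := numer_mul_aux g h p
    have hD := (factor_pos h p).ne'
    have hE := (factor_pos g (act h p)).ne'
    have hD' : (factor (h 1 0) (h 1 1) p : ℂ) ≠ 0 := by exact_mod_cast hD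
    have hE' : (factor (g 1 0) (g 1 1) (act h p) : ℂ) ≠ 0 := by exact_mod_cast hE
    apply H3.ext
    · rw [act_z, act_z g, hf, ← hn]
      push_cast
      field_simp
    · rw [act_ζ, act_ζ g, act_ζ h, hf]
      field_simp

/-- The real upper half-plane inside hyperbolic 3-space. -/
def realHalfPlane : Set H3 := {p | p.z.im = 0}

/-- The natural embedding of the upper half-plane as the real upper half-plane,
`x + iy ↦ (x, y)`. -/
def realEmbedding (τ : UpperHalfPlane) : H3 := ⟨((τ.re : ℂ), τ.im), τ.im_pos⟩

/-! ## The imaginary quadratic field and the Bianchi group -/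

variable (m : ℕ)

/-- `√(-m)`. -/
def sqrtNeg : ℂ := Complex.I * (Real.sqrt m : ℂ)

/-- The imaginary quadratic field `K = ℚ(√(-m))`, as a subfield of `ℂ`. -/
def QField : IntermediateField ℚ ℂ := IntermediateField.adjoin ℚ {sqrtNeg m}

/-- The ring of integers `𝒪` of `ℚ(√(-m))`. -/
abbrev RingInt : Type := 𝓞 (QField m)

/-- The Bianchi group `SL₂(𝒪)`. -/
abbrev BianchiGroup : Type := Matrix.SpecialLinearGroup (Fin 2) (RingInt m)

/-- The inclusion `𝒪 ⊆ ℂ`. -/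
def intToComplex : RingInt m →+* ℂ :=
  (algebraMap (QField m) ℂ).comp (algebraMap (RingInt m) (QField m))

/-- The usual generator `ω` of `𝒪 = ℤ[ω]`. -/
def omega : ℂ := if m % 4 = 3 then (-1 + sqrtNeg m) / 2 else sqrtNeg m

/-! ## The Borel–Serre bordification

One plane is attached at every cusp `c ∈ ℙ¹(K)`: the set of geodesics emanating from `c`. Such a
geodesic is recorded by its other end point `e ∈ ℙ¹(ℂ) ∖ {c}`. -/

/-- The inclusion `ℙ¹(K) ⊆ ℙ¹(ℂ)`. -/
def cuspToComplex (c : OnePoint (QField m)) : OnePoint ℂ :=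
  OnePoint.map (algebraMap (QField m) ℂ) c

/-- The Borel–Serre bordification of hyperbolic 3-space with respect to `SL₂(K)`. -/
inductive BorelSerre : Type
  | inner (p : H3) : BorelSerre
  | bdry (c : OnePoint (QField m)) (e : OnePoint ℂ) (h : cuspToComplex m c ≠ e) : BorelSerre

variable {m}

/-- The inclusion `SL₂(K) ⊆ SL₂(ℂ)`. -/
def slToComplex : SL(2, QField m) →* SL(2, ℂ) :=
  Matrix.SpecialLinearGroup.map (algebraMap (QField m) ℂ)

lemma cuspToComplex_smul (g : SL(2, QField m)) (c : OnePoint (QField m)) :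
    cuspToComplex m (Matrix.SpecialLinearGroup.toGL g • c) =
      Matrix.SpecialLinearGroup.toGL (slToComplex g) • cuspToComplex m c := by
  unfold cuspToComplex
  rw [OnePoint.map_smul]
  rfl

/-- `SL₂(K)` acts by isometries on hyperbolic space, and on the geodesics emanating from cusps
by the Möbius action on both of their end points. -/
instance : MulAction SL(2, QField m) (BorelSerre m) where
  smul g
    | .inner p => .inner (slToComplex g • p)
    | .bdry c e h => .bdry (Matrix.SpecialLinearGroup.toGL g • c)
        (Matrix.SpecialLinearGroup.toGL (slToComplex g) • e) (by
          rw [cuspToComplex_smul]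
          exact fun h' => h (MulAction.injective _ h'))
  one_smul x := by
    rcases x with p | ⟨c, e, h⟩
    · change BorelSerre.inner _ = _
      simp
    · change BorelSerre.bdry _ _ _ = _
      simp
  mul_smul g g' x := by
    rcases x with p | ⟨c, e, h⟩
    · change BorelSerre.inner _ = BorelSerre.inner _
      simp [mul_smul]
    · change BorelSerre.bdry _ _ _ = BorelSerre.bdry _ _ _
      simp [mul_smul]

instance : MulAction (BianchiGroup m) (BorelSerre m) :=
  MulAction.compHom (BorelSerre m)
    (Matrix.SpecialLinearGroup.map (n := Fin 2) (algebraMap (RingInt m) (QField m)))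

/-- The point at infinity of the vertical geodesic over `z`, in the plane attached at the cusp
`∞`. -/
def atInfinity (z : ℂ) : BorelSerre m := .bdry ∞ (z : OnePoint ℂ) (OnePoint.infty_ne_coe z)

/-- The chart at the cusp `∞`, with coordinates `z` and `r = 1/ζ ∈ [0, ∞)`. -/
def chartInfinity (x : ℂ × NNReal) : BorelSerre m :=
  if h : x.2 = 0 then atInfinity x.1
  else .inner ⟨(x.1, ((x.2 : ℝ))⁻¹), by
    have : 0 < (x.2 : ℝ) := lt_of_le_of_ne x.2.2 (fun h' => h (NNReal.coe_eq_zero.1 h'.symm))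
    exact inv_pos.2 this⟩

/-- The topology glued from the chart at `∞` and its translates under `SL₂(K)`, which is
transitive on the cusps: a set is open if and only if its preimage in every chart is open. -/
instance : TopologicalSpace (BorelSerre m) :=
  ⨆ g : SL(2, QField m),
    TopologicalSpace.coinduced (fun x : ℂ × NNReal => g • (chartInfinity x : BorelSerre m))
      inferInstance

variable (m)

/-- The part of the bordification which lies in hyperbolic space. -/
def innerPart : Set (BorelSerre m) := Set.range BorelSerre.inner

/-- The plane attached at the cusp `∞`. -/
def planeAtInfinity : Set (BorelSerre m) := Set.range atInfinity

/-- The Borel–Serre compactification of the quotient of hyperbolic space by the Bianchi group. -/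
abbrev Compactification : Type := MulAction.orbitRel.Quotient (BianchiGroup m) (BorelSerre m)

variable {m}

/-- The quotient map onto the Borel–Serre compactification. -/
def proj (x : BorelSerre m) : Compactification m := Quotient.mk _ x

variable (m)

/-- The torus attached at the cusp `∞`, as a subset of the Borel–Serre compactification. -/
def torusAtInfinity : Set (Compactification m) := proj '' planeAtInfinity m

/-! ## The Bianchi fundamental polyhedron and the cell structure induced by it -/

/-- The fundamental parallelogram for the stabiliser of the cusp `∞`, with opposite edges
identified by the translations by `1` and `ω`. -/
def cuspParallelogram : Set ℂ :=
  {z | ∃ s t : ℝ, |s| ≤ 1 / 2 ∧ 0 ≤ t ∧ t ≤ 1 ∧ z = s + t * omega m}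

/-- The Bianchi fundamental polyhedron: the points above the fundamental parallelogram which do
not lie strictly below any of the hemispheres `|c z + d|² + |c|² ζ² = 1` with `(c, d)`
unimodular. -/
def polyhedron : Set H3 :=
  {p | p.z ∈ cuspParallelogram m ∧
    ∀ c d : RingInt m, IsCoprime c d → 1 ≤ factor (intToComplex m c) (intToComplex m d) p}

/-- The Bianchi fundamental polyhedron, completed by its ideal points in the bordification. -/
def closedPolyhedron : Set (BorelSerre m) := closure (BorelSerre.inner '' polyhedron m)

/-- The part of the Bianchi fundamental polyhedron in the real upper half-plane. -/
def realFace : Set H3 := polyhedron m ∩ realHalfPlane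

/-- The completion of `realFace` in the bordification. -/
def closedRealFace : Set (BorelSerre m) := closure (BorelSerre.inner '' realFace m)

variable {m}

/-- Two points have the same type if they lie in the same translates of the polyhedron, have the
same stabiliser, and either both or none of them lie in the attached boundary. -/
def SameType (x y : BorelSerre m) : Prop :=
  (∀ γ : BianchiGroup m,
    (γ⁻¹ • x ∈ closedPolyhedron m ↔ γ⁻¹ • y ∈ closedPolyhedron m) ∧ (γ • x = x ↔ γ • y = y)) ∧
  (x ∈ innerPart m ↔ y ∈ innerPart m)

/-- The open cells of the cell structure that the Bianchi fundamental polyhedron and its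
translates induce on the bordification, subdivided in such a way that the stabiliser of a cell
fixes the cell pointwise. The open cells of the Borel–Serre compactification are their images. -/
def IsOpenCell (C : Set (BorelSerre m)) : Prop :=
  ∃ x, C = connectedComponentIn {y | SameType x y} x

variable (m)

/-- An oriented edge (with a parametrization) of the cell structure. -/
structure Edge where
  toFun : C(I, BorelSerre m)
  injOn : Set.InjOn toFun (Set.Ioo 0 1)
  isOpenCell : IsOpenCell (toFun '' Set.Ioo 0 1)
  isOpenCell_source : IsOpenCell {toFun 0}
  isOpenCell_target : IsOpenCell {toFun 1}

instance : CoeFun (Edge m) (fun _ => I → BorelSerre m) := ⟨fun e => e.toFun⟩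

/-- The relations between oriented edges in the Borel–Serre compactification: edges which become
equal up to an orientation preserving reparametrization are equal, and edges which become equal
up to an orientation reversing reparametrization are opposite to each other. -/
def edgeRelations : Set (FreeAbelianGroup (Edge m)) :=
  {x | ∃ (e e' : Edge m) (φ : I ≃ₜ I), (∀ t, proj (e' t) = proj (e (φ t))) ∧
    ((φ 0 = 0 ∧ x = FreeAbelianGroup.of e' - FreeAbelianGroup.of e) ∨
     (φ 0 = 1 ∧ x = FreeAbelianGroup.of e' + FreeAbelianGroup.of e))}

/-- The group of cellular 1-chains of the Borel–Serre compactification. -/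
abbrev Chain1 : Type := FreeAbelianGroup (Edge m) ⧸ AddSubgroup.closure (edgeRelations m)

variable {m}

/-- The cellular 1-chain of an oriented edge. -/
def Edge.chain (e : Edge m) : Chain1 m := QuotientAddGroup.mk (FreeAbelianGroup.of e)

variable (m)

/-- An oriented 2-cell with `n` edges: a closed disc embedded in the bordification, whose interior
is an open cell, and whose boundary circle runs successively through `n` oriented edges. -/
structure PolygonalCell (n : ℕ) where
  toFun : ℂ → BorelSerre m
  continuousOn : ContinuousOn toFun (Metric.closedBall 0 1)
  injOn : Set.InjOn toFun (Metric.closedBall 0 1)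
  isOpenCell : IsOpenCell (toFun '' Metric.ball 0 1)
  edge : Fin n → Edge m
  boundary_eq : ∀ (k : Fin n) (t : I),
    toFun (Complex.exp (2 * Real.pi * Complex.I * (((k : ℕ) : ℂ) + ((t : ℝ) : ℂ)) / (n : ℂ))) =
      edge k t

variable {m}

/-- The closed cell. -/
def PolygonalCell.closedCell {n : ℕ} (F : PolygonalCell m n) : Set (BorelSerre m) :=
  F.toFun '' Metric.closedBall 0 1

/-- The cellular boundary of an oriented 2-cell in the Borel–Serre compactification. -/
def PolygonalCell.boundaryChain {n : ℕ} (F : PolygonalCell m n) : Chain1 m :=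
  ∑ k, (F.edge k).chain

end Bianchi

end

/-! Over the real upper half-plane the rows (c, d) of `SL₂(𝒪)` are of two kinds. If c or d has a
non-zero ω-component, imaginary parts alone give |cz+d|² + |c|²ζ² ≥ (Im ω)²·Q, where Q is an
integral form that is at least 1 over the fundamental domain of `SL₂(ℤ)`. The hypothesis on units
excludes m = 1 and m = 3, so (Im ω)² ≥ 7/4 and such a row never takes the value 1 (`omega_im_sq`,
`factor_cases`). All other rows have entries in ℤ. Hence the real face is the classical domain, and
away from its two corners the only rows of value 1 are (0, ±1) and, on the unit arc, (±1, 0)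
(`factor_eq_one`).

An element of Γ which carries a point of the face into P has a lower row of value 1 there. Away from
the corners it therefore acts as a translation or, on the unit arc, as z ↦ -z̄ followed by a
translation. So the type is constant on the interior, on each open vertical side, and on the open
arc without the point i (`transfer`, `sameType_of_inFd`). Conversely the type detects these pieces:
translation by ω detects Im z = 0, translation by ±1 the vertical sides, inversion the arc, and the
stabiliser the point i (`sameType_inner`). Of these pieces only the punctured arc is disconnected,
and i cuts it into two edges; with the vertical sides and the top edge this makes five. On the ideal
boundary the same argument runs in the chart at ∞, and points at other cusps are separated off by
open sets (`isOpenCell_upper`).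

The face has height bounded below, so its closure meets no plane except the one at ∞
(`closedRealFace_eq`). This closure is parametrized by a square (`faceMap`), hence by a disc
(`discToSquare`).

Translation by 1 matches the vertical sides and inversion matches the half arcs, both reversing the
boundary orientation, so the top edge alone survives in the boundary. Its chain is non-zero because
counting modulo 2 the edges with the same image in the quotient, up to reparametrization, respects
every relation (`Edge.chain_ne_zero`). -/

noncomputable section

namespace Bianchi

/-! ## The ring of integers -/

lemma sqrtNeg_re (m : ℕ) : (sqrtNeg m).re = 0 := by simp [sqrtNeg]

lemma sqrtNeg_im (m : ℕ) : (sqrtNeg m).im = Real.sqrt m := by simp [sqrtNeg]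

lemma sqrtNeg_sq (m : ℕ) : sqrtNeg m ^ 2 = -(m : ℂ) := by
  unfold sqrtNeg
  rw [mul_pow, Complex.I_sq, ← Complex.ofReal_pow, Real.sq_sqrt (Nat.cast_nonneg m)]
  simp

lemma star_sqrtNeg (m : ℕ) : (starRingEnd ℂ) (sqrtNeg m) = -sqrtNeg m := by
  apply Complex.ext <;> simp [sqrtNeg_re]

lemma omega_im_pos {m : ℕ} (hm : 0 < m) : 0 < (omega m).im := by
  have : 0 < Real.sqrt m := Real.sqrt_pos.2 (by exact_mod_cast hm)
  unfold omega
  split_ifs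
  · simp [sqrtNeg_im, this]
  · simpa [sqrtNeg_im] using this

/-- The square is m/4 with m ≥ 7, or m with m ≥ 2. What matters later is that it exceeds 1, which
fails precisely for the two excluded values. -/
lemma omega_im_sq {m : ℕ} (hm : Squarefree m) (h1 : m ≠ 1) (h3 : m ≠ 3) :
    7 / 4 ≤ (omega m).im ^ 2 := by
  have h0 : m ≠ 0 := hm.ne_zero
  have hs : Real.sqrt m ^ 2 = m := Real.sq_sqrt (Nat.cast_nonneg m)
  unfold omega
  split_ifs with h
  · have : (7 : ℝ) ≤ m := by exact_mod_cast (by omega : 7 ≤ m)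
    simp [sqrtNeg_im]
    nlinarith
  · have : (2 : ℝ) ≤ m := by exact_mod_cast (by omega : 2 ≤ m)
    rw [sqrtNeg_im]
    linarith

lemma isIntegral_sqrtNeg (m : ℕ) : IsIntegral ℤ (sqrtNeg m) := by
  refine ⟨Polynomial.X ^ 2 + Polynomial.C (m : ℤ), Polynomial.monic_X_pow_add_C _ two_ne_zero, ?_⟩
  simp [sqrtNeg_sq]

lemma isIntegral_omega (m : ℕ) : IsIntegral ℤ (omega m) := by
  unfold omega
  split_ifs with h
  · obtain ⟨k, hk⟩ : ∃ k : ℕ, m = 4 * k + 3 := ⟨m / 4, by omega⟩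
    refine ⟨Polynomial.X ^ 2 + Polynomial.X + Polynomial.C (k + 1 : ℤ), by monicity!, ?_⟩
    have := sqrtNeg_sq m
    rw [hk] at this ⊢
    push_cast at this
    simp
    linear_combination this / 4
  · exact isIntegral_sqrtNeg m

/-- Since √(-m) is algebraic, the field it generates is already the algebra it generates, and the
claimed form is stable under sums and products. -/
lemma exists_rat_form {m : ℕ} {x : ℂ} (hx : x ∈ QField m) :
    ∃ p q : ℚ, x = p + q * sqrtNeg m := by
  have halg : IsAlgebraic ℚ (sqrtNeg m) :=
    ((isIntegral_sqrtNeg m).tower_top (A := ℚ)).isAlgebraic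
  have hx' : x ∈ Algebra.adjoin ℚ {sqrtNeg m} := by
    rw [← IntermediateField.adjoin_simple_toSubalgebra_of_isAlgebraic halg]
    exact hx
  clear hx
  induction hx' using Algebra.adjoin_induction with
  | mem x hx => exact ⟨0, 1, by simpa using hx⟩
  | algebraMap r => exact ⟨r, 0, by simp⟩
  | add x y _ _ hx hy =>
    obtain ⟨p, q, rfl⟩ := hx
    obtain ⟨p', q', rfl⟩ := hy
    exact ⟨p + p', q + q', by push_cast; ring⟩
  | mul x y _ _ hx hy =>
    obtain ⟨p, q, rfl⟩ := hx
    obtain ⟨p', q', rfl⟩ := hy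
    refine ⟨p * p' - m * q * q', p * q' + q * p', ?_⟩
    push_cast
    linear_combination (q * q' : ℂ) * sqrtNeg_sq m

lemma sqrtNeg_mem (m : ℕ) : sqrtNeg m ∈ QField m :=
  IntermediateField.mem_adjoin_simple_self ℚ _

lemma omega_mem (m : ℕ) : omega m ∈ QField m := by
  unfold omega
  have h2 : (2 : ℂ) ∈ QField m := by exact_mod_cast natCast_mem (QField m) 2
  split_ifs
  · exact div_mem (add_mem (neg_mem (one_mem _)) (sqrtNeg_mem m)) h2
  · exact sqrtNeg_mem m

lemma exists_ringInt {m : ℕ} {x : ℂ} (hx : x ∈ QField m) (hi : IsIntegral ℤ x) :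
    ∃ w : RingInt m, intToComplex m w = x := by
  have : IsIntegral ℤ (⟨x, hx⟩ : QField m) :=
    (isIntegral_algebraMap_iff (B := ℂ) (algebraMap (QField m) ℂ).injective).1 hi
  exact ⟨⟨⟨x, hx⟩, this⟩, rfl⟩

lemma exists_omega (m : ℕ) : ∃ w : RingInt m, intToComplex m w = omega m :=
  exists_ringInt (omega_mem m) (isIntegral_omega m)

lemma intToComplex_injective (m : ℕ) : Function.Injective (intToComplex m) :=
  (algebraMap (QField m) ℂ).injective.comp NumberField.RingOfIntegers.coe_injective

lemma exists_int_of_isIntegral_ratCast {q : ℚ} (h : IsIntegral ℤ (q : ℂ)) : ∃ n : ℤ, (n : ℚ) = q := by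
  have h' : IsIntegral ℤ q :=
    (isIntegral_algebraMap_iff (A := ℚ) (B := ℂ) (algebraMap ℚ ℂ).injective).1 (by simpa using h)
  obtain ⟨n, hn⟩ := IsIntegrallyClosed.isIntegral_iff.1 h'
  exact ⟨n, by simpa using hn⟩

/-- The square of the denominator is coprime to the square of the numerator, so it divides the
squarefree m. -/
lemma exists_int_of_squarefree_mul_sq {m : ℕ} (hm : Squarefree m) {q : ℚ} {n : ℤ}
    (h : m * q ^ 2 = n) : ∃ b : ℤ, (b : ℚ) = q := by
  have hden : (q.den : ℤ) * q.den ∣ (m : ℤ) := by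
    have h1 : (m : ℤ) * q.num ^ 2 = n * (q.den : ℤ) ^ 2 := by
      have h2 : (m : ℚ) * (q.num : ℚ) ^ 2 = n * (q.den : ℚ) ^ 2 := by
        have hd : (q.den : ℚ) ≠ 0 := by exact_mod_cast q.den_nz
        have hq : q * q.den = q.num := Rat.mul_den_eq_num q
        rw [← hq, ← h]; ring
      exact_mod_cast h2
    have hc : IsCoprime ((q.den : ℤ) * q.den) (q.num ^ 2) := by
      have : IsCoprime (q.den : ℤ) q.num := by
        rw [Int.isCoprime_iff_gcd_eq_one, Int.gcd_comm]
        exact q.reduced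
      exact (this.mul_left this).pow_right
    exact hc.dvd_of_dvd_mul_right ⟨n, by rw [h1]; ring⟩
  have hu := hm q.den (by exact_mod_cast hden)
  rw [Nat.isUnit_iff] at hu
  exact ⟨q.num, by exact (Rat.den_eq_one_iff q).1 hu⟩

/-- Complex conjugation preserves integrality, so the trace and the norm are rational and integral
over ℤ. -/
lemma exists_trace_norm {m : ℕ} (c : RingInt m) :
    ∃ (p q : ℚ) (A N : ℤ), intToComplex m c = p + q * sqrtNeg m ∧ (A : ℚ) = 2 * p ∧
      (N : ℚ) = p ^ 2 + m * q ^ 2 := by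
  have hint : IsIntegral ℤ (intToComplex m c) :=
    (NumberField.RingOfIntegers.isIntegral_coe c).map
      ((algebraMap (QField m) ℂ).toIntAlgHom)
  obtain ⟨p, q, hpq⟩ := exists_rat_form (m := m) (x := intToComplex m c) (Subtype.property _)
  have hstar : IsIntegral ℤ ((starRingEnd ℂ) (intToComplex m c)) :=
    hint.map ((starRingEnd ℂ).toIntAlgHom)
  have hs : (starRingEnd ℂ) (intToComplex m c) = p - q * sqrtNeg m := by
    rw [hpq]; simp [star_sqrtNeg, sub_eq_add_neg]
  obtain ⟨A, hA⟩ : ∃ n : ℤ, (n : ℚ) = 2 * p := by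
    apply exists_int_of_isIntegral_ratCast
    rw [show ((2 * p : ℚ) : ℂ) = intToComplex m c + (starRingEnd ℂ) (intToComplex m c) by
      rw [hs, hpq]; push_cast; ring]
    exact hint.add hstar
  obtain ⟨N, hN⟩ : ∃ n : ℤ, (n : ℚ) = p ^ 2 + m * q ^ 2 := by
    apply exists_int_of_isIntegral_ratCast
    rw [show ((p ^ 2 + m * q ^ 2 : ℚ) : ℂ) =
      intToComplex m c * (starRingEnd ℂ) (intToComplex m c) by
        rw [hs, hpq]; push_cast; linear_combination (q : ℂ) ^ 2 * sqrtNeg_sq m]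
    exact hint.mul hstar
  exact ⟨p, q, A, N, hpq, hA, hN⟩

lemma exists_int_form {m : ℕ} (hm : Squarefree m) (c : RingInt m) :
    ∃ a b : ℤ, intToComplex m c = a + b * omega m := by
  obtain ⟨p, q, A, N, hpq, hA, hN⟩ := exists_trace_norm c
  -- From trace A and norm N one gets m(2q)² = 4N - A², so 2q is an integer B. The rest is parity:
  -- A² + mB² ≡ 0 mod 4 with 4 ∤ m forces A and B both even, or both odd with m ≡ 3 mod 4.
  obtain ⟨B, hB⟩ : ∃ n : ℤ, (n : ℚ) = 2 * q := by
    refine exists_int_of_squarefree_mul_sq hm (n := 4 * N - A ^ 2) ?_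
    push_cast
    rw [hN, hA]; ring
  have hAB : A * A + m * (B * B) = 4 * N := by
    have : (A : ℚ) * A + m * (B * B) = 4 * N := by rw [hA, hB, hN]; ring
    exact_mod_cast this
  have hp : (p : ℂ) = A / 2 := by
    have : (p : ℚ) = A / 2 := by rw [hA]; ring
    rw [this]; push_cast; ring
  have hq : (q : ℂ) = B / 2 := by
    have : (q : ℚ) = B / 2 := by rw [hB]; ring
    rw [this]; push_cast; ring
  have h4 : m % 4 ≠ 0 := by
    intro h
    have : (2 * 2 : ℕ) ∣ m := Nat.dvd_of_mod_eq_zero h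
    exact absurd (hm 2 this) (by decide)
  obtain ⟨k, hk⟩ : ∃ k : ℤ, (m : ℤ) = 4 * k + (m % 4 : ℕ) := ⟨m / 4, by omega⟩
  have hmod : (A * A + (m % 4 : ℕ) * (B * B)) = 4 * (N - k * (B * B)) := by
    rw [hk] at hAB; linarith
  rw [hpq, hp, hq]
  generalize N - k * (B * B) = N' at hmod
  unfold omega
  rcases Int.even_or_odd' A with ⟨a, ha | ha⟩ <;> rcases Int.even_or_odd' B with ⟨b, hb | hb⟩
  · split_ifs with h
    · exact ⟨a + b, 2 * b, by rw [ha, hb]; push_cast; ring⟩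
    · exact ⟨a, b, by rw [ha, hb]; push_cast; ring⟩
  · exfalso
    have e1 : A * A = 4 * (a * a) := by rw [ha]; ring
    have e2 : B * B = 4 * (b * b + b) + 1 := by rw [hb]; ring
    rw [e1, e2] at hmod
    have : m % 4 = 1 ∨ m % 4 = 2 ∨ m % 4 = 3 := by omega
    rcases this with h | h | h <;> rw [h] at hmod <;> push_cast at hmod <;> omega
  · exfalso
    have e1 : A * A = 4 * (a * a + a) + 1 := by rw [ha]; ring
    have e2 : B * B = 4 * (b * b) := by rw [hb]; ring
    rw [e1, e2] at hmod
    have : m % 4 = 1 ∨ m % 4 = 2 ∨ m % 4 = 3 := by omega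
    rcases this with h | h | h <;> rw [h] at hmod <;> push_cast at hmod <;> omega
  · have e1 : A * A = 4 * (a * a + a) + 1 := by rw [ha]; ring
    have e2 : B * B = 4 * (b * b + b) + 1 := by rw [hb]; ring
    rw [e1, e2] at hmod
    split_ifs with h
    · exact ⟨a + b + 1, 2 * b + 1, by rw [ha, hb]; push_cast; ring⟩
    · exfalso
      have : m % 4 = 1 ∨ m % 4 = 2 := by omega
      rcases this with h | h <;> rw [h] at hmod <;> push_cast at hmod <;> omega

/-- The hypothesis that `m` is squarefree and that the only units of `𝒪` are `±1`. -/
structure Admissible (m : ℕ) : Prop where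
  squarefree : Squarefree m
  units : ∀ u : (RingInt m)ˣ, u = 1 ∨ u = -1

/-! ### Consequences of the units being ±1 -/

namespace Admissible

variable {m : ℕ} (H : Admissible m)
include H

lemma pos : 0 < m := Nat.pos_of_ne_zero H.squarefree.ne_zero

lemma ne_one : m ≠ 1 := by
  rintro rfl
  obtain ⟨w, hw⟩ := exists_omega 1
  -- Here ω = i, a unit of order 4.
  have hww : w * -w = 1 := by
    apply intToComplex_injective
    simp only [map_mul, map_neg, hw, map_one]
    have : omega 1 = sqrtNeg 1 := by simp [omega]
    rw [this]
    have := sqrtNeg_sq 1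
    push_cast at this
    linear_combination -this
  have him := omega_im_pos one_pos
  rw [← hw] at him
  rcases H.units ⟨w, -w, hww, by rw [mul_comm]; exact hww⟩ with h | h
  · have h : w = 1 := congrArg Units.val h
    simp [h] at him
  · have h : w = -1 := congrArg Units.val h
    simp [h] at him

lemma ne_three : m ≠ 3 := by
  rintro rfl
  obtain ⟨w, hw⟩ := exists_omega 3
  -- Here ω is a primitive cube root of unity, with inverse ω² = -ω - 1.
  have hww : w * (-w - 1) = 1 := by
    apply intToComplex_injective
    simp only [map_mul, map_neg, hw, map_one, map_sub]
    have : omega 3 = (-1 + sqrtNeg 3) / 2 := by simp [omega]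
    rw [this]
    have := sqrtNeg_sq 3
    push_cast at this
    linear_combination -this / 4
  have him := omega_im_pos (m := 3) (by norm_num)
  rw [← hw] at him
  rcases H.units ⟨w, -w - 1, hww, by rw [mul_comm]; exact hww⟩ with h | h
  · have h : w = 1 := congrArg Units.val h
    simp [h] at him
  · have h : w = -1 := congrArg Units.val h
    simp [h] at him

lemma omega_im_pos : 0 < (omega m).im := Bianchi.omega_im_pos H.pos

lemma omega_im_sq : 7 / 4 ≤ (omega m).im ^ 2 :=
  Bianchi.omega_im_sq H.squarefree H.ne_one H.ne_three

lemma unit_eq {d : RingInt m} (hd : IsUnit d) : d = 1 ∨ d = -1 := by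
  obtain ⟨u, rfl⟩ := hd
  rcases H.units u with h | h
  · left; rw [h]; rfl
  · right; rw [h]; rfl

end Admissible

/-- The squared modulus is the field norm, a positive rational integer. -/
lemma one_le_normSq_intToComplex {m : ℕ} {c : RingInt m} (hc : c ≠ 0) :
    1 ≤ Complex.normSq (intToComplex m c) := by
  obtain ⟨p, q, -, n, hpq, -, hn⟩ := exists_trace_norm c
  have hs : (starRingEnd ℂ) (intToComplex m c) = p - q * sqrtNeg m := by
    rw [hpq]; simp [star_sqrtNeg, sub_eq_add_neg]
  have hN : (Complex.normSq (intToComplex m c) : ℂ) = ((p ^ 2 + m * q ^ 2 : ℚ) : ℂ) := by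
    rw [← Complex.mul_conj, hs, hpq]
    push_cast
    linear_combination -(q : ℂ) ^ 2 * sqrtNeg_sq m
  rw [← hn] at hN
  have hN' : Complex.normSq (intToComplex m c) = n := by exact_mod_cast hN
  have hpos : 0 < Complex.normSq (intToComplex m c) := by
    rw [Complex.normSq_pos]
    exact fun h => hc (intToComplex_injective m (by rw [h, map_zero]))
  rw [hN'] at hpos ⊢
  have : 0 < n := by exact_mod_cast hpos
  exact_mod_cast this

/-! ## The polyhedron and the real face inside hyperbolic space -/

variable {m : ℕ}

/-- The point of hyperbolic space with given coordinates. -/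
def H3.ofCoord (z : ℂ) (ζ : ℝ) (h : 0 < ζ) : H3 := ⟨(z, ζ), h⟩

lemma H3.ofCoord_z (z : ℂ) (ζ : ℝ) (h : 0 < ζ) : (H3.ofCoord z ζ h).z = z := rfl

lemma H3.ofCoord_ζ (z : ℂ) (ζ : ℝ) (h : 0 < ζ) : (H3.ofCoord z ζ h).ζ = ζ := rfl

/-- The inclusion of the Bianchi group in `SL₂(ℂ)`. -/
def toC (γ : BianchiGroup m) : SL(2, ℂ) :=
  slToComplex (Matrix.SpecialLinearGroup.map (n := Fin 2) (algebraMap (RingInt m) (QField m)) γ)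

lemma toC_apply (γ : BianchiGroup m) (i j : Fin 2) : toC γ i j = intToComplex m (γ i j) := rfl

lemma smul_inner (γ : BianchiGroup m) (p : H3) :
    γ • (BorelSerre.inner p : BorelSerre m) = .inner (act (toC γ) p) := rfl

lemma det_entries {R : Type*} [CommRing R] (g : SL(2, R)) : g 0 0 * g 1 1 - g 0 1 * g 1 0 = 1 := by
  have := Matrix.det_fin_two g.1
  rw [g.2] at this
  exact this.symm

variable (m) in
/-- The points which do not lie strictly below a hemisphere attached to a unimodular row. -/
def IsHigh (p : H3) : Prop :=
  ∀ c d : RingInt m, IsCoprime c d → 1 ≤ factor (intToComplex m c) (intToComplex m d) p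

lemma mem_polyhedron {p : H3} : p ∈ polyhedron m ↔ p.z ∈ cuspParallelogram m ∧ IsHigh m p := Iff.rfl

/-- By the cocycle rule, when the factor of γ at p is 1, the row (c, d) has at γp the value that (c,
d)γ has at p; and γ permutes unimodular rows. -/
lemma IsHigh.act {p : H3} (hp : IsHigh m p) (γ : BianchiGroup m)
    (h : factor (toC γ 1 0) (toC γ 1 1) p = 1) : IsHigh m (act (toC γ) p) := by
  rintro c d ⟨u, v, huv⟩
  have := factor_mul_aux (toC γ) p (intToComplex m c) (intToComplex m d)
  rw [h, mul_one] at this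
  rw [this]
  simp only [toC_apply, ← map_mul, ← map_add]
  -- Bézout coefficients of (c, d)γ: the inverse of γ applied to the column (u, v).
  refine hp _ _ ⟨γ 1 1 * u - γ 0 1 * v, -γ 1 0 * u + γ 0 0 * v, ?_⟩
  have hdet := det_entries γ
  linear_combination (c * u + d * v) * hdet + huv

lemma IsHigh.one_le_factor {p : H3} (hp : IsHigh m p) (γ : BianchiGroup m) :
    1 ≤ factor (toC γ 1 0) (toC γ 1 1) p :=
  hp _ _ ⟨-γ 0 1, γ 0 0, by linear_combination det_entries γ⟩

/-- The row (-γ₁₀, γ₀₀) is the lower row of γ⁻¹. Its value at γp is at least 1, and its product with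
the factor of γ at p is 1. -/
lemma IsHigh.factor_le_one {p : H3} (γ : BianchiGroup m) (hp : IsHigh m (Bianchi.act (toC γ) p)) :
    factor (toC γ 1 0) (toC γ 1 1) p ≤ 1 := by
  have h1 := hp (-γ 1 0) (γ 0 0) ⟨γ 0 1, γ 1 1, by linear_combination det_entries γ⟩
  have h2 := factor_mul_aux (toC γ) p (intToComplex m (-γ 1 0)) (intToComplex m (γ 0 0))
  have h3 : factor (intToComplex m (-γ 1 0) * toC γ 0 0 + intToComplex m (γ 0 0) * toC γ 1 0)
      (intToComplex m (-γ 1 0) * toC γ 0 1 + intToComplex m (γ 0 0) * toC γ 1 1) p = 1 := by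
    simp only [toC_apply, ← map_mul, ← map_add]
    rw [show -γ 1 0 * γ 0 0 + γ 0 0 * γ 1 0 = 0 by ring,
      show -γ 1 0 * γ 0 1 + γ 0 0 * γ 1 1 = 1 by linear_combination det_entries γ]
    simp [factor]
  rw [h3] at h2
  have h4 := factor_pos (toC γ) p
  nlinarith

lemma act_z_of_lower_eq_zero {g : SL(2, ℂ)} {ε : ℂ} (h0 : g 1 0 = 0) (h1 : g 1 1 = ε)
    (hε : ε = 1 ∨ ε = -1) (p : H3) : act g p = .ofCoord (p.z + ε * g 0 1) p.ζ p.ζ_pos := by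
  have hd := det_entries g
  rw [h0, h1] at hd
  have hf : factor (g 1 0) (g 1 1) p = 1 := by
    rw [h0, h1]; rcases hε with rfl | rfl <;> simp [factor]
  apply H3.ext
  · rw [act_z, hf]
    unfold numer
    rw [h0, h1]
    rcases hε with rfl | rfl
    · simp at hd; simp [hd, H3.ofCoord_z]
    · have : g 0 0 = -1 := by linear_combination -hd
      simp [this, H3.ofCoord_z, add_comm]
  · rw [act_ζ, hf]; simp [H3.ofCoord_ζ]

/-- On the unit hemisphere the inversion z ↦ -1/z becomes the reflection z ↦ -z̄ and keeps the
height. -/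
lemma act_z_of_lower_eq_unit {g : SL(2, ℂ)} {ε : ℂ} (h0 : g 1 0 = ε) (h1 : g 1 1 = 0)
    (hε : ε = 1 ∨ ε = -1) {p : H3} (hp : Complex.normSq p.z + p.ζ ^ 2 = 1) :
    act g p = .ofCoord (ε * g 0 0 - (starRingEnd ℂ) p.z) p.ζ p.ζ_pos := by
  have hd := det_entries g
  rw [h0, h1] at hd
  have hε2 : ε * ε = 1 := by rcases hε with rfl | rfl <;> simp
  have hb : g 0 1 = -ε := by linear_combination -ε * hd - (g 0 1) * hε2
  have hf : factor (g 1 0) (g 1 1) p = 1 := by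
    rw [h0, h1]; rcases hε with rfl | rfl <;> simp [factor, hp]
  have hp' : p.z * (starRingEnd ℂ) p.z + (p.ζ : ℂ) ^ 2 = 1 := by
    rw [Complex.mul_conj]; exact_mod_cast hp
  have hεs : (starRingEnd ℂ) ε = ε := by rcases hε with rfl | rfl <;> simp
  apply H3.ext
  · rw [act_z, hf]
    unfold numer
    rw [h0, h1, hb]
    simp only [map_mul, map_add, map_zero, hεs, Complex.ofReal_one]
    change _ = ε * g 0 0 - (starRingEnd ℂ) p.z
    linear_combination ε * g 0 0 * hp' - (starRingEnd ℂ) p.z * hε2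
  · rw [act_ζ, hf]; simp [H3.ofCoord_ζ]

/-- The points of the real upper half-plane over the fundamental domain of `SL₂(ℤ)`. -/
def InFd (p : H3) : Prop := p.z.im = 0 ∧ |p.z.re| ≤ 1 / 2 ∧ 1 ≤ p.z.re ^ 2 + p.ζ ^ 2

/-- Expanding gives c²(x²+y²) + 2cdx + d² ≥ c² - |cd| + d², a positive definite integral form. -/
lemma one_le_intForm {x y : ℝ} (hx : |x| ≤ 1 / 2) (hxy : 1 ≤ x ^ 2 + y ^ 2) {c d : ℤ}
    (h : c ≠ 0 ∨ d ≠ 0) : 1 ≤ (c * x + d) ^ 2 + c ^ 2 * y ^ 2 := by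
  have hx' := abs_le.1 hx
  have hint : (1 : ℤ) ≤ c ^ 2 - |c * d| + d ^ 2 := by
    rw [abs_mul]
    by_cases hc : c = 0
    · have : 0 < |d| := abs_pos.2 (by tauto)
      rw [hc, ← sq_abs d]; simp; nlinarith
    · by_cases hd : d = 0
      · have : 0 < |c| := abs_pos.2 hc
        rw [hd, ← sq_abs c]; simp; nlinarith
      · have h1 : 0 < |c| := abs_pos.2 hc
        have h2 : 0 < |d| := abs_pos.2 hd
        rw [← sq_abs c, ← sq_abs d]
        nlinarith [sq_nonneg (|c| - |d|)]
  have hreal : (1 : ℝ) ≤ c ^ 2 - |(c : ℝ) * d| + d ^ 2 := by exact_mod_cast hint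
  have h2 : -|(c : ℝ) * d| ≤ 2 * (c * d) * x := by
    have := abs_mul ((c : ℝ) * d) x
    have h3 := neg_abs_le ((c : ℝ) * d * x)
    nlinarith [abs_nonneg ((c : ℝ) * d)]
  nlinarith [sq_nonneg (c : ℝ)]

/-- The hypothesis `hs` removes the two corners of the domain, where a row with c = ±1 and d = ±1
also attains 1. Away from them cd ≠ 0 makes the estimate c² - |cd| + d² ≥ 1 strict. -/
lemma intForm_eq_one {x y : ℝ} (hx : |x| ≤ 1 / 2) (hxy : 1 ≤ x ^ 2 + y ^ 2)
    (hs : |x| < 1 / 2 ∨ 1 < x ^ 2 + y ^ 2) {c d : ℤ}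
    (h : (c * x + d) ^ 2 + c ^ 2 * y ^ 2 = 1) :
    (c = 0 ∧ (d = 1 ∨ d = -1)) ∨ ((c = 1 ∨ c = -1) ∧ d = 0 ∧ x ^ 2 + y ^ 2 = 1) := by
  by_cases hc : c = 0
  · left
    refine ⟨hc, ?_⟩
    rw [hc] at h
    have : d ^ 2 = 1 := by simp at h; exact_mod_cast (show (d : ℝ) ^ 2 = 1 by simpa using h)
    exact mul_self_eq_one_iff.1 (by rw [← sq, this])
  by_cases hd : d = 0
  · right
    have h1 : (1 : ℝ) ≤ (c : ℝ) ^ 2 := by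
      exact_mod_cast (show 1 ≤ c ^ 2 from Int.one_le_abs hc |> fun h => by nlinarith [sq_abs c])
    rw [hd] at h
    push_cast at h
    have hN : x ^ 2 + y ^ 2 = 1 := by nlinarith
    have h2 : (c : ℝ) ^ 2 = 1 := by nlinarith
    exact ⟨mul_self_eq_one_iff.1 (by rw [← sq]; exact_mod_cast h2), hd, hN⟩
  exfalso
  have hcd : (1 : ℝ) ≤ |(c : ℝ) * d| := by
    exact_mod_cast Int.one_le_abs (mul_ne_zero hc hd)
  have h3 : -(2 * |x| * |(c : ℝ) * d|) ≤ 2 * (c * d) * x := by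
    have := abs_mul ((c : ℝ) * d) x
    have h3 := neg_abs_le ((c : ℝ) * d * x)
    nlinarith
  have h4 : 2 * |(c : ℝ) * d| ≤ c ^ 2 + d ^ 2 := by
    rw [abs_mul, ← sq_abs (c : ℝ), ← sq_abs (d : ℝ)]
    nlinarith [sq_nonneg (|(c : ℝ)| - |(d : ℝ)|)]
  have h1 : (1 : ℝ) ≤ (c : ℝ) ^ 2 := by
    exact_mod_cast (show 1 ≤ c ^ 2 from Int.one_le_abs hc |> fun h => by nlinarith [sq_abs c])
  rcases hs with hs | hs
  · nlinarith
  · nlinarith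

/-- For real z the real parts are dropped: Im(cz + d) = (bz + b') Im w, and |c|² ≥ b² (Im w)². -/
lemma factor_add_mul_omega {p : H3} (hp : p.z.im = 0) (a b a' b' : ℤ) (w : ℂ) :
    ((b * p.z.re + b') ^ 2 + b ^ 2 * p.ζ ^ 2) * w.im ^ 2 ≤
      factor (a + b * w) (a' + b' * w) p := by
  unfold factor
  rw [Complex.normSq_apply, Complex.normSq_apply]
  simp [hp]
  nlinarith [sq_nonneg (((a : ℝ) + b * w.re) * p.z.re + (a' + b' * w.re)),
    mul_nonneg (sq_nonneg ((a : ℝ) + b * w.re)) (sq_nonneg p.ζ)]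

lemma factor_int {p : H3} (hp : p.z.im = 0) (a a' : ℤ) :
    factor a a' p = (a * p.z.re + a') ^ 2 + a ^ 2 * p.ζ ^ 2 := by
  unfold factor
  rw [Complex.normSq_apply, Complex.normSq_apply]
  simp [hp]
  ring

/-! ### The polyhedron over the real half-plane -/

namespace Admissible

variable (H : Admissible m)
include H

/-- A row with a non-zero ω-part has value at least (Im ω)² ≥ 7/4. This reduces every question about
rows of value at most 1 to `SL₂(ℤ)`. -/
lemma factor_cases {p : H3} (hp : InFd p) (c d : RingInt m) (hcd : c ≠ 0 ∨ d ≠ 0) :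
    1 < factor (intToComplex m c) (intToComplex m d) p ∨
    ∃ a b : ℤ, c = a ∧ d = b ∧ factor (intToComplex m c) (intToComplex m d) p =
      (a * p.z.re + b) ^ 2 + a ^ 2 * p.ζ ^ 2 ∧ (a ≠ 0 ∨ b ≠ 0) := by
  obtain ⟨a, b, hc⟩ := exists_int_form H.squarefree c
  obtain ⟨a', b', hd⟩ := exists_int_form H.squarefree d
  by_cases hb : b = 0 ∧ b' = 0
  · right
    obtain ⟨rfl, rfl⟩ := hb
    have hc' : c = a := intToComplex_injective m (by rw [hc]; simp)
    have hd' : d = a' := intToComplex_injective m (by rw [hd]; simp)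
    refine ⟨a, a', hc', hd', ?_, ?_⟩
    · rw [hc, hd, ← factor_int hp.1]; simp
    · contrapose! hcd
      rw [hc', hd', hcd.1, hcd.2]; simp
  · left
    have h1 := factor_add_mul_omega hp.1 a b a' b' (omega m)
    rw [← hc, ← hd] at h1
    have h2 := one_le_intForm hp.2.1 hp.2.2 (c := b) (d := b') (by tauto)
    have h3 := H.omega_im_sq
    nlinarith

lemma isHigh_of_inFd {p : H3} (hp : InFd p) : IsHigh m p := by
  intro c d hcd
  rcases H.factor_cases hp c d (by
    by_contra! h
    rw [h.1, h.2] at hcd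
    exact not_isCoprime_zero_zero hcd) with h | ⟨a, b, -, -, h, hab⟩
  · exact h.le
  · rw [h]; exact one_le_intForm hp.2.1 hp.2.2 hab

lemma factor_eq_one {p : H3} (hp : InFd p) (hs : |p.z.re| < 1 / 2 ∨ 1 < p.z.re ^ 2 + p.ζ ^ 2)
    (γ : BianchiGroup m) (h : factor (toC γ 1 0) (toC γ 1 1) p = 1) :
    (γ 1 0 = 0 ∧ (γ 1 1 = 1 ∨ γ 1 1 = -1)) ∨
    ((γ 1 0 = 1 ∨ γ 1 0 = -1) ∧ γ 1 1 = 0 ∧ p.z.re ^ 2 + p.ζ ^ 2 = 1) := by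
  have hcd : γ 1 0 ≠ 0 ∨ γ 1 1 ≠ 0 := by
    by_contra! h'
    have := det_entries γ
    rw [h'.1, h'.2] at this
    simp at this
  rw [toC_apply, toC_apply] at h
  rcases H.factor_cases hp _ _ hcd with h' | ⟨a, b, ha, hb, h', -⟩
  · exact absurd h h'.ne'
  · rw [h] at h'
    rw [ha, hb]
    rcases intForm_eq_one hp.2.1 hp.2.2 hs h'.symm with ⟨rfl, rfl | rfl⟩ | ⟨rfl | rfl, rfl, h⟩
    · left; simp
    · left; simp
    · right; simpa using h
    · right; simpa using h

lemma mem_cuspParallelogram {s t : ℝ} :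
    (s + t * omega m : ℂ) ∈ cuspParallelogram m ↔ |s| ≤ 1 / 2 ∧ 0 ≤ t ∧ t ≤ 1 := by
  constructor
  · rintro ⟨s', t', h1, h2, h3, h4⟩
    have him := congrArg Complex.im h4
    have hre := congrArg Complex.re h4
    simp at him hre
    have ht : t = t' := by
      rcases him with h | h
      · exact h
      · exact absurd h H.omega_im_pos.ne'
    subst ht
    have hs : s = s' := by linarith
    subst hs
    exact ⟨h1, h2, h3⟩
  · rintro ⟨h1, h2, h3⟩
    exact ⟨s, t, h1, h2, h3, rfl⟩

lemma ofReal_add_int_mem {x : ℝ} {a b : ℤ} :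
    (x + (a + b * omega m) : ℂ) ∈ cuspParallelogram m ↔ |x + a| ≤ 1 / 2 ∧ 0 ≤ b ∧ b ≤ 1 := by
  have : (x + (a + b * omega m) : ℂ) = ((x + a : ℝ) : ℂ) + ((b : ℝ) : ℂ) * omega m := by
    push_cast; ring
  rw [this, H.mem_cuspParallelogram]
  norm_cast

lemma ofReal_mem {x : ℝ} : (x : ℂ) ∈ cuspParallelogram m ↔ |x| ≤ 1 / 2 := by
  have := H.ofReal_add_int_mem (x := x) (a := 0) (b := 0)
  simpa using this

/-- Both t and t + 1 lie in [0, 1], so t = 0. This is how membership in translates of P recognises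
the real half-plane. -/
lemma im_eq_zero {z : ℂ} (h : z ∈ cuspParallelogram m) (h' : z + omega m ∈ cuspParallelogram m) :
    z.im = 0 := by
  obtain ⟨s, t, h1, h2, h3, rfl⟩ := h
  have : (s + t * omega m + omega m : ℂ) = s + ((t + 1 : ℝ) : ℂ) * omega m := by push_cast; ring
  rw [this, H.mem_cuspParallelogram] at h'
  have : t = 0 := by linarith [h'.2.2]
  simp [this]

lemma eq_ofReal {z : ℂ} (h : z ∈ cuspParallelogram m) (h' : z.im = 0) :
    z = z.re ∧ |z.re| ≤ 1 / 2 := by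
  have : z = z.re := by apply Complex.ext <;> simp [h']
  exact ⟨this, H.ofReal_mem.1 (by rw [← this]; exact h)⟩

lemma mem_polyhedron_of_inFd {p : H3} (hp : InFd p) : p ∈ polyhedron m := by
  refine ⟨?_, H.isHigh_of_inFd hp⟩
  have : p.z = p.z.re := by apply Complex.ext <;> simp [hp.1]
  rw [this, H.ofReal_mem]
  exact hp.2.1

lemma mem_realFace {p : H3} : p ∈ realFace m ↔ InFd p := by
  constructor
  · rintro ⟨h1, h2⟩
    refine ⟨h2, (H.eq_ofReal h1.1 h2).2, ?_⟩
    have h2 : p.z.im = 0 := h2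
    have := h1.2 1 0 isCoprime_one_left
    simp only [factor, map_one, map_zero, one_mul, add_zero] at this
    rw [Complex.normSq_apply, h2] at this
    nlinarith
  · intro h
    exact ⟨H.mem_polyhedron_of_inFd h, h.1⟩

/-- Two points of the face lying on the same edge, or both in its interior. -/
lemma transfer {p p' : H3} (hp : InFd p) (hp' : InFd p')
    (h : (1 < p.z.re ^ 2 + p.ζ ^ 2 ∧ 1 < p'.z.re ^ 2 + p'.ζ ^ 2 ∧
        (p.z.re = p'.z.re ∨ (|p.z.re| < 1 / 2 ∧ |p'.z.re| < 1 / 2))) ∨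
      (p'.z.re ^ 2 + p'.ζ ^ 2 = 1 ∧ 0 < |p.z.re| ∧ |p.z.re| < 1 / 2 ∧ |p'.z.re| < 1 / 2))
    (γ : BianchiGroup m) :
    (act (toC γ) p ∈ polyhedron m → act (toC γ) p' ∈ polyhedron m) ∧
    (act (toC γ) p = p → act (toC γ) p' = p') := by
  have hs : |p.z.re| < 1 / 2 ∨ 1 < p.z.re ^ 2 + p.ζ ^ 2 := by tauto
  have hx : p.z.re = p'.z.re ∨ (|p.z.re| < 1 / 2 ∧ |p'.z.re| < 1 / 2) := by tauto
  have hpz : p.z = p.z.re := by apply Complex.ext <;> simp [hp.1]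
  have hpz' : p'.z = p'.z.re := by apply Complex.ext <;> simp [hp'.1]
  have hP := H.mem_polyhedron_of_inFd hp
  have habs : ∀ n : ℤ, |p.z.re + n| ≤ 1 / 2 → |p'.z.re + n| ≤ 1 / 2 := by
    -- A non-zero integer shift moves a number of absolute value below 1/2 out of [-1/2, 1/2], so
    -- only n = 0 occurs in the second case.
    intro n hn
    rcases hx with hx | ⟨hx, hx'⟩
    · rwa [← hx]
    · have h1 := abs_le.1 hn
      have h2 := abs_lt.1 hx
      have h3 : (n : ℝ) < 1 := by linarith
      have h4 : (-1 : ℝ) < n := by linarith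
      have h3' : n < 1 := by exact_mod_cast h3
      have h4' : -1 < n := by exact_mod_cast h4
      have : n = 0 := by omega
      rw [this]; simpa using hx'.le
  -- If p and γp both lie in P, the factor is at least 1 and at most 1. When it is not 1, both
  -- implications are vacuous, as a fixed p would also give γp in P.
  by_cases hf : factor (toC γ 1 0) (toC γ 1 1) p = 1
  swap
  · have key : act (toC γ) p ∉ polyhedron m := fun h =>
      hf (le_antisymm (IsHigh.factor_le_one γ h.2) (IsHigh.one_le_factor hP.2 γ))
    exact ⟨fun h => absurd h key, fun h => absurd (h.symm ▸ hP : act (toC γ) p ∈ polyhedron m) key⟩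
  rcases H.factor_eq_one hp hs γ hf with ⟨h0, h1⟩ | ⟨h0, h1, hN⟩
  · have hε : toC γ 1 1 = 1 ∨ toC γ 1 1 = -1 := by
      rw [toC_apply]; rcases h1 with h1 | h1 <;> rw [h1] <;> simp
    have h0' : toC γ 1 0 = 0 := by rw [toC_apply, h0, map_zero]
    have e := act_z_of_lower_eq_zero h0' rfl hε p
    have e' := act_z_of_lower_eq_zero h0' rfl hε p'
    have hf' : factor (toC γ 1 0) (toC γ 1 1) p' = 1 := by
      rw [h0']; rcases hε with h | h <;> rw [h] <;> simp [factor]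
    have hb : toC γ 1 1 * toC γ 0 1 = intToComplex m (γ 1 1 * γ 0 1) := by
      rw [map_mul]; rfl
    obtain ⟨n, k, hnk⟩ := exists_int_form H.squarefree (γ 1 1 * γ 0 1)
    constructor
    · intro h
      refine ⟨?_, (H.isHigh_of_inFd hp').act γ hf'⟩
      have h := h.1
      rw [e] at h
      rw [e']
      change p.z + _ ∈ _ at h
      change p'.z + _ ∈ _
      rw [hb, hnk, hpz, H.ofReal_add_int_mem] at h
      rw [hb, hnk, hpz', H.ofReal_add_int_mem]
      exact ⟨habs n h.1, h.2⟩
    · intro h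
      rw [e] at h
      rw [e']
      have h := congrArg H3.z h
      change p.z + _ = p.z at h
      have : toC γ 1 1 * toC γ 0 1 = 0 := by simpa using h
      apply H3.ext
      · change p'.z + _ = p'.z
        rw [this, add_zero]
      · rfl
  -- The row (±1, 0) puts p on the unit hemisphere, which leaves the second alternative; γ then acts
  -- on p and p' as z ↦ n + kω - z̄.
  · rcases h with ⟨h, -⟩ | ⟨hN', hx0, hx1, hx1'⟩
    · exact absurd hN h.ne'
    have hε : toC γ 1 0 = 1 ∨ toC γ 1 0 = -1 := by
      rw [toC_apply]; rcases h0 with h0 | h0 <;> rw [h0] <;> simp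
    have h1' : toC γ 1 1 = 0 := by rw [toC_apply, h1, map_zero]
    have hnorm : ∀ q : H3, q.z.im = 0 → q.z.re ^ 2 + q.ζ ^ 2 = 1 →
        Complex.normSq q.z + q.ζ ^ 2 = 1 := by
      intro q hq hq'
      rw [Complex.normSq_apply, hq]; linarith
    have e := act_z_of_lower_eq_unit rfl h1' hε (hnorm p hp.1 hN)
    have e' := act_z_of_lower_eq_unit rfl h1' hε (hnorm p' hp'.1 hN')
    have hf' : factor (toC γ 1 0) (toC γ 1 1) p' = 1 := by
      have := hnorm p' hp'.1 hN'
      rw [h1']; rcases hε with h | h <;> rw [h] <;> simp [factor, this]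
    have hb : toC γ 1 0 * toC γ 0 0 = intToComplex m (γ 1 0 * γ 0 0) := by
      rw [map_mul]; rfl
    obtain ⟨n, k, hnk⟩ := exists_int_form H.squarefree (γ 1 0 * γ 0 0)
    have hz : ∀ q : H3, q.z = q.z.re → toC γ 1 0 * toC γ 0 0 - (starRingEnd ℂ) q.z =
        ((-q.z.re : ℝ) : ℂ) + (n + k * omega m) := by
      intro q hq
      rw [hq, Complex.conj_ofReal, hb, hnk]; simp; ring
    constructor
    · intro h
      refine ⟨?_, (H.isHigh_of_inFd hp').act γ hf'⟩
      have h := h.1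
      rw [e] at h
      rw [e']
      change toC γ 1 0 * toC γ 0 0 - (starRingEnd ℂ) p.z ∈ _ at h
      change toC γ 1 0 * toC γ 0 0 - (starRingEnd ℂ) p'.z ∈ _
      rw [hz p hpz, H.ofReal_add_int_mem] at h
      rw [hz p' hpz', H.ofReal_add_int_mem]
      refine ⟨?_, h.2⟩
      have h2 := abs_le.1 h.1
      have h3 := abs_lt.1 hx1
      have h3 : (n : ℝ) < 1 := by linarith
      have h4 : (-1 : ℝ) < n := by linarith
      have h3' : n < 1 := by exact_mod_cast h3
      have h4' : -1 < n := by exact_mod_cast h4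
      have : n = 0 := by omega
      rw [this]; simpa using hx1'.le
    · intro h
      -- A fixed point would satisfy 2 Re z = n with |n| < 1, so Re z = 0: the elliptic point i,
      -- which `hx0` excludes.
      exfalso
      rw [e] at h
      have h := congrArg H3.z h
      change toC γ 1 0 * toC γ 0 0 - (starRingEnd ℂ) p.z = p.z at h
      rw [hz p hpz] at h
      have him := congrArg Complex.im h
      have hre := congrArg Complex.re h
      simp [hp.1] at him
      have hk : k = 0 := by
        rcases him with h | h
        · exact h
        · exact absurd h H.omega_im_pos.ne'
      rw [hk] at hre
      simp at hre
      have h3 := abs_lt.1 hx1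
      have h4 : (n : ℝ) < 1 := by linarith
      have h5 : (-1 : ℝ) < n := by linarith
      have h4' : n < 1 := by exact_mod_cast h4
      have h5' : -1 < n := by exact_mod_cast h5
      have : n = 0 := by omega
      rw [this] at hre
      have : p.z.re = 0 := by push_cast at hre; linarith
      rw [this] at hx0
      simp at hx0

end Admissible

/-! ## The topology of the bordification -/

lemma isOpen_borelSerre_iff {U : Set (BorelSerre m)} :
    IsOpen U ↔ ∀ g : SL(2, QField m),
      IsOpen ((fun x : ℂ × NNReal => g • (chartInfinity x : BorelSerre m)) ⁻¹' U) := by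
  rw [isOpen_iSup_iff]
  rfl

lemma continuous_smul_chartInfinity (g : SL(2, QField m)) :
    Continuous (fun x : ℂ × NNReal => g • (chartInfinity x : BorelSerre m)) :=
  continuous_def.2 fun _ hU => isOpen_borelSerre_iff.1 hU g

lemma continuous_chartInfinity : Continuous (chartInfinity : ℂ × NNReal → BorelSerre m) := by
  simpa using continuous_smul_chartInfinity (m := m) 1

lemma continuous_smul_borelSerre (g : SL(2, QField m)) :
    Continuous (fun x : BorelSerre m => g • x) := by
  refine continuous_def.2 fun U hU => isOpen_borelSerre_iff.2 fun g' => ?_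
  have := isOpen_borelSerre_iff.1 hU (g * g')
  simp only [mul_smul] at this
  exact this

lemma chartInfinity_zero (z : ℂ) : chartInfinity (z, 0) = (atInfinity z : BorelSerre m) := by
  simp [chartInfinity]

/-- The point of hyperbolic space with coordinates `z` and `1/ζ`. -/
def pointOfInv (x : ℂ × NNReal) (h : x.2 ≠ 0) : H3 :=
  ⟨(x.1, ((x.2 : ℝ))⁻¹), inv_pos.2 (NNReal.coe_pos.2 (pos_iff_ne_zero.2 h))⟩

lemma chartInfinity_of_ne {x : ℂ × NNReal} (h : x.2 ≠ 0) :
    chartInfinity x = (BorelSerre.inner (pointOfInv x h) : BorelSerre m) := by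
  unfold chartInfinity
  rw [dif_neg h]
  rfl

/-- The coordinates `z` and `1/ζ`. -/
def invCoord (p : H3) : ℂ × NNReal := (p.z, ⟨p.ζ⁻¹, (inv_pos.2 p.ζ_pos).le⟩)

lemma continuous_z : Continuous H3.z := continuous_fst.comp continuous_subtype_val

lemma continuous_ζ : Continuous H3.ζ := continuous_snd.comp continuous_subtype_val

lemma continuous_invCoord : Continuous invCoord :=
  continuous_z.prodMk (Continuous.subtype_mk (continuous_ζ.inv₀ fun p => p.ζ_pos.ne') _)

lemma invCoord_ne (p : H3) : (invCoord p).2 ≠ 0 := by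
  intro h
  have := congrArg NNReal.toReal h
  exact (inv_pos.2 p.ζ_pos).ne' this

lemma pointOfInv_invCoord (p : H3) : pointOfInv (invCoord p) (invCoord_ne p) = p := by
  apply H3.ext
  · rfl
  · exact inv_inv p.ζ

lemma chartInfinity_invCoord (p : H3) : chartInfinity (invCoord p) = (.inner p : BorelSerre m) := by
  rw [chartInfinity_of_ne (invCoord_ne p), pointOfInv_invCoord]

lemma invCoord_pointOfInv (x : ℂ × NNReal) (h : x.2 ≠ 0) : invCoord (pointOfInv x h) = x := by
  refine Prod.ext rfl (NNReal.coe_injective ?_)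
  exact inv_inv (x.2 : ℝ)

lemma inner_injective : Function.Injective (BorelSerre.inner : H3 → BorelSerre m) :=
  fun _ _ h => BorelSerre.inner.inj h

lemma atInfinity_injective : Function.Injective (atInfinity : ℂ → BorelSerre m) := by
  intro z w h
  exact OnePoint.coe_injective (BorelSerre.bdry.inj h).2

lemma inner_ne_atInfinity (p : H3) (z : ℂ) : (.inner p : BorelSerre m) ≠ atInfinity z :=
  fun h => nomatch h

lemma chartInfinity_injective : Function.Injective (chartInfinity : ℂ × NNReal → BorelSerre m) := by
  rintro ⟨z, r⟩ ⟨z', r'⟩ h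
  by_cases hr : r = 0 <;> by_cases hr' : r' = 0
  · subst hr hr'
    rw [chartInfinity_zero, chartInfinity_zero] at h
    rw [atInfinity_injective h]
  · subst hr
    rw [chartInfinity_zero, chartInfinity_of_ne hr'] at h
    exact absurd h.symm (inner_ne_atInfinity _ _)
  · subst hr'
    rw [chartInfinity_zero, chartInfinity_of_ne hr] at h
    exact absurd h (inner_ne_atInfinity _ _)
  · rw [chartInfinity_of_ne hr, chartInfinity_of_ne hr'] at h
    rw [← invCoord_pointOfInv (z, r) hr, ← invCoord_pointOfInv (z', r') hr', inner_injective h]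

lemma continuous_factor (c d : ℂ) : Continuous (factor c d) := by
  unfold factor
  have := continuous_z
  have := continuous_ζ
  exact (Complex.continuous_normSq.comp (by fun_prop)).add (by fun_prop)

lemma continuous_act (g : SL(2, ℂ)) : Continuous (act g) := by
  have hz := continuous_z
  have hζ := continuous_ζ
  have hn : Continuous (numer g) := by
    unfold numer
    have : Continuous fun p : H3 => (starRingEnd ℂ) (g 1 0 * p.z + g 1 1) :=
      Complex.continuous_conj.comp (by fun_prop)
    fun_prop
  have hf := continuous_factor (g 1 0) (g 1 1)
  refine Continuous.subtype_mk (Continuous.prodMk ?_ ?_) _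
  · exact hn.div (Complex.continuous_ofReal.comp hf) fun p => by
      exact_mod_cast (factor_pos g p).ne'
  · exact hζ.div hf fun p => (factor_pos g p).ne'

lemma smul_inner_K (g : SL(2, QField m)) (p : H3) :
    g • (BorelSerre.inner p : BorelSerre m) = .inner (act (slToComplex g) p) := rfl

lemma smul_bdry (g : SL(2, QField m)) (c : OnePoint (QField m)) (e h) :
    g • (BorelSerre.bdry c e h : BorelSerre m) =
      .bdry (Matrix.SpecialLinearGroup.toGL g • c)
        (Matrix.SpecialLinearGroup.toGL (slToComplex g) • e) (by
          rw [cuspToComplex_smul]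
          exact fun h' => h (MulAction.injective _ h')) := rfl

/-- In every chart the points of hyperbolic space are those with r ≠ 0, an open set on which the
passage to the coordinates (z, ζ) is continuous. -/
lemma isOpenMap_inner : IsOpenMap (BorelSerre.inner : H3 → BorelSerre m) := by
  intro U hU
  refine isOpen_borelSerre_iff.2 fun g => ?_
  let f : {x : ℂ × NNReal // x.2 ≠ 0} → H3 := fun x =>
    act (slToComplex g) (pointOfInv x.1 x.2)
  have hf : Continuous f := by
    refine (continuous_act _).comp (Continuous.subtype_mk (Continuous.prodMk ?_ ?_) _)
    · exact continuous_fst.comp continuous_subtype_val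
    · exact ((NNReal.continuous_coe.comp continuous_snd).comp continuous_subtype_val).inv₀
        fun x => NNReal.coe_ne_zero.2 x.2
  have hopen : IsOpen {x : ℂ × NNReal | x.2 ≠ 0} := isOpen_ne_fun continuous_snd continuous_const
  have := hopen.isOpenMap_subtype_val _ (hU.preimage hf)
  convert this using 1
  ext ⟨z, r⟩
  simp only [Set.mem_preimage, Set.mem_image, Subtype.exists]
  constructor
  · rintro ⟨p, hp, h⟩
    by_cases hr : r = 0
    · subst hr
      rw [chartInfinity_zero] at h
      exact nomatch h
    · refine ⟨(z, r), hr, ?_, rfl⟩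
      rw [chartInfinity_of_ne hr, smul_inner_K] at h
      change act _ _ ∈ U
      rw [← inner_injective h]
      exact hp
  · rintro ⟨x, hx, h, rfl⟩
    exact ⟨_, h, by rw [chartInfinity_of_ne hx]; rfl⟩

lemma slToComplex_apply (g : SL(2, QField m)) (i j : Fin 2) :
    slToComplex g i j = algebraMap (QField m) ℂ (g i j) := rfl

lemma toGL_smul_infty {K : Type*} [Field K] [DecidableEq K] (g : SL(2, K)) :
    Matrix.SpecialLinearGroup.toGL g • (∞ : OnePoint K) = ∞ ↔ g 1 0 = 0 :=
  OnePoint.smul_infty_eq_self_iff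

lemma smul_atInfinity_of_eq_zero {g : SL(2, QField m)} (h : g 1 0 = 0) (z : ℂ) :
    g • (atInfinity z : BorelSerre m) =
      atInfinity ((slToComplex g 0 0 * z + slToComplex g 0 1) / slToComplex g 1 1) := by
  classical
  have e := smul_bdry g ∞ z (OnePoint.infty_ne_coe z)
  have h1 := (toGL_smul_infty g).2 h
  have h2 : Matrix.SpecialLinearGroup.toGL (slToComplex g) • (z : OnePoint ℂ) =
      ((slToComplex g 0 0 * z + slToComplex g 0 1) / slToComplex g 1 1 : ℂ) := by
    rw [OnePoint.smul_some_eq_ite]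
    have h0 : slToComplex g 1 0 = 0 := by rw [slToComplex_apply, h, map_zero]
    have hd := det_entries (slToComplex g)
    rw [h0] at hd
    have h3 : slToComplex g 1 1 ≠ 0 := by
      intro h3
      rw [h3] at hd
      simp at hd
    change (if slToComplex g 1 0 * z + slToComplex g 1 1 = 0 then _ else
      (((slToComplex g 0 0 * z + slToComplex g 0 1) /
        (slToComplex g 1 0 * z + slToComplex g 1 1) : ℂ) : OnePoint ℂ)) = _
    rw [h0]
    simp [h3]
  simp only [h1, h2] at e
  exact e

lemma smul_atInfinity_notMem {g : SL(2, QField m)} (h : g 1 0 ≠ 0) (z : ℂ) :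
    g • (atInfinity z : BorelSerre m) ∉ planeAtInfinity m := by
  classical
  rintro ⟨w, hw⟩
  exact h ((toGL_smul_infty g).1 (BorelSerre.bdry.inj hw).1.symm)

lemma atInfinity_notMem_innerPart (z : ℂ) : (atInfinity z : BorelSerre m) ∉ innerPart m := by
  rintro ⟨p, hp⟩
  exact inner_ne_atInfinity p z hp

lemma smul_mem_innerPart (g : SL(2, QField m)) (x : BorelSerre m) :
    g • x ∈ innerPart m ↔ x ∈ innerPart m := by
  have key : ∀ (g : SL(2, QField m)) (x : BorelSerre m), x ∈ innerPart m → g • x ∈ innerPart m := by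
    rintro g x ⟨p, rfl⟩
    exact ⟨_, rfl⟩
  exact ⟨fun h => by simpa using key g⁻¹ _ h, key g x⟩

/-- `SL₂(K)` is transitive on cusps: the matrix with columns (k, 1) and (-1, 0) sends ∞ to k. -/
lemma mem_planeAtInfinity_or {x : BorelSerre m} (hx : x ∉ innerPart m) :
    ∃ (g : SL(2, QField m)) (z : ℂ), x = g • atInfinity z ∧ (x ∉ planeAtInfinity m → g 1 0 ≠ 0) := by
  classical
  have hinf : ∀ (e : OnePoint ℂ) (h : cuspToComplex m ∞ ≠ e),
      ∃ z, BorelSerre.bdry ∞ e h = (atInfinity z : BorelSerre m) := by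
    intro e h
    induction e using OnePoint.rec with
    | infty => exact absurd rfl h
    | coe z => exact ⟨z, rfl⟩
  rcases x with p | ⟨c, e, h⟩
  · exact absurd ⟨p, rfl⟩ hx
  induction c using OnePoint.rec with
  | infty =>
    obtain ⟨z, hz⟩ := hinf e h
    exact ⟨1, z, by rw [one_smul, hz], fun h' => absurd ⟨z, hz.symm⟩ h'⟩
  | coe k =>
    let g : SL(2, QField m) := ⟨!![k, -1; 1, 0], by simp [Matrix.det_fin_two]⟩
    have hg : Matrix.SpecialLinearGroup.toGL g⁻¹ • (k : OnePoint (QField m)) = ∞ := by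
      rw [map_inv, inv_smul_eq_iff, OnePoint.smul_infty_eq_ite]
      change _ = if (1 : QField m) = 0 then _ else ((k / 1 : QField m) : OnePoint (QField m))
      simp
    have e1 := smul_bdry g⁻¹ k e h
    simp only [hg] at e1
    obtain ⟨z, hz⟩ := hinf _ (by
      rw [← hg, cuspToComplex_smul]
      exact fun h' => h (MulAction.injective _ h'))
    rw [hz] at e1
    refine ⟨g, z, by rw [← e1, smul_inv_smul], fun _ => ?_⟩
    exact one_ne_zero

/-- The action of an element fixing `∞` in the chart at `∞`. -/
lemma smul_chartInfinity_of_eq_zero {g : SL(2, QField m)} (h : g 1 0 = 0) (x : ℂ × NNReal) :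
    g • (chartInfinity x : BorelSerre m) =
      chartInfinity ((slToComplex g 0 0 * x.1 + slToComplex g 0 1) / slToComplex g 1 1,
        x.2 * ‖slToComplex g 1 1‖₊ ^ 2) := by
  obtain ⟨z, r⟩ := x
  have h0 : slToComplex g 1 0 = 0 := by rw [slToComplex_apply, h, map_zero]
  have hd := det_entries (slToComplex g)
  rw [h0] at hd
  have h3 : slToComplex g 1 1 ≠ 0 := by
    intro h3
    rw [h3] at hd
    simp at hd
  by_cases hr : r = 0
  · subst hr
    rw [chartInfinity_zero, smul_atInfinity_of_eq_zero h]
    simp [chartInfinity_zero]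
  · have hr' : r * ‖slToComplex g 1 1‖₊ ^ 2 ≠ 0 := by simp [hr, h3]
    rw [chartInfinity_of_ne hr, chartInfinity_of_ne hr', smul_inner_K]
    congr 1
    have hf : factor (slToComplex g 1 0) (slToComplex g 1 1) (pointOfInv (z, r) hr) =
        ‖slToComplex g 1 1‖ ^ 2 := by
      rw [h0]; simp [factor, Complex.normSq_eq_norm_sq]
    have hc : ((‖slToComplex g 1 1‖ ^ 2 : ℝ) : ℂ) =
        slToComplex g 1 1 * (starRingEnd ℂ) (slToComplex g 1 1) := by
      rw [Complex.mul_conj, Complex.normSq_eq_norm_sq]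
    have h4 : (starRingEnd ℂ) (slToComplex g 1 1) ≠ 0 := by simpa using h3
    apply H3.ext
    · rw [act_z, hf, hc]
      unfold numer
      rw [h0]
      change _ = (slToComplex g 0 0 * z + slToComplex g 0 1) / slToComplex g 1 1
      simp only [zero_mul, zero_add, map_zero, mul_zero, add_zero]
      rw [mul_div_mul_right _ _ h4]
      rfl
    · rw [act_ζ, hf]
      change (r : ℝ)⁻¹ / _ = ((r * ‖slToComplex g 1 1‖₊ ^ 2 : NNReal) : ℝ)⁻¹
      push_cast
      rw [mul_inv, div_eq_mul_inv]

lemma smul_chartInfinity_zero_notMem {g : SL(2, QField m)} (h : g 1 0 ≠ 0) (z : ℂ)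
    (x : ℂ × NNReal) : g • (chartInfinity (z, 0) : BorelSerre m) ≠ chartInfinity x := by
  rw [chartInfinity_zero]
  intro hx
  by_cases hr : x.2 = 0
  · have : x = (x.1, 0) := by rw [← hr]
    rw [this, chartInfinity_zero] at hx
    exact smul_atInfinity_notMem h z ⟨_, hx.symm⟩
  · rw [chartInfinity_of_ne hr] at hx
    exact atInfinity_notMem_innerPart z ((smul_mem_innerPart g _).1 ⟨_, hx.symm⟩)

/-- If g fixes ∞, the change of charts is affine in z and linear in r, hence continuous up to r = 0.
If not, the two charts overlap only in hyperbolic space, where `isOpenMap_inner` applies. -/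
lemma isOpenMap_chartInfinity : IsOpenMap (chartInfinity : ℂ × NNReal → BorelSerre m) := by
  intro W hW
  refine isOpen_borelSerre_iff.2 fun g => ?_
  by_cases h : g 1 0 = 0
  · let φ : ℂ × NNReal → ℂ × NNReal := fun x =>
      ((slToComplex g 0 0 * x.1 + slToComplex g 0 1) / slToComplex g 1 1,
        x.2 * ‖slToComplex g 1 1‖₊ ^ 2)
    have hφ : Continuous φ := by fun_prop
    convert hW.preimage hφ using 1
    ext x
    simp only [Set.mem_preimage]
    rw [smul_chartInfinity_of_eq_zero h, chartInfinity_injective.mem_set_image]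
  · have := isOpen_borelSerre_iff.1
      (isOpenMap_inner (m := m) _ (hW.preimage continuous_invCoord)) g
    convert this using 1
    ext ⟨z, r⟩
    simp only [Set.mem_preimage, Set.mem_image]
    constructor
    · rintro ⟨x, hx, hxe⟩
      change ∃ p, _ ∧ _ = g • chartInfinity (z, r)
      by_cases hr : r = 0
      · subst hr
        exact absurd hxe.symm (smul_chartInfinity_zero_notMem h _ _)
      · rw [chartInfinity_of_ne (x := (z, r)) hr, smul_inner_K] at hxe ⊢
        refine ⟨_, ?_, rfl⟩
        rw [← chartInfinity_invCoord] at hxe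
        rwa [← chartInfinity_injective hxe]
    · rintro ⟨p, hp, hpe⟩
      exact ⟨_, hp, by rw [chartInfinity_invCoord, hpe]⟩

/-- A chart meets the plane at ∞ either in its whole slice r = 0 or not at all. -/
lemma isOpen_compl_planeAtInfinity : IsOpen (planeAtInfinity m)ᶜ := by
  refine isOpen_borelSerre_iff.2 fun g => ?_
  by_cases h : g 1 0 = 0
  · have : (fun x : ℂ × NNReal => g • (chartInfinity x : BorelSerre m)) ⁻¹' (planeAtInfinity m)ᶜ =
        {x : ℂ × NNReal | x.2 ≠ 0} := by
      ext ⟨z, r⟩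
      simp only [Set.mem_preimage, Set.mem_compl_iff, Set.mem_ofPred_eq, not_iff_not]
      constructor
      · rintro ⟨w, hw⟩
        by_contra hr
        rw [chartInfinity_of_ne hr] at hw
        exact inner_ne_atInfinity _ _ hw.symm
      · rintro rfl
        rw [chartInfinity_zero, smul_atInfinity_of_eq_zero h]
        exact ⟨_, rfl⟩
    rw [this]
    exact isOpen_ne_fun continuous_snd continuous_const
  · have : (fun x : ℂ × NNReal => g • (chartInfinity x : BorelSerre m)) ⁻¹' (planeAtInfinity m)ᶜ =
        Set.univ := by
      ext ⟨z, r⟩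
      simp only [Set.mem_preimage, Set.mem_compl_iff, Set.mem_univ, iff_true]
      by_cases hr : r = 0
      · subst hr
        rw [chartInfinity_zero]
        exact smul_atInfinity_notMem h z
      · rw [chartInfinity_of_ne hr]
        rintro ⟨w, hw⟩
        exact inner_ne_atInfinity _ _ hw.symm
    rw [this]
    exact isOpen_univ

lemma range_chartInfinity :
    Set.range (chartInfinity : ℂ × NNReal → BorelSerre m) = innerPart m ∪ planeAtInfinity m := by
  ext x
  constructor
  · rintro ⟨⟨z, r⟩, rfl⟩
    by_cases hr : r = 0
    · subst hr
      exact .inr ⟨z, (chartInfinity_zero z).symm⟩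
    · exact .inl ⟨_, (chartInfinity_of_ne hr).symm⟩
  · rintro (⟨p, rfl⟩ | ⟨z, rfl⟩)
    · exact ⟨_, chartInfinity_invCoord p⟩
    · exact ⟨_, chartInfinity_zero z⟩

lemma isOpen_inner_union_planeAtInfinity : IsOpen (innerPart m ∪ planeAtInfinity m) := by
  rw [← range_chartInfinity]
  exact isOpenMap_chartInfinity.isOpen_range

/-! ## Closures of subsets of hyperbolic space -/

lemma inner_mem_closure {A : Set H3} (hA : IsClosed A) {p : H3} :
    (.inner p : BorelSerre m) ∈ closure (BorelSerre.inner '' A) ↔ p ∈ A := by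
  refine ⟨fun h => ?_, fun h => subset_closure ⟨p, h, rfl⟩⟩
  by_contra hp
  obtain ⟨x, ⟨q, hq, rfl⟩, ⟨q', hq', h'⟩⟩ :=
    mem_closure_iff.1 h _ (isOpenMap_inner _ hA.isOpen_compl) ⟨p, hp, rfl⟩
  rw [inner_injective h'] at hq'
  exact hq hq'

/-- The vertical geodesic over z stays in A from height 1 on and converges to the ideal point. -/
lemma atInfinity_mem_closure {A : Set H3} {z : ℂ}
    (h : ∀ p : H3, p.z = z → 1 ≤ p.ζ → p ∈ A) :
    (atInfinity z : BorelSerre m) ∈ closure (BorelSerre.inner '' A) := by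
  have hc : Continuous fun r : NNReal => (chartInfinity (z, r) : BorelSerre m) :=
    continuous_chartInfinity.comp (by fun_prop)
  have ht : Filter.Tendsto (fun r : NNReal => (chartInfinity (z, r) : BorelSerre m))
      (nhdsWithin 0 (Set.Ioi 0)) (nhds (atInfinity z)) := by
    rw [← chartInfinity_zero]
    exact (hc.tendsto 0).mono_left nhdsWithin_le_nhds
  refine mem_closure_of_tendsto ht ?_
  have h1 : Set.Ioo (0 : NNReal) 1 ∈ nhdsWithin (0 : NNReal) (Set.Ioi 0) :=
    Ioo_mem_nhdsGT one_pos
  filter_upwards [h1] with r hr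
  rw [chartInfinity_of_ne (x := (z, r)) hr.1.ne']
  refine ⟨_, h _ rfl ?_, rfl⟩
  change 1 ≤ (r : ℝ)⁻¹
  exact (one_le_inv₀ (NNReal.coe_pos.2 hr.1)).2 (by exact_mod_cast hr.2.le)

/-- The chart at ∞ is open, so the full cylinder over the complement of B is an open set that misses
A. -/
lemma mem_of_atInfinity_mem_closure {A : Set H3} {z : ℂ} {B : Set ℂ} (hB : IsClosed B)
    (hAB : ∀ p ∈ A, p.z ∈ B)
    (h : (atInfinity z : BorelSerre m) ∈ closure (BorelSerre.inner '' A)) : z ∈ B := by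
  by_contra hz
  have ho : IsOpen ((chartInfinity : ℂ × NNReal → BorelSerre m) '' (Prod.fst ⁻¹' Bᶜ)) :=
    isOpenMap_chartInfinity _ (hB.isOpen_compl.preimage continuous_fst)
  obtain ⟨x, ⟨q, hq, hqe⟩, ⟨p, hp, rfl⟩⟩ :=
    mem_closure_iff.1 h _ ho ⟨(z, 0), hz, chartInfinity_zero z⟩
  rw [← chartInfinity_invCoord] at hqe
  rw [chartInfinity_injective hqe] at hq
  exact hq (hAB p hp)

/-- A point at a cusp `g ∞` is not adherent to a set which avoids the image under `g` of a
horoball at `∞`. -/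
lemma smul_atInfinity_notMem_closure {A : Set H3} (g : SL(2, QField m)) (z : ℂ) {ε : ℝ}
    (hε : 0 < ε) (hA : ∀ p : H3, p.ζ⁻¹ < ε → act (slToComplex g) p ∉ A) :
    g • (atInfinity z : BorelSerre m) ∉ closure (BorelSerre.inner '' A) := by
  intro h
  have ho : IsOpen ((chartInfinity : ℂ × NNReal → BorelSerre m) ''
      ((fun x => (x.2 : ℝ)) ⁻¹' Set.Iio ε)) :=
    isOpenMap_chartInfinity _ (isOpen_Iio.preimage (by fun_prop))
  obtain ⟨x, ⟨y, hy, hye⟩, ⟨p, hp, rfl⟩⟩ :=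
    mem_closure_iff.1 h _ (ho.preimage (continuous_smul_borelSerre g⁻¹))
      (by simpa using ⟨z, 0, by simpa using hε, chartInfinity_zero z⟩)
  change _ = g⁻¹ • BorelSerre.inner p at hye
  rw [smul_inner_K, ← chartInfinity_invCoord] at hye
  rw [chartInfinity_injective hye] at hy
  refine hA _ hy ?_
  rw [map_inv]
  have : act (slToComplex g) (act (slToComplex g)⁻¹ p) = p := smul_inv_smul (slToComplex g) p
  rwa [this]

/-- With c the lower left entry of g, a point of height ζ is sent to height at most 1/(|c|²ζ), which
is below δ as soon as 1/ζ < δ|c|². -/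
lemma smul_atInfinity_notMem_closure_of_height {A : Set H3} {δ : ℝ} (hδ : 0 < δ)
    (hA : ∀ p ∈ A, δ ≤ p.ζ) {g : SL(2, QField m)} (hg : g 1 0 ≠ 0) (z : ℂ) :
    g • (atInfinity z : BorelSerre m) ∉ closure (BorelSerre.inner '' A) := by
  have hc : 0 < Complex.normSq (slToComplex g 1 0) := by
    rw [Complex.normSq_pos, slToComplex_apply]
    simpa using hg
  refine smul_atInfinity_notMem_closure g z (mul_pos hδ hc) fun p hp hpA => ?_
  have h1 := hA _ hpA
  rw [act_ζ, le_div_iff₀ (factor_pos _ p)] at h1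
  have h2 : Complex.normSq (slToComplex g 1 0) * p.ζ ^ 2 ≤
      factor (slToComplex g 1 0) (slToComplex g 1 1) p :=
    le_add_of_nonneg_left (Complex.normSq_nonneg _)
  have h3 := p.ζ_pos
  rw [inv_lt_iff_one_lt_mul₀ h3] at hp
  nlinarith

/-! ### Inner and ideal points of the completed polyhedron -/

lemma isClosed_cuspParallelogram : IsClosed (cuspParallelogram m) := by
  have : cuspParallelogram m =
      (fun x : ℝ × ℝ => (x.1 + x.2 * omega m : ℂ)) '' (Set.Icc (-1 / 2) (1 / 2) ×ˢ Set.Icc 0 1) := by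
    ext z
    constructor
    · rintro ⟨s, t, h1, h2, h3, rfl⟩
      have := abs_le.1 h1
      exact ⟨(s, t), ⟨⟨by linarith, this.2⟩, h2, h3⟩, rfl⟩
    · rintro ⟨⟨s, t⟩, ⟨⟨h1, h2⟩, h3, h4⟩, rfl⟩
      exact ⟨s, t, abs_le.2 ⟨by linarith, h2⟩, h3, h4, rfl⟩
  rw [this]
  exact ((isCompact_Icc.prod isCompact_Icc).image (by fun_prop)).isClosed

lemma isClosed_polyhedron : IsClosed (polyhedron m) := by
  refine IsClosed.inter (isClosed_cuspParallelogram.preimage continuous_z) ?_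
  have : {p : H3 | IsHigh m p} = ⋂ (c : RingInt m) (d : RingInt m) (_ : IsCoprime c d),
      {p | 1 ≤ factor (intToComplex m c) (intToComplex m d) p} := by
    ext p; simp [IsHigh]
  change IsClosed {p : H3 | IsHigh m p}
  rw [this]
  exact isClosed_iInter fun c => isClosed_iInter fun d => isClosed_iInter fun _ =>
    isClosed_le continuous_const (continuous_factor _ _)

lemma inner_mem_closedPolyhedron {p : H3} :
    (.inner p : BorelSerre m) ∈ closedPolyhedron m ↔ p ∈ polyhedron m :=
  inner_mem_closure isClosed_polyhedron

lemma isHigh_of_one_le {p : H3} (hp : 1 ≤ p.ζ) : IsHigh m p := by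
  have key : ∀ c : RingInt m, c ≠ 0 → 1 ≤ Complex.normSq (intToComplex m c) :=
    fun c hc => one_le_normSq_intToComplex hc
  intro c d hcd
  unfold factor
  by_cases hc : c = 0
  · subst hc
    have hd : d ≠ 0 := by
      rintro rfl
      exact not_isCoprime_zero_zero hcd
    simpa using key d hd
  · have h1 := key c hc
    have h2 := Complex.normSq_nonneg (intToComplex m c * p.z + intToComplex m d)
    nlinarith [mul_nonneg (sub_nonneg.2 h1) (sub_nonneg.2 (one_le_pow₀ hp (n := 2))),
      one_le_pow₀ hp (n := 2)]

lemma atInfinity_mem_closedPolyhedron {z : ℂ} :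
    (atInfinity z : BorelSerre m) ∈ closedPolyhedron m ↔ z ∈ cuspParallelogram m :=
  ⟨mem_of_atInfinity_mem_closure isClosed_cuspParallelogram fun _ hp => hp.1,
    fun h => atInfinity_mem_closure fun _ hp hζ => ⟨hp ▸ h, isHigh_of_one_le hζ⟩⟩

/-- The inclusion of the Bianchi group in `SL₂(K)`. -/
def toK (γ : BianchiGroup m) : SL(2, QField m) :=
  Matrix.SpecialLinearGroup.map (n := Fin 2) (algebraMap (RingInt m) (QField m)) γ

lemma smul_eq_toK (γ : BianchiGroup m) (x : BorelSerre m) : γ • x = toK γ • x := rfl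

lemma toK_lower_eq_zero {γ : BianchiGroup m} : toK γ 1 0 = 0 ↔ γ 1 0 = 0 := by
  change algebraMap (RingInt m) (QField m) (γ 1 0) = 0 ↔ _
  exact FaithfulSMul.algebraMap_eq_zero_iff (RingInt m) (QField m)

/-- If γp lies in P, the factor of γ at p is at most 1; but it is at least |γ₁₀|²ζ² ≥ ζ². So γ
carries no point of height above 1 into P. -/
lemma smul_atInfinity_notMem_closedPolyhedron {γ : BianchiGroup m} (h : γ 1 0 ≠ 0) (z : ℂ) :
    γ • (atInfinity z : BorelSerre m) ∉ closedPolyhedron m := by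
  rw [smul_eq_toK]
  refine smul_atInfinity_notMem_closure _ z one_pos fun p hp hpP => ?_
  have h1 : factor (toC γ 1 0) (toC γ 1 1) p ≤ 1 := IsHigh.factor_le_one γ hpP.2
  have h2 : Complex.normSq (toC γ 1 0) * p.ζ ^ 2 ≤ factor (toC γ 1 0) (toC γ 1 1) p :=
    le_add_of_nonneg_left (Complex.normSq_nonneg _)
  have h3 : 1 ≤ Complex.normSq (toC γ 1 0) := one_le_normSq_intToComplex h
  have h4 : 1 < p.ζ := (inv_lt_one₀ p.ζ_pos).1 hp
  nlinarith [mul_nonneg (sub_nonneg.2 h3) (sq_nonneg p.ζ)]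

lemma smul_atInfinity_eq {γ : BianchiGroup m} {ε : ℂ} (h : γ 1 0 = 0) (h1 : toC γ 1 1 = ε)
    (hε : ε = 1 ∨ ε = -1) (z : ℂ) :
    γ • (atInfinity z : BorelSerre m) = atInfinity (z + ε * toC γ 0 1) := by
  rw [smul_eq_toK, smul_atInfinity_of_eq_zero (toK_lower_eq_zero.2 h)]
  congr 1
  change (toC γ 0 0 * z + toC γ 0 1) / toC γ 1 1 = _
  have hd := det_entries (toC γ)
  have h0 : toC γ 1 0 = 0 := by rw [toC_apply, h, map_zero]
  rw [h0, h1] at hd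
  rw [h1]
  rcases hε with rfl | rfl
  · simp at hd; simp [hd]
  · have : toC γ 0 0 = -1 := by linear_combination -hd
    simp [this]; ring

/-- Two points of the upper edge of the completed face, both vertices or both not. -/
lemma Admissible.transfer_atInfinity (H : Admissible m) {x x' : ℝ} (hx' : |x'| ≤ 1 / 2)
    (hxx : x = x' ∨ (|x| < 1 / 2 ∧ |x'| < 1 / 2)) (γ : BianchiGroup m) :
    (γ • (atInfinity (x : ℂ) : BorelSerre m) ∈ closedPolyhedron m →
      γ • (atInfinity (x' : ℂ) : BorelSerre m) ∈ closedPolyhedron m) ∧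
    (γ • (atInfinity (x : ℂ) : BorelSerre m) = atInfinity (x : ℂ) →
      γ • (atInfinity (x' : ℂ) : BorelSerre m) = atInfinity (x' : ℂ)) := by
  by_cases h : γ 1 0 = 0
  swap
  · refine ⟨fun h' => absurd h' (smul_atInfinity_notMem_closedPolyhedron h _), fun h' => ?_⟩
    exact absurd ⟨_, h'.symm⟩
      (smul_atInfinity_notMem (g := toK γ) (mt toK_lower_eq_zero.1 h) (x : ℂ))
  have hε : toC γ 1 1 = 1 ∨ toC γ 1 1 = -1 := by
    -- The diagonal entries of an element fixing ∞ are units, hence ±1, so the stabiliser of ∞ acts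
    -- on its plane by translations only.
    have hu : IsUnit (γ 1 1) := by
      have hd := det_entries γ
      rw [h, mul_zero, sub_zero] at hd
      exact IsUnit.of_mul_eq_one _ (by rw [mul_comm]; exact hd)
    rw [toC_apply]
    rcases H.unit_eq hu with h1 | h1 <;> rw [h1] <;> simp
  rw [smul_atInfinity_eq h rfl hε, smul_atInfinity_eq h rfl hε]
  constructor
  · rw [atInfinity_mem_closedPolyhedron, atInfinity_mem_closedPolyhedron]
    obtain ⟨n, k, hnk⟩ := exists_int_form H.squarefree (γ 1 1 * γ 0 1)
    have hb : toC γ 1 1 * toC γ 0 1 = intToComplex m (γ 1 1 * γ 0 1) := by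
      rw [map_mul]; rfl
    rw [hb, hnk, H.ofReal_add_int_mem, H.ofReal_add_int_mem]
    rintro ⟨h1, h2⟩
    refine ⟨?_, h2⟩
    rcases hxx with rfl | ⟨hx, -⟩
    · exact h1
    · have h1 := abs_le.1 h1
      have h2 := abs_lt.1 hx
      have h3 : (n : ℝ) < 1 := by linarith
      have h4 : (-1 : ℝ) < n := by linarith
      have h3' : n < 1 := by exact_mod_cast h3
      have h4' : -1 < n := by exact_mod_cast h4
      have : n = 0 := by omega
      rw [this]; simpa using hx'
  · intro h'
    have := atInfinity_injective h'
    have h0 : toC γ 1 1 * toC γ 0 1 = 0 := by simpa using this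
    rw [h0, add_zero]

/-! ## Recognising points of the same type -/

/-- The translation by an algebraic integer. -/
def translation (w : RingInt m) : BianchiGroup m := ⟨!![1, w; 0, 1], by simp [Matrix.det_fin_two]⟩

variable (m) in
/-- The inversion `τ ↦ -1/τ`. -/
def inversion : BianchiGroup m := ⟨!![0, -1; 1, 0], by simp [Matrix.det_fin_two]⟩

lemma translation_smul_inner (w : RingInt m) (p : H3) :
    translation w • (.inner p : BorelSerre m) =
    .inner (.ofCoord (p.z + intToComplex m w) p.ζ p.ζ_pos) := by
  rw [smul_inner, act_z_of_lower_eq_zero (ε := 1)]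
  · congr 3
    rw [toC_apply]
    change 1 * intToComplex m w = _
    rw [one_mul]
  · rw [toC_apply]; exact map_zero _
  · rw [toC_apply]; exact map_one _
  · left; rfl

lemma translation_smul_atInfinity (w : RingInt m) (z : ℂ) :
    translation w • (atInfinity z : BorelSerre m) = atInfinity (z + intToComplex m w) := by
  rw [smul_atInfinity_eq (ε := 1)]
  · congr 2
    rw [toC_apply]
    change 1 * intToComplex m w = _
    rw [one_mul]
  · rfl
  · rw [toC_apply]; exact map_one _
  · left; rfl

lemma InFd.z_eq {p : H3} (hp : InFd p) : p.z = p.z.re := by apply Complex.ext <;> simp [hp.1]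

lemma InFd.normSq_eq {p : H3} (hp : InFd p) :
    Complex.normSq p.z + p.ζ ^ 2 = p.z.re ^ 2 + p.ζ ^ 2 := by
  rw [Complex.normSq_apply, hp.1]; ring

lemma inversion_smul_inner {p : H3} (hp : InFd p) (h : p.z.re ^ 2 + p.ζ ^ 2 = 1) :
    inversion m • (.inner p : BorelSerre m) =
    .inner (.ofCoord ((-p.z.re : ℝ) : ℂ) p.ζ p.ζ_pos) := by
  rw [smul_inner, act_z_of_lower_eq_unit (ε := 1)]
  · congr 2
    rw [toC_apply]
    change 1 * intToComplex m 0 - _ = _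
    rw [map_zero, hp.z_eq]
    simp
  · rw [toC_apply]; exact map_one _
  · rw [toC_apply]; exact map_zero _
  · left; rfl
  · rw [hp.normSq_eq, h]

lemma abs_add_one_iff {x : ℝ} (hx : |x| ≤ 1 / 2) : |x + (1 : ℤ)| ≤ 1 / 2 ↔ x = -1 / 2 := by
  have h := abs_le.1 hx
  rw [abs_le]
  push_cast
  constructor
  · rintro ⟨-, h2⟩; linarith
  · rintro rfl; norm_num

lemma abs_sub_one_iff {x : ℝ} (hx : |x| ≤ 1 / 2) : |x + (-1 : ℤ)| ≤ 1 / 2 ↔ x = 1 / 2 := by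
  have h := abs_le.1 hx
  rw [abs_le]
  push_cast
  constructor
  · rintro ⟨h2, -⟩; linarith
  · rintro rfl; norm_num

namespace Admissible

variable (H : Admissible m)
include H

lemma translation_mem_iff {p : H3} (hp : InFd p) (n : ℤ) :
    translation (n : RingInt m) • (.inner p : BorelSerre m) ∈ closedPolyhedron m ↔
      |p.z.re + n| ≤ 1 / 2 := by
  have hmem := H.ofReal_add_int_mem (x := p.z.re) (a := n) (b := 0)
  have hf : factor (toC (translation (n : RingInt m)) 1 0)
      (toC (translation (n : RingInt m)) 1 1) p = 1 := by
    rw [toC_apply, toC_apply]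
    change factor (intToComplex m 0) (intToComplex m 1) p = 1
    simp [factor]
  have hh := (H.isHigh_of_inFd hp).act _ hf
  have e := smul_inner (translation (n : RingInt m)) p
  have e' := translation_smul_inner (n : RingInt m) p
  rw [inner_injective (e.symm.trans e')] at hh
  rw [translation_smul_inner, inner_mem_closedPolyhedron, mem_polyhedron, and_iff_left hh]
  change p.z + _ ∈ _ ↔ _
  rw [hp.z_eq, map_intCast]
  simpa using hmem

/-- The inversion has the row (1, 0) of value |z|² + ζ², at least 1 on the face and at most 1 if the
image lies in P. -/
lemma inversion_mem_iff {p : H3} (hp : InFd p) :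
    inversion m • (.inner p : BorelSerre m) ∈ closedPolyhedron m ↔ p.z.re ^ 2 + p.ζ ^ 2 = 1 := by
  constructor
  · intro h
    rw [smul_inner, inner_mem_closedPolyhedron] at h
    have h1 : factor (toC (inversion m) 1 0) (toC (inversion m) 1 1) p ≤ 1 :=
      IsHigh.factor_le_one _ h.2
    rw [toC_apply, toC_apply] at h1
    change factor (intToComplex m 1) (intToComplex m 0) p ≤ 1 at h1
    simp only [factor, map_one, map_zero, one_mul, add_zero] at h1
    rw [hp.normSq_eq] at h1
    exact le_antisymm h1 hp.2.2
  · intro h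
    rw [inversion_smul_inner hp h, inner_mem_closedPolyhedron]
    apply H.mem_polyhedron_of_inFd
    refine ⟨Complex.ofReal_im _, ?_, ?_⟩
    · change |-p.z.re| ≤ _
      rw [abs_neg]; exact hp.2.1
    · change 1 ≤ (-p.z.re) ^ 2 + p.ζ ^ 2
      rw [neg_sq]; exact hp.2.2

/-- On the arc the inversion changes the sign of Re z. Stabilisers thus make the midpoint of the arc
a vertex. -/
lemma inversion_fix_iff {p : H3} (hp : InFd p) :
    inversion m • (.inner p : BorelSerre m) = .inner p ↔
      p.z.re ^ 2 + p.ζ ^ 2 = 1 ∧ p.z.re = 0 := by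
  constructor
  · intro h
    have h1 : p.z.re ^ 2 + p.ζ ^ 2 = 1 := by
      rw [← H.inversion_mem_iff hp, h, inner_mem_closedPolyhedron]
      exact H.mem_polyhedron_of_inFd hp
    rw [inversion_smul_inner hp h1] at h
    have h2 := congrArg (fun q : H3 => q.z.re) (inner_injective h)
    change -p.z.re = p.z.re at h2
    exact ⟨h1, by linarith⟩
  · rintro ⟨h1, h2⟩
    rw [inversion_smul_inner hp h1]
    congr 1
    apply H3.ext
    · change ((-p.z.re : ℝ) : ℂ) = p.z
      rw [hp.z_eq, h2]; simp
    · rfl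

lemma inFd_of_mem {p : H3} (h : (.inner p : BorelSerre m) ∈ closedPolyhedron m) {w : RingInt m}
    (hw : intToComplex m w = omega m)
    (h' : translation w • (.inner p : BorelSerre m) ∈ closedPolyhedron m) : InFd p := by
  rw [inner_mem_closedPolyhedron] at h
  rw [translation_smul_inner, inner_mem_closedPolyhedron] at h'
  have h' : p.z + intToComplex m w ∈ cuspParallelogram m := h'.1
  rw [hw] at h'
  exact H.mem_realFace.1 ⟨h, H.im_eq_zero h.1 h'⟩

lemma translation_omega_mem {p : H3} (hp : InFd p) {w : RingInt m}
    (hw : intToComplex m w = omega m) :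
    translation w • (.inner p : BorelSerre m) ∈ closedPolyhedron m := by
  have hf : factor (toC (translation w) 1 0) (toC (translation w) 1 1) p = 1 := by
    rw [toC_apply, toC_apply]
    change factor (intToComplex m 0) (intToComplex m 1) p = 1
    simp [factor]
  have hh := (H.isHigh_of_inFd hp).act _ hf
  rw [inner_injective ((smul_inner _ p).symm.trans (translation_smul_inner w p))] at hh
  rw [translation_smul_inner, inner_mem_closedPolyhedron]
  refine ⟨?_, hh⟩
  change p.z + intToComplex m w ∈ _
  have := H.ofReal_add_int_mem (x := p.z.re) (a := 0) (b := 1)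
  rw [hw, hp.z_eq]
  simp only [Int.cast_zero, Int.cast_one, zero_add, one_mul, add_zero] at this
  exact this.2 ⟨hp.2.1, by norm_num⟩

end Admissible

lemma SameType.mem_iff {x y : BorelSerre m} (h : SameType x y) (γ : BianchiGroup m) :
    γ • x ∈ closedPolyhedron m ↔ γ • y ∈ closedPolyhedron m := by
  simpa using (h.1 γ⁻¹).1

lemma sameType_of {x y : BorelSerre m}
    (h : ∀ γ : BianchiGroup m, γ • x ∈ closedPolyhedron m ↔ γ • y ∈ closedPolyhedron m)
    (h' : ∀ γ : BianchiGroup m, γ • x = x ↔ γ • y = y)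
    (h'' : x ∈ innerPart m ↔ y ∈ innerPart m) : SameType x y :=
  ⟨fun γ => ⟨h γ⁻¹, h' γ⟩, h''⟩

/-- The component of x in its type class cannot meet both of the open sets U and V, which partition
that class. Only the part in U has to be known, so V may contain points of the same type that are
never described. -/
lemma isOpenCell_of {C U V : Set (BorelSerre m)} {x : BorelSerre m} (hx : x ∈ C)
    (hC : IsPreconnected C) (hCS : ∀ y ∈ C, SameType x y) (hU : IsOpen U) (hV : IsOpen V)
    (hcov : ∀ y, SameType x y → y ∈ U ∨ y ∈ V) (hdisj : ∀ y, SameType x y → y ∈ U → y ∉ V)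
    (hxU : x ∈ U) (hUC : ∀ y, SameType x y → y ∈ U → y ∈ C) : IsOpenCell C := by
  refine ⟨x, Set.Subset.antisymm (hC.subset_connectedComponentIn hx hCS) fun y hy => ?_⟩
  have hS := connectedComponentIn_subset {y | SameType x y} x
  have hpre := isPreconnected_connectedComponentIn (F := {y | SameType x y}) (x := x)
  have hxc : x ∈ connectedComponentIn {y | SameType x y} x :=
    mem_connectedComponentIn (hCS x hx)
  have hyS : SameType x y := hS hy
  refine hUC y hyS ?_
  by_contra hyU
  obtain ⟨z, hz, hzU, hzV⟩ := hpre U V hU hV (fun z hz => hcov z (hS hz)) ⟨x, hxc, hxU⟩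
    ⟨y, hy, (hcov y hyS).resolve_left hyU⟩
  exact hdisj z (hS hz) hzU hzV

lemma isOpenCell_of_eq {C : Set (BorelSerre m)} {x : BorelSerre m} (hx : x ∈ C)
    (hC : IsPreconnected C) (hCS : ∀ y ∈ C, SameType x y) (hSC : ∀ y, SameType x y → y ∈ C) :
    IsOpenCell C :=
  isOpenCell_of (U := Set.univ) (V := ∅) hx hC hCS isOpen_univ isOpen_empty
    (fun _ _ => .inl trivial) (fun _ _ _ => id) trivial fun y hy _ => hSC y hy

namespace Admissible

variable (H : Admissible m)
include H

/-- Each invariant is tested by one group element: translation by ω for the real half-plane, by 1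
and -1 for the two vertical sides, inversion for the arc and, through its fixed points, for i. -/
lemma sameType_inner {p : H3} (hp : InFd p) {y : BorelSerre m} (h : SameType (.inner p) y) :
    ∃ p', y = .inner p' ∧ InFd p' ∧ (p.z.re = -1 / 2 ↔ p'.z.re = -1 / 2) ∧
      (p.z.re = 1 / 2 ↔ p'.z.re = 1 / 2) ∧
      (p.z.re ^ 2 + p.ζ ^ 2 = 1 ↔ p'.z.re ^ 2 + p'.ζ ^ 2 = 1) ∧
      (p.z.re ^ 2 + p.ζ ^ 2 = 1 ∧ p.z.re = 0 ↔ p'.z.re ^ 2 + p'.ζ ^ 2 = 1 ∧ p'.z.re = 0) := by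
  obtain ⟨p', rfl⟩ : y ∈ innerPart m := h.2.1 ⟨p, rfl⟩
  obtain ⟨w, hw⟩ := exists_omega m
  have h1 := h.mem_iff 1
  rw [one_smul, one_smul] at h1
  have hp' : InFd p' := H.inFd_of_mem
    (h1.1 (inner_mem_closedPolyhedron.2 (H.mem_polyhedron_of_inFd hp))) hw
    ((h.mem_iff _).1 (H.translation_omega_mem hp hw))
  refine ⟨p', rfl, hp', ?_, ?_, ?_, ?_⟩
  · rw [← abs_add_one_iff hp.2.1, ← abs_add_one_iff hp'.2.1, ← H.translation_mem_iff hp,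
      ← H.translation_mem_iff hp']
    exact h.mem_iff _
  · rw [← abs_sub_one_iff hp.2.1, ← abs_sub_one_iff hp'.2.1, ← H.translation_mem_iff hp,
      ← H.translation_mem_iff hp']
    exact h.mem_iff _
  · rw [← H.inversion_mem_iff hp, ← H.inversion_mem_iff hp']
    exact h.mem_iff _
  · rw [← H.inversion_fix_iff hp, ← H.inversion_fix_iff hp']
    exact (h.1 _).2

lemma sameType_atInfinity {x : ℝ} (hx : |x| ≤ 1 / 2) {y : BorelSerre m}
    (h : SameType (atInfinity (x : ℂ)) y) (hy : y ∈ planeAtInfinity m) :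
    ∃ x' : ℝ, y = atInfinity (x' : ℂ) ∧ |x'| ≤ 1 / 2 ∧ (x = -1 / 2 ↔ x' = -1 / 2) ∧
      (x = 1 / 2 ↔ x' = 1 / 2) := by
  obtain ⟨z, rfl⟩ := hy
  obtain ⟨w, hw⟩ := exists_omega m
  have h1 := h.mem_iff 1
  have h2 := h.mem_iff (translation w)
  have h3 := h.mem_iff (translation (1 : ℤ))
  have h4 := h.mem_iff (translation (-1 : ℤ))
  rw [one_smul, one_smul, atInfinity_mem_closedPolyhedron, atInfinity_mem_closedPolyhedron,
    H.ofReal_mem] at h1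
  rw [translation_smul_atInfinity, translation_smul_atInfinity, atInfinity_mem_closedPolyhedron,
    atInfinity_mem_closedPolyhedron] at h2 h3 h4
  have hxw := H.ofReal_add_int_mem (x := x) (a := 0) (b := 1)
  simp only [Int.cast_zero, Int.cast_one, zero_add, one_mul, add_zero] at hxw
  rw [hw, hxw] at h2
  have hz := h1.1 hx
  have him := H.im_eq_zero hz (h2.1 (by simpa using hx))
  obtain ⟨hz1, hz2⟩ := H.eq_ofReal hz him
  have key : ∀ (u : ℝ) (n : ℤ), (u : ℂ) + intToComplex m (n : RingInt m) ∈ cuspParallelogram m ↔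
      |u + n| ≤ 1 / 2 := by
    intro u n
    have := H.ofReal_add_int_mem (x := u) (a := n) (b := 0)
    rw [map_intCast]
    simpa using this
  rw [hz1, key, key] at h3 h4
  refine ⟨z.re, by rw [← hz1], hz2, ?_, ?_⟩
  · rw [← abs_add_one_iff hx, ← abs_add_one_iff hz2]
    exact h3
  · rw [← abs_sub_one_iff hx, ← abs_sub_one_iff hz2]
    exact h4

/-- Points of the face lying in the same relatively open piece have the same type. -/
lemma sameType_of_inFd {p p' : H3} (hp : InFd p) (hp' : InFd p')
    (h : (1 < p.z.re ^ 2 + p.ζ ^ 2 ∧ 1 < p'.z.re ^ 2 + p'.ζ ^ 2 ∧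
        (p.z.re = p'.z.re ∨ (|p.z.re| < 1 / 2 ∧ |p'.z.re| < 1 / 2))) ∨
      (p.z.re ^ 2 + p.ζ ^ 2 = 1 ∧ p'.z.re ^ 2 + p'.ζ ^ 2 = 1 ∧ 0 < |p.z.re| ∧ |p.z.re| < 1 / 2 ∧
        0 < |p'.z.re| ∧ |p'.z.re| < 1 / 2)) :
    SameType (.inner p : BorelSerre m) (.inner p') := by
  have t := H.transfer hp hp' (by tauto)
  have t' := H.transfer hp' hp (by
    have : p.z.re = p'.z.re ↔ p'.z.re = p.z.re := eq_comm
    tauto)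
  refine sameType_of (fun γ => ?_) (fun γ => ?_) (iff_of_true ⟨p, rfl⟩ ⟨p', rfl⟩)
  · rw [smul_inner, smul_inner, inner_mem_closedPolyhedron, inner_mem_closedPolyhedron]
    exact ⟨(t γ).1, (t' γ).1⟩
  · rw [smul_inner, smul_inner, inner_injective.eq_iff, inner_injective.eq_iff]
    exact ⟨(t γ).2, (t' γ).2⟩

lemma sameType_of_atInfinity {x x' : ℝ} (hx : |x| < 1 / 2) (hx' : |x'| < 1 / 2) :
    SameType (atInfinity (x : ℂ) : BorelSerre m) (atInfinity (x' : ℂ)) :=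
  sameType_of
    (fun γ => ⟨(H.transfer_atInfinity hx'.le (.inr ⟨hx, hx'⟩) γ).1,
      (H.transfer_atInfinity hx.le (.inr ⟨hx', hx⟩) γ).1⟩)
    (fun γ => ⟨(H.transfer_atInfinity hx'.le (.inr ⟨hx, hx'⟩) γ).2,
      (H.transfer_atInfinity hx.le (.inr ⟨hx', hx⟩) γ).2⟩)
    (iff_of_false (atInfinity_notMem_innerPart _) (atInfinity_notMem_innerPart _))

end Admissible

lemma sameType_refl (x : BorelSerre m) : SameType x x :=
  sameType_of (fun _ => Iff.rfl) (fun _ => Iff.rfl) Iff.rfl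

/-! ## Coordinates on the completed face -/

/-- The parametrization of the completed face by the square `[-1, 1]²`. -/
def faceMap (q : ℝ × ℝ) : BorelSerre m :=
  -- In terms of height, ζ = 2√(1 - (x/2)²)/(1 - y): the side y = -1 is the unit arc and y = 1 is
  -- the ideal edge r = 0.
  chartInfinity (((q.1 / 2 : ℝ) : ℂ), Real.toNNReal ((1 - q.2) / 2 / √(1 - (q.1 / 2) ^ 2)))

lemma mem_square {q : ℝ × ℝ} : q ∈ Metric.closedBall (0 : ℝ × ℝ) 1 ↔
    (-1 ≤ q.1 ∧ q.1 ≤ 1) ∧ -1 ≤ q.2 ∧ q.2 ≤ 1 := by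
  rw [mem_closedBall_zero_iff, Prod.norm_def, max_le_iff, Real.norm_eq_abs, Real.norm_eq_abs,
    abs_le, abs_le]

lemma mem_square_interior {q : ℝ × ℝ} : q ∈ Metric.ball (0 : ℝ × ℝ) 1 ↔
    (-1 < q.1 ∧ q.1 < 1) ∧ -1 < q.2 ∧ q.2 < 1 := by
  rw [mem_ball_zero_iff, Prod.norm_def, max_lt_iff, Real.norm_eq_abs, Real.norm_eq_abs,
    abs_lt, abs_lt]

lemma height_pos {x : ℝ} (h1 : -1 ≤ x) (h2 : x ≤ 1) : 0 < √(1 - (x / 2) ^ 2) :=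
  Real.sqrt_pos.2 (by nlinarith)

lemma continuousOn_faceMap :
    ContinuousOn (faceMap : ℝ × ℝ → BorelSerre m) (Metric.closedBall 0 1) := by
  refine continuous_chartInfinity.comp_continuousOn (ContinuousOn.prodMk (by fun_prop) ?_)
  refine continuous_real_toNNReal.comp_continuousOn (ContinuousOn.div (by fun_prop) (by fun_prop) ?_)
  intro q hq
  exact (height_pos (mem_square.1 hq).1.1 (mem_square.1 hq).1.2).ne'

lemma injOn_faceMap : Set.InjOn (faceMap : ℝ × ℝ → BorelSerre m) (Metric.closedBall 0 1) := by
  rintro ⟨x, y⟩ hq ⟨x', y'⟩ hq' h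
  rw [mem_square] at hq hq'
  have h := chartInfinity_injective h
  have h1 : x / 2 = x' / 2 := Complex.ofReal_injective (congrArg Prod.fst h)
  have hx : x = x' := by linarith
  subst hx
  have hpos := height_pos hq.1.1 hq.1.2
  have h2 := congrArg Prod.snd h
  simp only at h2 hq hq' hpos
  rw [Real.toNNReal_eq_toNNReal_iff (div_nonneg (by linarith) hpos.le)
    (div_nonneg (by linarith) hpos.le)] at h2
  have h3 := (div_left_inj' hpos.ne').1 h2
  exact Prod.ext rfl (by simp only; linarith)

lemma faceMap_top (x : ℝ) : faceMap (x, 1) = (atInfinity ((x / 2 : ℝ) : ℂ) : BorelSerre m) := by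
  simp [faceMap, chartInfinity_zero]

lemma faceMap_inner {q : ℝ × ℝ} (hq : q ∈ Metric.closedBall (0 : ℝ × ℝ) 1) (h : q.2 ≠ 1) :
    ∃ p, faceMap q = (.inner p : BorelSerre m) ∧ InFd p ∧ p.z.re = q.1 / 2 ∧
      p.ζ = 2 * √(1 - (q.1 / 2) ^ 2) / (1 - q.2) ∧ (p.z.re ^ 2 + p.ζ ^ 2 = 1 ↔ q.2 = -1) := by
  obtain ⟨x, y⟩ := q
  rw [mem_square] at hq
  simp only at hq h ⊢
  have hpos := height_pos hq.1.1 hq.1.2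
  have hy : 0 < 1 - y := by
    have := lt_of_le_of_ne hq.2.2 h
    linarith
  have hr : 0 < (1 - y) / 2 / √(1 - (x / 2) ^ 2) := by positivity
  have hne : Real.toNNReal ((1 - y) / 2 / √(1 - (x / 2) ^ 2)) ≠ 0 := by
    simpa using hr
  let p : H3 := pointOfInv (((x / 2 : ℝ) : ℂ), _) hne
  have hz : p.z = ((x / 2 : ℝ) : ℂ) := rfl
  have hζ : p.ζ = 2 * √(1 - (x / 2) ^ 2) / (1 - y) := by
    change ((Real.toNNReal _ : NNReal) : ℝ)⁻¹ = _
    rw [Real.coe_toNNReal _ hr.le]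
    field_simp
  have hre : p.z.re = x / 2 := by rw [hz, Complex.ofReal_re]
  have hsq : √(1 - (x / 2) ^ 2) ^ 2 = 1 - (x / 2) ^ 2 := Real.sq_sqrt (by nlinarith)
  -- Uses 4/(1 - y)² - 1 = (3 - y)(1 + y)/(1 - y)², so the excess over 1 is non-negative and
  -- vanishes only at y = -1.
  have hsum : p.z.re ^ 2 + p.ζ ^ 2 =
      1 + (1 - (x / 2) ^ 2) * ((3 - y) * (1 + y)) / (1 - y) ^ 2 := by
    rw [hre, hζ]
    generalize x / 2 = u at hsq ⊢
    rw [div_pow, mul_pow, hsq]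
    field_simp
    ring
  have hx2 : 0 < 1 - (x / 2) ^ 2 := by nlinarith
  refine ⟨p, chartInfinity_of_ne hne, ⟨?_, ?_, ?_⟩, hre, hζ, ?_⟩
  · rw [hz, Complex.ofReal_im]
  · rw [hre, abs_le]; constructor <;> linarith
  · rw [hsum]
    have : 0 ≤ (1 - (x / 2) ^ 2) * ((3 - y) * (1 + y)) / (1 - y) ^ 2 :=
      div_nonneg (mul_nonneg hx2.le (mul_nonneg (by linarith) (by linarith))) (sq_nonneg _)
    linarith
  · rw [hsum, add_eq_left, div_eq_zero_iff, or_iff_left (pow_ne_zero 2 hy.ne'),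
      mul_eq_zero, or_iff_right hx2.ne', mul_eq_zero, or_iff_right (by linarith)]
    constructor <;> intro h <;> linarith

lemma exists_faceMap_eq {p : H3} (hp : InFd p) :
    ∃ q ∈ Metric.closedBall (0 : ℝ × ℝ) 1, faceMap q = (.inner p : BorelSerre m) ∧ q.2 ≠ 1 ∧
      p.z.re = q.1 / 2 ∧ (p.z.re ^ 2 + p.ζ ^ 2 = 1 ↔ q.2 = -1) := by
  have hx := abs_le.1 hp.2.1
  have hζ := p.ζ_pos
  have hpos := height_pos (x := 2 * p.z.re) (by linarith) (by linarith)
  have hle : √(1 - (2 * p.z.re / 2) ^ 2) ≤ p.ζ := by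
    rw [Real.sqrt_le_left hζ.le]
    have := hp.2.2
    rw [mul_div_cancel_left₀ _ two_ne_zero]
    linarith
  have h1 : 0 < √(1 - (2 * p.z.re / 2) ^ 2) / p.ζ := div_pos hpos hζ
  have h2 : √(1 - (2 * p.z.re / 2) ^ 2) / p.ζ ≤ 1 := (div_le_one hζ).2 hle
  -- The formula for the height solved for y.
  let q : ℝ × ℝ := (2 * p.z.re, 1 - 2 * (√(1 - (2 * p.z.re / 2) ^ 2) / p.ζ))
  have hq : q ∈ Metric.closedBall (0 : ℝ × ℝ) 1 := by
    rw [mem_square]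
    refine ⟨⟨?_, ?_⟩, ?_, ?_⟩ <;> simp only [q] <;> linarith
  have hq1 : q.2 ≠ 1 := by simp only [q]; linarith
  obtain ⟨p', e, hp', hre, hζ', hN⟩ := faceMap_inner (m := m) hq hq1
  have hpp : p' = p := by
    apply H3.ext
    · rw [hp'.z_eq, hp.z_eq, hre]
      simp [q]
    · rw [hζ']
      simp only [q]
      rw [sub_sub_cancel, mul_div_mul_left _ _ two_ne_zero, div_div_cancel₀ hpos.ne']
  subst hpp
  exact ⟨q, hq, e, hq1, hre, hN⟩

/-! ## A homeomorphism from the disc to the square -/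

/-- The truncation of a real number to `[-1, 1]`. -/
def clamp (u : ℝ) : ℝ := max (-1) (min 1 u)

lemma clamp_of_mem {u : ℝ} (h : -1 ≤ u) (h' : u ≤ 1) : clamp u = u := by
  rw [clamp, min_eq_right h', max_eq_right h]

lemma clamp_of_le {u : ℝ} (h : u ≤ -1) : clamp u = -1 := by
  rw [clamp, min_eq_right (by linarith), max_eq_left h]

lemma clamp_of_ge {u : ℝ} (h : 1 ≤ u) : clamp u = 1 := by
  rw [clamp, min_eq_left h, max_eq_right (by norm_num)]

lemma clamp_le_one (u : ℝ) : clamp u ≤ 1 := max_le (by norm_num) (min_le_left _ _)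

/-- A parametrization by `[0, 5]` of the boundary of the square, starting with the upper edge and
running through the lower edge at half speed. -/
def squareLoop (s : ℝ) : ℝ × ℝ :=
  -- Each coordinate falls once from 1 to -1 and later rises again. Before the rise starts, the
  -- second clamp equals -1; after the fall, the first one does, so the maximum follows the right
  -- ramp.
  (max (clamp (1 - 2 * s)) (clamp (s - 3)), max (clamp (3 - 2 * s)) (clamp (2 * s - 9)))

lemma continuous_squareLoop : Continuous squareLoop := by
  unfold squareLoop clamp
  fun_prop

lemma squareLoop_zero_one {s : ℝ} (h : 0 ≤ s) (h' : s ≤ 1) : squareLoop s = (1 - 2 * s, 1) := by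
  unfold squareLoop
  rw [clamp_of_mem (u := 1 - 2 * s) (by linarith) (by linarith),
    clamp_of_le (u := s - 3) (by linarith), clamp_of_ge (u := 3 - 2 * s) (by linarith),
    max_eq_left (by linarith), max_eq_left (clamp_le_one _)]

lemma squareLoop_one_two {s : ℝ} (h : 1 ≤ s) (h' : s ≤ 2) : squareLoop s = (-1, 3 - 2 * s) := by
  unfold squareLoop
  rw [clamp_of_le (u := 1 - 2 * s) (by linarith), clamp_of_le (u := s - 3) (by linarith),
    clamp_of_mem (u := 3 - 2 * s) (by linarith) (by linarith),
    clamp_of_le (u := 2 * s - 9) (by linarith), max_self, max_eq_left (by linarith)]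

lemma squareLoop_two_four {s : ℝ} (h : 2 ≤ s) (h' : s ≤ 4) : squareLoop s = (s - 3, -1) := by
  unfold squareLoop
  rw [clamp_of_le (u := 1 - 2 * s) (by linarith),
    clamp_of_mem (u := s - 3) (by linarith) (by linarith),
    clamp_of_le (u := 3 - 2 * s) (by linarith), clamp_of_le (u := 2 * s - 9) (by linarith),
    max_self, max_eq_right (by linarith)]

lemma squareLoop_four_five {s : ℝ} (h : 4 ≤ s) (h' : s ≤ 5) : squareLoop s = (1, 2 * s - 9) := by
  unfold squareLoop
  rw [clamp_of_ge (u := s - 3) (by linarith), clamp_of_le (u := 3 - 2 * s) (by linarith),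
    clamp_of_mem (u := 2 * s - 9) (by linarith) (by linarith),
    max_eq_right (clamp_le_one _), max_eq_right (by linarith)]

lemma squareLoop_cases {s : ℝ} (h : 0 ≤ s) (h' : s ≤ 5) :
    (0 ≤ s ∧ s ≤ 1 ∧ squareLoop s = (1 - 2 * s, 1)) ∨
    (1 ≤ s ∧ s ≤ 2 ∧ squareLoop s = (-1, 3 - 2 * s)) ∨
    (2 ≤ s ∧ s ≤ 4 ∧ squareLoop s = (s - 3, -1)) ∨
    (4 ≤ s ∧ s ≤ 5 ∧ squareLoop s = (1, 2 * s - 9)) := by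
  rcases le_total s 1 with h1 | h1
  · exact .inl ⟨h, h1, squareLoop_zero_one h h1⟩
  rcases le_total s 2 with h2 | h2
  · exact .inr (.inl ⟨h1, h2, squareLoop_one_two h1 h2⟩)
  rcases le_total s 4 with h3 | h3
  · exact .inr (.inr (.inl ⟨h2, h3, squareLoop_two_four h2 h3⟩))
  · exact .inr (.inr (.inr ⟨h3, h', squareLoop_four_five h3 h'⟩))

lemma norm_squareLoop {s : ℝ} (h : 0 ≤ s) (h' : s ≤ 5) : ‖squareLoop s‖ = 1 := by
  rcases squareLoop_cases h h' with ⟨h1, h2, e⟩ | ⟨h1, h2, e⟩ | ⟨h1, h2, e⟩ | ⟨h1, h2, e⟩ <;>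
    rw [e, Prod.norm_def] <;> simp only [Real.norm_eq_abs, abs_one, abs_neg]
  · exact max_eq_right (abs_le.2 ⟨by linarith, by linarith⟩)
  · exact max_eq_left (abs_le.2 ⟨by linarith, by linarith⟩)
  · exact max_eq_right (abs_le.2 ⟨by linarith, by linarith⟩)
  · exact max_eq_left (abs_le.2 ⟨by linarith, by linarith⟩)

lemma squareLoop_injOn : Set.InjOn squareLoop (Set.Ico 0 5) := by
  intro s hs s' hs' h
  have hs5 := hs.2
  have hs5' := hs'.2
  rcases squareLoop_cases hs.1 hs.2.le with ⟨h1, h2, e⟩ | ⟨h1, h2, e⟩ | ⟨h1, h2, e⟩ | ⟨h1, h2, e⟩ <;>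
  rcases squareLoop_cases hs'.1 hs'.2.le with
    ⟨h1', h2', e'⟩ | ⟨h1', h2', e'⟩ | ⟨h1', h2', e'⟩ | ⟨h1', h2', e'⟩ <;>
  · rw [e, e'] at h
    have hx := congrArg Prod.fst h
    have hy := congrArg Prod.snd h
    simp only at hx hy
    linarith

lemma exists_squareLoop {q : ℝ × ℝ} (hq : ‖q‖ = 1) : ∃ s ∈ Set.Ico (0 : ℝ) 5, squareLoop s = q := by
  obtain ⟨x, y⟩ := q
  have hmem := mem_square.1 (mem_closedBall_zero_iff.2 hq.le)
  simp only at hmem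
  obtain ⟨⟨hx1, hx2⟩, hy1, hy2⟩ := hmem
  by_cases h1 : y = 1
  · subst h1
    refine ⟨(1 - x) / 2, ⟨by linarith, by linarith⟩, ?_⟩
    rw [squareLoop_zero_one (by linarith) (by linarith)]
    ext <;> simp only; ring
  by_cases h2 : x = -1
  · subst h2
    refine ⟨(3 - y) / 2, ⟨by linarith, by linarith⟩, ?_⟩
    rw [squareLoop_one_two (by linarith) (by linarith)]
    ext <;> simp only; ring
  by_cases h3 : y = -1
  · subst h3
    refine ⟨x + 3, ⟨by linarith, by linarith⟩, ?_⟩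
    rw [squareLoop_two_four (by linarith) (by linarith)]
    ext <;> simp only; ring
  have hy3 : y < 1 := lt_of_le_of_ne hy2 h1
  by_cases h4 : x = 1
  · subst h4
    refine ⟨(y + 9) / 2, ⟨by linarith, by linarith⟩, ?_⟩
    rw [squareLoop_four_five (by linarith) (by linarith)]
    ext <;> simp only; ring
  · exfalso
    have : (x, y) ∈ Metric.ball (0 : ℝ × ℝ) 1 := mem_square_interior.2
      ⟨⟨lt_of_le_of_ne hx1 (Ne.symm h2), lt_of_le_of_ne hx2 h4⟩,
        lt_of_le_of_ne hy1 (Ne.symm h3), hy3⟩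
    rw [mem_ball_zero_iff, hq] at this
    exact lt_irrefl _ this

/-- The parametrization of the boundary of the square by angles. -/
def angleLoop : Real.Angle → ℝ × ℝ :=
  haveI : Fact (0 < 2 * Real.pi) := ⟨Real.two_pi_pos⟩
  AddCircle.liftIco (2 * Real.pi) 0 (fun θ => squareLoop (5 * θ / (2 * Real.pi)))

lemma squareLoop_five : squareLoop 5 = squareLoop 0 := by
  rw [squareLoop_four_five (by norm_num) le_rfl, squareLoop_zero_one le_rfl zero_le_one]
  norm_num

lemma continuous_angleLoop : Continuous angleLoop := by
  have : Fact (0 < 2 * Real.pi) := ⟨Real.two_pi_pos⟩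
  refine AddCircle.liftIco_continuous ?_ ?_
  · have h : 5 * (0 + 2 * Real.pi) / (2 * Real.pi) = 5 := by
      have := Real.pi_pos.ne'
      field_simp
      simp
    rw [h, squareLoop_five]
    simp
  · exact (continuous_squareLoop.comp (by fun_prop)).continuousOn

lemma angleLoop_coe {s : ℝ} (h : 0 ≤ s) (h' : s ≤ 5) :
    angleLoop ((2 * Real.pi * s / 5 : ℝ) : Real.Angle) = squareLoop s := by
  have : Fact (0 < 2 * Real.pi) := ⟨Real.two_pi_pos⟩
  have hpi := Real.pi_pos
  have key : ∀ s : ℝ, 0 ≤ s → s < 5 →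
      angleLoop ((2 * Real.pi * s / 5 : ℝ) : Real.Angle) = squareLoop s := by
    intro s h h'
    have : angleLoop ((2 * Real.pi * s / 5 : ℝ) : Real.Angle) =
        squareLoop (5 * (2 * Real.pi * s / 5) / (2 * Real.pi)) := by
      refine AddCircle.liftIco_coe_apply ⟨by positivity, ?_⟩
      rw [zero_add, div_lt_iff₀ (by norm_num)]
      nlinarith
    rw [this]
    congr 1
    field_simp
  rcases h'.lt_or_eq with h' | rfl
  · exact key s h h'
  -- The endpoint s = 5 lies outside the half-open interval of the lift and is reached by
  -- periodicity.
  · have e : ((2 * Real.pi * 5 / 5 : ℝ) : Real.Angle) = ((2 * Real.pi * 0 / 5 : ℝ) : Real.Angle) := by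
      rw [mul_div_cancel_right₀ _ (by norm_num)]
      simp
    rw [e, key 0 le_rfl (by norm_num), squareLoop_five]

lemma exists_angle_eq (θ : Real.Angle) :
    ∃ s ∈ Set.Ico (0 : ℝ) 5, θ = ((2 * Real.pi * s / 5 : ℝ) : Real.Angle) := by
  have : Fact (0 < 2 * Real.pi) := ⟨Real.two_pi_pos⟩
  have hpi := Real.pi_pos
  obtain ⟨u, hu, rfl⟩ : ∃ u ∈ Set.Ico (0 : ℝ) (0 + 2 * Real.pi), (u : Real.Angle) = θ :=
    ⟨_, (AddCircle.equivIco (2 * Real.pi) 0 θ).2, (AddCircle.equivIco (2 * Real.pi) 0).symm_apply_apply θ⟩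
  refine ⟨5 * u / (2 * Real.pi), ⟨div_nonneg (by linarith [hu.1]) (by linarith), ?_⟩, ?_⟩
  · rw [div_lt_iff₀ (by linarith)]
    linarith [hu.2]
  · congr 1
    field_simp

lemma norm_angleLoop (θ : Real.Angle) : ‖angleLoop θ‖ = 1 := by
  obtain ⟨s, hs, rfl⟩ := exists_angle_eq θ
  rw [angleLoop_coe hs.1 hs.2.le, norm_squareLoop hs.1 hs.2.le]

lemma angleLoop_injective : Function.Injective angleLoop := by
  intro θ θ' h
  obtain ⟨s, hs, rfl⟩ := exists_angle_eq θ
  obtain ⟨s', hs', rfl⟩ := exists_angle_eq θ'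
  rw [angleLoop_coe hs.1 hs.2.le, angleLoop_coe hs'.1 hs'.2.le] at h
  rw [squareLoop_injOn hs hs' h]

lemma exists_angleLoop {q : ℝ × ℝ} (hq : ‖q‖ = 1) : ∃ θ, angleLoop θ = q := by
  obtain ⟨s, hs, h⟩ := exists_squareLoop hq
  exact ⟨_, (angleLoop_coe hs.1 hs.2.le).trans h⟩

/-- A norm preserving homeomorphism from the complex plane to the plane with the sup norm. -/
def discToSquare (w : ℂ) : ℝ × ℝ := ‖w‖ • angleLoop (w.arg : Real.Angle)

lemma norm_discToSquare (w : ℂ) : ‖discToSquare w‖ = ‖w‖ := by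
  rw [discToSquare, norm_smul, norm_angleLoop, mul_one, norm_norm]

/-- As an element of ℝ/2π the argument is continuous at every non-zero point; at 0 preservation of
the norm suffices. -/
lemma continuous_discToSquare : Continuous discToSquare := by
  rw [continuous_iff_continuousAt]
  intro w
  by_cases hw : w = 0
  · subst hw
    have h0 : discToSquare 0 = 0 := by rw [discToSquare, norm_zero, zero_smul]
    rw [ContinuousAt, h0, tendsto_zero_iff_norm_tendsto_zero]
    simp only [norm_discToSquare]
    exact tendsto_norm_zero
  · exact continuous_norm.continuousAt.smul
      (continuous_angleLoop.continuousAt.comp (Complex.continuousAt_arg_coe_angle hw))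

lemma discToSquare_injective : Function.Injective discToSquare := by
  intro w w' h
  have hn : ‖w‖ = ‖w'‖ := by rw [← norm_discToSquare, h, norm_discToSquare]
  by_cases hw : w = 0
  · rw [hw, norm_zero] at hn
    rw [hw, norm_eq_zero.1 hn.symm]
  · have hpos : ‖w‖ ≠ 0 := norm_ne_zero_iff.2 hw
    unfold discToSquare at h
    rw [← hn] at h
    exact Complex.ext_norm_arg hn
      (Complex.arg_coe_angle_eq_iff.1 (angleLoop_injective (smul_right_injective _ hpos h)))

lemma discToSquare_polar {r : ℝ} (hr : 0 < r) (θ : ℝ) :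
    discToSquare (r * Complex.exp (θ * Complex.I)) = r • angleLoop (θ : Real.Angle) := by
  unfold discToSquare
  have h1 : ((r * Complex.exp (θ * Complex.I) : ℂ).arg : Real.Angle) = θ := by
    rw [Complex.arg_real_mul _ hr, Complex.exp_mul_I, ← Complex.ofReal_cos, ← Complex.ofReal_sin]
    exact Complex.arg_cos_add_sin_mul_I_coe_angle (θ : Real.Angle)
  rw [h1, norm_mul, Complex.norm_exp_ofReal_mul_I, mul_one, Complex.norm_real,
    Real.norm_of_nonneg hr.le]

lemma discToSquare_surjective : Function.Surjective discToSquare := by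
  intro q
  by_cases hq : q = 0
  · exact ⟨0, by rw [hq, discToSquare, norm_zero, zero_smul]⟩
  · have hpos : 0 < ‖q‖ := norm_pos_iff.2 hq
    obtain ⟨θ, hθ⟩ := exists_angleLoop (q := ‖q‖⁻¹ • q) (by
      rw [norm_smul, norm_inv, norm_norm, inv_mul_cancel₀ hpos.ne'])
    obtain ⟨s, -, rfl⟩ := exists_angle_eq θ
    exact ⟨_, by rw [discToSquare_polar hpos, hθ, smul_inv_smul₀ hpos.ne']⟩

lemma discToSquare_exp {s : ℝ} (h : 0 ≤ s) (h' : s ≤ 5) :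
    discToSquare (Complex.exp (2 * Real.pi * Complex.I * s / (5 : ℕ))) = squareLoop s := by
  have := discToSquare_polar one_pos (2 * Real.pi * s / 5)
  rw [angleLoop_coe h h', one_smul] at this
  rw [← this]
  congr 1
  push_cast
  rw [one_mul]
  congr 1
  ring

lemma image_discToSquare_ball : discToSquare '' Metric.ball 0 1 = Metric.ball 0 1 := by
  ext q
  constructor
  · rintro ⟨w, hw, rfl⟩
    rw [mem_ball_zero_iff] at hw ⊢
    rwa [norm_discToSquare]
  · intro hq
    obtain ⟨w, rfl⟩ := discToSquare_surjective q
    refine ⟨w, ?_, rfl⟩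
    rw [mem_ball_zero_iff] at hq ⊢
    rwa [norm_discToSquare] at hq

lemma image_discToSquare_closedBall :
    discToSquare '' Metric.closedBall 0 1 = Metric.closedBall 0 1 := by
  ext q
  constructor
  · rintro ⟨w, hw, rfl⟩
    rw [mem_closedBall_zero_iff] at hw ⊢
    rwa [norm_discToSquare]
  · intro hq
    obtain ⟨w, rfl⟩ := discToSquare_surjective q
    refine ⟨w, ?_, rfl⟩
    rw [mem_closedBall_zero_iff] at hq ⊢
    rwa [norm_discToSquare] at hq

/-! ## The open cells of the completed face -/

namespace Admissible

variable (H : Admissible m)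
include H

lemma exists_of_sameType_faceMap {q : ℝ × ℝ} (hq : q ∈ Metric.closedBall (0 : ℝ × ℝ) 1)
    (h1 : q.2 ≠ 1) {y : BorelSerre m} (h : SameType (faceMap q) y) :
    ∃ q' ∈ Metric.closedBall (0 : ℝ × ℝ) 1, y = faceMap q' ∧ q'.2 ≠ 1 ∧
      (q.1 = -1 ↔ q'.1 = -1) ∧ (q.1 = 1 ↔ q'.1 = 1) ∧ (q.2 = -1 ↔ q'.2 = -1) ∧
      (q.2 = -1 ∧ q.1 = 0 ↔ q'.2 = -1 ∧ q'.1 = 0) := by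
  obtain ⟨p, e, hp, hre, -, hN⟩ := faceMap_inner (m := m) hq h1
  rw [e] at h
  obtain ⟨p', rfl, hp', a1, a2, a3, a4⟩ := H.sameType_inner hp h
  obtain ⟨q', hq', e', h1', hre', hN'⟩ := exists_faceMap_eq (m := m) hp'
  have b : ∀ x : ℝ, (x / 2 = -1 / 2 ↔ x = -1) ∧ (x / 2 = 1 / 2 ↔ x = 1) ∧ (x / 2 = 0 ↔ x = 0) :=
    fun x => ⟨by constructor <;> intro h <;> linarith, by constructor <;> intro h <;> linarith,
      by constructor <;> intro h <;> linarith⟩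
  rw [hN, hN', hre, hre', (b _).2.2, (b _).2.2] at a4
  rw [hN, hN'] at a3
  rw [hre, hre', (b _).1, (b _).1] at a1
  rw [hre, hre', (b _).2.1, (b _).2.1] at a2
  exact ⟨q', hq', e'.symm, h1', a1, a2, a3, a4⟩

lemma sameType_faceMap {q q' : ℝ × ℝ} (hq : q ∈ Metric.closedBall (0 : ℝ × ℝ) 1) (h1 : q.2 ≠ 1)
    (hq' : q' ∈ Metric.closedBall (0 : ℝ × ℝ) 1) (h1' : q'.2 ≠ 1)
    (h : (q.2 ≠ -1 ∧ q'.2 ≠ -1 ∧ (q.1 = q'.1 ∨ (|q.1| < 1 ∧ |q'.1| < 1))) ∨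
      (q.2 = -1 ∧ q'.2 = -1 ∧ 0 < |q.1| ∧ |q.1| < 1 ∧ 0 < |q'.1| ∧ |q'.1| < 1)) :
    SameType (faceMap q : BorelSerre m) (faceMap q') := by
  obtain ⟨p, e, hp, hre, -, hN⟩ := faceMap_inner (m := m) hq h1
  obtain ⟨p', e', hp', hre', -, hN'⟩ := faceMap_inner (m := m) hq' h1'
  rw [e, e']
  have b : ∀ x : ℝ, (|x / 2| < 1 / 2 ↔ |x| < 1) ∧ (0 < |x / 2| ↔ 0 < |x|) := by
    intro x
    rw [abs_div, abs_two]
    exact ⟨by constructor <;> intro h <;> linarith, by constructor <;> intro h <;> linarith⟩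
  have c : ∀ p : H3, InFd p → (1 < p.z.re ^ 2 + p.ζ ^ 2 ↔ ¬ p.z.re ^ 2 + p.ζ ^ 2 = 1) :=
    fun p hp => ⟨fun h => h.ne', fun h => lt_of_le_of_ne hp.2.2 (Ne.symm h)⟩
  apply H.sameType_of_inFd hp hp'
  rw [c p hp, c p' hp', hN, hN', hre, hre', (b _).1, (b _).1, (b _).2, (b _).2,
    div_left_inj' (two_ne_zero)]
  exact h

omit H in
lemma isPreconnected_image_faceMap {Q : Set (ℝ × ℝ)} (hQ : IsPreconnected Q)
    (h : Q ⊆ Metric.closedBall 0 1) : IsPreconnected (faceMap '' Q : Set (BorelSerre m)) :=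
  hQ.image _ (continuousOn_faceMap.mono h)

lemma isOpenCell_ball :
    IsOpenCell (faceMap '' Metric.ball (0 : ℝ × ℝ) 1 : Set (BorelSerre m)) := by
  have hsub : ∀ q : ℝ × ℝ, q ∈ Metric.ball (0 : ℝ × ℝ) 1 →
      q ∈ Metric.closedBall (0 : ℝ × ℝ) 1 ∧ |q.1| < 1 ∧ q.2 ≠ -1 ∧ q.2 ≠ 1 := fun q hq =>
    ⟨Metric.ball_subset_closedBall hq, abs_lt.2 (mem_square_interior.1 hq).1,
      (mem_square_interior.1 hq).2.1.ne', (mem_square_interior.1 hq).2.2.ne⟩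
  have h0 : (0 : ℝ × ℝ) ∈ Metric.ball (0 : ℝ × ℝ) 1 := Metric.mem_ball_self one_pos
  refine isOpenCell_of_eq ⟨0, h0, rfl⟩
    (isPreconnected_image_faceMap (convex_ball _ _).isPreconnected
      Metric.ball_subset_closedBall) ?_ ?_
  · rintro _ ⟨q, hq, rfl⟩
    exact H.sameType_faceMap (hsub _ h0).1 (hsub _ h0).2.2.2 (hsub _ hq).1 (hsub _ hq).2.2.2
      (.inl ⟨(hsub _ h0).2.2.1, (hsub _ hq).2.2.1, .inr ⟨(hsub _ h0).2.1, (hsub _ hq).2.1⟩⟩)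
  · intro y hy
    obtain ⟨q, hq, rfl, h1, a1, a2, a3, -⟩ :=
      H.exists_of_sameType_faceMap (hsub _ h0).1 (hsub _ h0).2.2.2 hy
    rw [mem_square] at hq
    have b1 : q.1 ≠ -1 := by rw [← not_iff_not] at a1; exact a1.1 (by norm_num)
    have b2 : q.1 ≠ 1 := by rw [← not_iff_not] at a2; exact a2.1 (by norm_num)
    have b3 : q.2 ≠ -1 := by rw [← not_iff_not] at a3; exact a3.1 (by norm_num)
    exact ⟨q, mem_square_interior.2 ⟨⟨lt_of_le_of_ne hq.1.1 b1.symm, lt_of_le_of_ne hq.1.2 b2⟩,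
      lt_of_le_of_ne hq.2.1 b3.symm, lt_of_le_of_ne hq.2.2 h1⟩, rfl⟩

lemma isOpenCell_vertical {c : ℝ} (hc : c = 1 ∨ c = -1) :
    IsOpenCell (faceMap '' ({c} ×ˢ Set.Ioo (-1) 1) : Set (BorelSerre m)) := by
  have hsub : ∀ q : ℝ × ℝ, q ∈ ({c} ×ˢ Set.Ioo (-1) 1 : Set (ℝ × ℝ)) →
      q ∈ Metric.closedBall (0 : ℝ × ℝ) 1 ∧ q.2 ≠ -1 ∧ q.2 ≠ 1 := by
    rintro ⟨x, y⟩ ⟨rfl, h1, h2⟩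
    refine ⟨mem_square.2 ⟨?_, h1.le, h2.le⟩, h1.ne', h2.ne⟩
    simp only at hc ⊢
    rcases hc with rfl | rfl <;> norm_num
  have h0 : (c, 0) ∈ ({c} ×ˢ Set.Ioo (-1) 1 : Set (ℝ × ℝ)) := ⟨rfl, by norm_num⟩
  refine isOpenCell_of_eq ⟨_, h0, rfl⟩ (isPreconnected_image_faceMap
    (isPreconnected_singleton.prod isPreconnected_Ioo) fun q hq => (hsub q hq).1) ?_ ?_
  · rintro _ ⟨q, hq, rfl⟩
    exact H.sameType_faceMap (hsub _ h0).1 (hsub _ h0).2.2 (hsub _ hq).1 (hsub _ hq).2.2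
      (.inl ⟨(hsub _ h0).2.1, (hsub _ hq).2.1, .inl hq.1.symm⟩)
  · intro y hy
    obtain ⟨q, hq, rfl, h1, a1, a2, a3, -⟩ :=
      H.exists_of_sameType_faceMap (hsub _ h0).1 (hsub _ h0).2.2 hy
    rw [mem_square] at hq
    simp only at a1 a2 a3
    have b : q.1 = c := by rcases hc with rfl | rfl <;> tauto
    have b3 : q.2 ≠ -1 := by rw [← not_iff_not] at a3; exact a3.1 (by norm_num)
    exact ⟨q, ⟨b, lt_of_le_of_ne hq.2.1 b3.symm, lt_of_le_of_ne hq.2.2 h1⟩, rfl⟩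

/-- The type class here is the open arc minus its midpoint. It has two components, separated by the
sign of Re z. -/
lemma isOpenCell_arc {a b : ℝ} (hab : (a = 0 ∧ b = 1) ∨ (a = -1 ∧ b = 0)) :
    IsOpenCell (faceMap '' (Set.Ioo a b ×ˢ {-1}) : Set (BorelSerre m)) := by
  have hsub : ∀ q : ℝ × ℝ, q ∈ (Set.Ioo a b ×ˢ {-1} : Set (ℝ × ℝ)) →
      q ∈ Metric.closedBall (0 : ℝ × ℝ) 1 ∧ q.2 = -1 ∧ q.2 ≠ 1 ∧ 0 < |q.1| ∧ |q.1| < 1 := by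
    rintro ⟨x, y⟩ ⟨⟨h1, h2⟩, rfl⟩
    simp only at h1 h2
    refine ⟨mem_square.2 ⟨?_, by norm_num⟩, rfl, by norm_num, abs_pos.2 ?_, abs_lt.2 ?_⟩ <;>
      simp only <;> rcases hab with ⟨rfl, rfl⟩ | ⟨rfl, rfl⟩
    · constructor <;> linarith
    · constructor <;> linarith
    · exact h1.ne'
    · exact h2.ne
    · constructor <;> linarith
    · constructor <;> linarith
  -- The sign of x on the chosen half: 1 on the right, -1 on the left.
  let sg : ℝ := a + b
  have hsg : sg = 1 ∨ sg = -1 := by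
    rcases hab with ⟨rfl, rfl⟩ | ⟨rfl, rfl⟩ <;> simp [sg]
  have hQ : ∀ q : ℝ × ℝ, q ∈ (Set.Ioo a b ×ˢ {-1} : Set (ℝ × ℝ)) ↔
      q.2 = -1 ∧ 0 < sg * q.1 ∧ |q.1| < 1 := by
    rintro ⟨x, y⟩
    simp only [Set.mem_prod, Set.mem_Ioo, Set.mem_singleton_iff, abs_lt, sg]
    rcases hab with ⟨rfl, rfl⟩ | ⟨rfl, rfl⟩
    · constructor
      · rintro ⟨⟨h1, h2⟩, h3⟩; exact ⟨h3, by linarith, by linarith, h2⟩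
      · rintro ⟨h3, h1, -, h2⟩; exact ⟨⟨by linarith, h2⟩, h3⟩
    · constructor
      · rintro ⟨⟨h1, h2⟩, h3⟩; exact ⟨h3, by linarith, h1, by linarith⟩
      · rintro ⟨h3, h1, h2, -⟩; exact ⟨⟨h2, by linarith⟩, h3⟩
  have h0 : (sg / 2, -1) ∈ (Set.Ioo a b ×ˢ {-1} : Set (ℝ × ℝ)) := by
    rw [hQ]
    rcases hsg with h | h <;> rw [h] <;> norm_num [abs_lt]
  have hz : Continuous fun p : H3 => sg * p.z.re :=
    continuous_const.mul (Complex.continuous_re.comp continuous_z)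
  have hpos : ∀ q ∈ Metric.closedBall (0 : ℝ × ℝ) 1, q.2 ≠ 1 →
      (((faceMap q : BorelSerre m) ∈ BorelSerre.inner '' {p | 0 < sg * p.z.re} ↔ 0 < sg * q.1) ∧
      ((faceMap q : BorelSerre m) ∈ BorelSerre.inner '' {p | sg * p.z.re < 0} ↔ sg * q.1 < 0)) := by
    intro q hq h1
    obtain ⟨p, e, -, hre, -, -⟩ := faceMap_inner (m := m) hq h1
    rw [e, inner_injective.mem_set_image, inner_injective.mem_set_image]
    simp only [Set.mem_ofPred_eq, hre]
    constructor <;> constructor <;> intro h <;> linarith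
  have hcl : ∀ y : BorelSerre m, SameType (faceMap (sg / 2, -1)) y →
      ∃ q ∈ Metric.closedBall (0 : ℝ × ℝ) 1, y = faceMap q ∧ q.2 ≠ 1 ∧ q.2 = -1 ∧ sg * q.1 ≠ 0 ∧
        |q.1| < 1 := by
    intro y hy
    obtain ⟨q, hq, rfl, h1, a1, a2, a3, a4⟩ :=
      H.exists_of_sameType_faceMap (hsub _ h0).1 (hsub _ h0).2.2.1 hy
    have hlt := abs_lt.1 (hsub _ h0).2.2.2.2
    have hne := abs_pos.1 (hsub _ h0).2.2.2.1
    rw [mem_square] at hq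
    have b3 : q.2 = -1 := a3.1 rfl
    have b1 : q.1 ≠ -1 := by rw [← not_iff_not] at a1; exact a1.1 hlt.1.ne'
    have b2 : q.1 ≠ 1 := by rw [← not_iff_not] at a2; exact a2.1 hlt.2.ne
    have b4 : q.1 ≠ 0 := fun h => hne (a4.2 ⟨b3, h⟩).2
    have hsg0 : sg ≠ 0 := by rcases hsg with h | h <;> rw [h] <;> norm_num
    exact ⟨q, mem_square.2 hq, rfl, h1, b3, mul_ne_zero hsg0 b4,
      abs_lt.2 ⟨lt_of_le_of_ne hq.1.1 b1.symm, lt_of_le_of_ne hq.1.2 b2⟩⟩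
  refine isOpenCell_of (U := BorelSerre.inner '' {p | 0 < sg * p.z.re})
    (V := BorelSerre.inner '' {p | sg * p.z.re < 0}) ⟨_, h0, rfl⟩ (isPreconnected_image_faceMap
    (isPreconnected_Ioo.prod isPreconnected_singleton) fun q hq => (hsub q hq).1) ?_
    (isOpenMap_inner _ (isOpen_lt continuous_const hz))
    (isOpenMap_inner _ (isOpen_lt hz continuous_const)) ?_ ?_ ?_ ?_
  · rintro _ ⟨q, hq, rfl⟩
    exact H.sameType_faceMap (hsub _ h0).1 (hsub _ h0).2.2.1 (hsub _ hq).1 (hsub _ hq).2.2.1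
      (.inr ⟨rfl, (hsub _ hq).2.1, (hsub _ h0).2.2.2.1, (hsub _ h0).2.2.2.2,
        (hsub _ hq).2.2.2.1, (hsub _ hq).2.2.2.2⟩)
  · intro y hy
    obtain ⟨q, hq, rfl, h1, -, h2, -⟩ := hcl y hy
    rw [(hpos q hq h1).1, (hpos q hq h1).2]
    exact h2.lt_or_gt.symm
  · intro y hy
    obtain ⟨q, hq, rfl, h1, -, -, -⟩ := hcl y hy
    rw [(hpos q hq h1).1, (hpos q hq h1).2]
    exact fun h => h.le.not_gt
  · rw [(hpos _ (hsub _ h0).1 (hsub _ h0).2.2.1).1]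
    exact ((hQ _).1 h0).2.1
  · intro y hy
    obtain ⟨q, hq, rfl, h1, h3, -, h4⟩ := hcl y hy
    rw [(hpos q hq h1).1]
    exact fun h => ⟨q, (hQ q).2 ⟨h3, h, h4⟩, rfl⟩

/-- `transfer` is not needed: the invariants of the type already determine each of these points, so
its class is a singleton. -/
lemma isOpenCell_lower_vertex {c : ℝ} (hc : c = 1 ∨ c = -1 ∨ c = 0) :
    IsOpenCell ({faceMap (c, -1)} : Set (BorelSerre m)) := by
  have hq : (c, -1) ∈ Metric.closedBall (0 : ℝ × ℝ) 1 :=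
    mem_square.2 ⟨by rcases hc with rfl | rfl | rfl <;> norm_num, by norm_num⟩
  refine isOpenCell_of_eq (Set.mem_singleton _) isPreconnected_singleton ?_ ?_
  · rintro _ rfl
    exact sameType_refl _
  · intro y hy
    obtain ⟨q, -, rfl, -, a1, a2, a3, a4⟩ := H.exists_of_sameType_faceMap hq (by norm_num) hy
    simp only at a1 a2 a3 a4
    have b : q = (c, -1) := Prod.ext (by rcases hc with rfl | rfl | rfl <;> tauto) (a3.1 trivial)
    rw [b]; rfl

/-- Points of the same type in planes at other cusps are not ruled out. The plane at ∞ is open and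
closed in the attached boundary, and this separates them from the component in question. -/
lemma isOpenCell_upper {C : Set (BorelSerre m)} {c : ℝ} (hc : |c| ≤ 1)
    (hx : (faceMap (c, 1) : BorelSerre m) ∈ C)
    (hC : IsPreconnected C) (hCS : ∀ y ∈ C, SameType (faceMap (c, 1)) y)
    (h : ∀ x : ℝ, |x| ≤ 1 → (c = -1 ↔ x = -1) → (c = 1 ↔ x = 1) → faceMap (x, 1) ∈ C) :
    IsOpenCell C := by
  rw [faceMap_top] at hx hCS
  have hnot : ∀ y : BorelSerre m, SameType (atInfinity ((c / 2 : ℝ) : ℂ)) y → y ∉ innerPart m :=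
    fun y hy h' => atInfinity_notMem_innerPart _ (hy.2.2 h')
  have hc2 : |c / 2| ≤ 1 / 2 := by rw [abs_div, abs_two]; linarith
  have b : ∀ x : ℝ, (x / 2 = -1 / 2 ↔ x = -1) ∧ (x / 2 = 1 / 2 ↔ x = 1) :=
    fun x => ⟨by constructor <;> intro h <;> linarith, by constructor <;> intro h <;> linarith⟩
  refine isOpenCell_of (U := innerPart m ∪ planeAtInfinity m) (V := (planeAtInfinity m)ᶜ) hx hC hCS
    isOpen_inner_union_planeAtInfinity isOpen_compl_planeAtInfinity ?_ ?_ (.inr ⟨_, rfl⟩) ?_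
  · intro y _
    by_cases hy : y ∈ planeAtInfinity m
    · exact .inl (.inr hy)
    · exact .inr hy
  · intro y hy hyU hyV
    exact hyV (hyU.resolve_left (hnot y hy))
  · intro y hy hyU
    obtain ⟨x, rfl, hx, a1, a2⟩ := H.sameType_atInfinity hc2 hy (hyU.resolve_left (hnot y hy))
    have hx2 : 2 * x / 2 = x := by ring
    have := h (2 * x) (by rw [abs_mul, abs_two]; linarith)
      (by rw [← (b c).1, ← (b (2 * x)).1, hx2]; exact a1)
      (by rw [← (b c).2, ← (b (2 * x)).2, hx2]; exact a2)
    rwa [faceMap_top, hx2] at this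

lemma isOpenCell_top :
    IsOpenCell (faceMap '' (Set.Ioo (-1) 1 ×ˢ {1}) : Set (BorelSerre m)) := by
  have hsub : (Set.Ioo (-1) 1 ×ˢ {1} : Set (ℝ × ℝ)) ⊆ Metric.closedBall (0 : ℝ × ℝ) 1 := by
    rintro ⟨x, y⟩ ⟨⟨h1, h2⟩, rfl⟩
    exact mem_square.2 ⟨⟨h1.le, h2.le⟩, by norm_num⟩
  refine H.isOpenCell_upper (c := 0) (by simp) ⟨(0, 1), ⟨by norm_num, rfl⟩, rfl⟩
    (isPreconnected_image_faceMap (isPreconnected_Ioo.prod isPreconnected_singleton) hsub) ?_ ?_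
  · rintro _ ⟨⟨x, y⟩, ⟨⟨h1, h2⟩, rfl⟩, rfl⟩
    rw [faceMap_top, faceMap_top]
    simp only at h1 h2
    exact H.sameType_of_atInfinity (by norm_num) (abs_lt.2 ⟨by linarith, by linarith⟩)
  · intro x hx h1 h2
    have hx := abs_le.1 hx
    have b1 : x ≠ -1 := by rw [← not_iff_not] at h1; exact h1.1 (by norm_num)
    have b2 : x ≠ 1 := by rw [← not_iff_not] at h2; exact h2.1 (by norm_num)
    exact ⟨(x, 1), ⟨⟨lt_of_le_of_ne hx.1 b1.symm, lt_of_le_of_ne hx.2 b2⟩, rfl⟩, rfl⟩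

lemma isOpenCell_upper_vertex {c : ℝ} (hc : c = 1 ∨ c = -1) :
    IsOpenCell ({faceMap (c, 1)} : Set (BorelSerre m)) := by
  refine H.isOpenCell_upper (c := c) (by rcases hc with rfl | rfl <;> simp)
    (Set.mem_singleton _) isPreconnected_singleton ?_ ?_
  · rintro _ rfl
    exact sameType_refl _
  · intro x _ h1 h2
    have : x = c := by rcases hc with rfl | rfl <;> tauto
    rw [this]; rfl

/-! ## The edges -/

omit H in
lemma image_squareLoop_top : squareLoop '' Set.Ioo 0 1 = Set.Ioo (-1) 1 ×ˢ {1} := by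
  ext ⟨x, y⟩
  constructor
  · rintro ⟨s, ⟨h1, h2⟩, h⟩
    rw [squareLoop_zero_one h1.le h2.le] at h
    rw [← h]
    exact ⟨⟨by simp only; linarith, by simp only; linarith⟩, rfl⟩
  · rintro ⟨⟨h1, h2⟩, rfl⟩
    simp only at h1 h2
    refine ⟨(1 - x) / 2, ⟨by linarith, by linarith⟩, ?_⟩
    rw [squareLoop_zero_one (by linarith) (by linarith)]
    ext <;> simp only; ring

omit H in
lemma image_squareLoop_left : squareLoop '' Set.Ioo 1 2 = {-1} ×ˢ Set.Ioo (-1) 1 := by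
  ext ⟨x, y⟩
  constructor
  · rintro ⟨s, ⟨h1, h2⟩, h⟩
    rw [squareLoop_one_two h1.le h2.le] at h
    rw [← h]
    exact ⟨rfl, by simp only; linarith, by simp only; linarith⟩
  · rintro ⟨rfl, h1, h2⟩
    simp only at h1 h2
    refine ⟨(3 - y) / 2, ⟨by linarith, by linarith⟩, ?_⟩
    rw [squareLoop_one_two (by linarith) (by linarith)]
    ext <;> simp only; ring

omit H in
lemma image_squareLoop_arc {a b : ℝ} (ha : 2 ≤ a) (hb : b ≤ 4) :
    squareLoop '' Set.Ioo a b = Set.Ioo (a - 3) (b - 3) ×ˢ {-1} := by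
  ext ⟨x, y⟩
  constructor
  · rintro ⟨s, ⟨h1, h2⟩, h⟩
    rw [squareLoop_two_four (by linarith) (by linarith)] at h
    rw [← h]
    exact ⟨⟨by simp only; linarith, by simp only; linarith⟩, rfl⟩
  · rintro ⟨⟨h1, h2⟩, rfl⟩
    simp only at h1 h2
    refine ⟨x + 3, ⟨by linarith, by linarith⟩, ?_⟩
    rw [squareLoop_two_four (by linarith) (by linarith)]
    ext <;> simp only; ring

omit H in
lemma image_squareLoop_right : squareLoop '' Set.Ioo 4 5 = {1} ×ˢ Set.Ioo (-1) 1 := by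
  ext ⟨x, y⟩
  constructor
  · rintro ⟨s, ⟨h1, h2⟩, h⟩
    rw [squareLoop_four_five h1.le h2.le] at h
    rw [← h]
    exact ⟨rfl, by simp only; linarith, by simp only; linarith⟩
  · rintro ⟨rfl, h1, h2⟩
    simp only at h1 h2
    refine ⟨(y + 9) / 2, ⟨by linarith, by linarith⟩, ?_⟩
    rw [squareLoop_four_five (by linarith) (by linarith)]
    ext <;> simp only; ring

lemma isOpenCell_side (k : Fin 5) :
    IsOpenCell (faceMap '' (squareLoop '' Set.Ioo (k : ℕ) ((k : ℕ) + 1)) : Set (BorelSerre m)) := by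
  fin_cases k <;> norm_num
  · rw [image_squareLoop_top]
    exact H.isOpenCell_top
  · rw [image_squareLoop_left]
    exact H.isOpenCell_vertical (.inr rfl)
  · rw [image_squareLoop_arc (by norm_num) (by norm_num)]
    exact H.isOpenCell_arc (by norm_num)
  · rw [image_squareLoop_arc (by norm_num) (by norm_num)]
    exact H.isOpenCell_arc (by norm_num)
  · rw [image_squareLoop_right]
    exact H.isOpenCell_vertical (.inl rfl)

lemma isOpenCell_corner (k : ℕ) (hk : k ≤ 5) :
    IsOpenCell ({faceMap (squareLoop k)} : Set (BorelSerre m)) := by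
  have h0 : IsOpenCell ({faceMap (squareLoop 0)} : Set (BorelSerre m)) := by
    rw [squareLoop_zero_one (by norm_num) (by norm_num)]
    exact H.isOpenCell_upper_vertex (by norm_num)
  interval_cases k <;> norm_num
  · exact h0
  · rw [squareLoop_zero_one (by norm_num) (by norm_num)]
    exact H.isOpenCell_upper_vertex (by norm_num)
  · rw [squareLoop_two_four (by norm_num) (by norm_num)]
    exact H.isOpenCell_lower_vertex (by norm_num)
  · rw [squareLoop_two_four (by norm_num) (by norm_num)]
    exact H.isOpenCell_lower_vertex (by norm_num)
  · rw [squareLoop_two_four (by norm_num) (by norm_num)]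
    exact H.isOpenCell_lower_vertex (by norm_num)
  · rw [squareLoop_five]
    exact h0

omit H in
lemma squareLoop_mem (k : Fin 5) (t : I) :
    0 ≤ ((k : ℕ) + t : ℝ) ∧ ((k : ℕ) + t : ℝ) ≤ 5 := by
  have h : ((k : ℕ) : ℝ) ≤ 4 := by exact_mod_cast Nat.lt_succ_iff.1 k.2
  have h' : (0 : ℝ) ≤ (k : ℕ) := Nat.cast_nonneg _
  exact ⟨by linarith [t.2.1], by linarith [t.2.2]⟩

omit H in
lemma squareLoop_mem_closedBall (k : Fin 5) (t : I) :
    squareLoop ((k : ℕ) + t) ∈ Metric.closedBall (0 : ℝ × ℝ) 1 :=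
  mem_closedBall_zero_iff.2 (norm_squareLoop (squareLoop_mem k t).1 (squareLoop_mem k t).2).le

/-- The edges of the completed face. -/
def faceEdge (k : Fin 5) : Edge m where
  toFun := ⟨fun t => faceMap (squareLoop ((k : ℕ) + t)),
    continuousOn_faceMap.comp_continuous (continuous_squareLoop.comp (by fun_prop))
      (squareLoop_mem_closedBall k)⟩
  injOn := by
    intro t ht t' ht' h
    have h1 := injOn_faceMap (squareLoop_mem_closedBall k t) (squareLoop_mem_closedBall k t') h
    have key : ∀ t : I, t ∈ Set.Ioo (0 : I) 1 → ((k : ℕ) + t : ℝ) ∈ Set.Ico (0 : ℝ) 5 := by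
      intro t ht
      refine ⟨(squareLoop_mem k t).1, ?_⟩
      have h : ((k : ℕ) : ℝ) ≤ 4 := by exact_mod_cast Nat.lt_succ_iff.1 k.2
      have : (t : ℝ) < 1 := ht.2
      linarith
    have h2 := squareLoop_injOn (key t ht) (key t' ht') h1
    exact Subtype.ext (by linarith)
  isOpenCell := by
    convert H.isOpenCell_side k using 1
    ext y
    constructor
    · rintro ⟨t, ⟨h1, h2⟩, rfl⟩
      have h1 : (0 : ℝ) < t := h1
      have h2 : (t : ℝ) < 1 := h2
      exact ⟨_, ⟨_, ⟨by linarith, by linarith⟩, rfl⟩, rfl⟩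
    · rintro ⟨_, ⟨s, ⟨h1, h2⟩, rfl⟩, rfl⟩
      refine ⟨⟨s - (k : ℕ), by linarith, by linarith⟩, ⟨?_, ?_⟩, ?_⟩
      · exact (sub_pos.2 h1 : (0 : ℝ) < s - (k : ℕ))
      · exact (by linarith : s - (k : ℕ) < (1 : ℝ))
      · change faceMap (squareLoop ((k : ℕ) + (s - (k : ℕ)))) = _
        rw [add_sub_cancel]
  isOpenCell_source := by
    convert H.isOpenCell_corner k (by omega) using 2
    change faceMap (squareLoop ((k : ℕ) + ((0 : I) : ℝ))) = _
    simp
  isOpenCell_target := by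
    convert H.isOpenCell_corner ((k : ℕ) + 1) (by omega) using 2
    change faceMap (squareLoop ((k : ℕ) + ((1 : I) : ℝ))) = _
    simp

lemma faceEdge_apply (k : Fin 5) (t : I) :
    H.faceEdge k t = faceMap (squareLoop ((k : ℕ) + t)) := rfl

/-- The completed face as a 2-cell with five edges. -/
def faceCell : PolygonalCell m 5 where
  toFun w := faceMap (discToSquare w)
  continuousOn := continuousOn_faceMap.comp continuous_discToSquare.continuousOn fun w hw => by
    rw [← image_discToSquare_closedBall]
    exact ⟨w, hw, rfl⟩
  injOn := by
    intro w hw w' hw' h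
    refine discToSquare_injective (injOn_faceMap ?_ ?_ h) <;>
      · rw [← image_discToSquare_closedBall]
        exact ⟨_, by assumption, rfl⟩
  isOpenCell := by
    rw [← Set.image_image (fun q => (faceMap q : BorelSerre m)), image_discToSquare_ball]
    exact H.isOpenCell_ball
  edge := H.faceEdge
  boundary_eq k t := by
    rw [H.faceEdge_apply, ← discToSquare_exp (squareLoop_mem k t).1 (squareLoop_mem k t).2]
    push_cast
    rfl

end Admissible

/-! ## The real upper half-plane -/

lemma inner_realEmbedding_smul (g : SL(2, ℤ)) (τ : UpperHalfPlane) :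
    (BorelSerre.inner (realEmbedding (g • τ)) : BorelSerre m) =
      (Matrix.SpecialLinearGroup.map (Int.castRingHom (RingInt m)) g) •
        BorelSerre.inner (realEmbedding τ) := by
  rw [smul_inner]
  congr 1
  have he : ∀ i j, toC (Matrix.SpecialLinearGroup.map (Int.castRingHom (RingInt m)) g) i j =
      ((g i j : ℝ) : ℂ) := by
    intro i j
    rw [toC_apply]
    change intToComplex m ((g i j : ℤ) : RingInt m) = _
    simp
  have hd : (g 0 0 * g 1 1 - g 0 1 * g 1 0 : ℝ) = 1 := by exact_mod_cast det_entries g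
  have hsm := UpperHalfPlane.coe_specialLinearGroup_apply g τ
  simp only [algebraMap_int_eq, eq_intCast] at hsm
  have hz : (realEmbedding τ).z = (τ.re : ℂ) := rfl
  have hζ : (realEmbedding τ).ζ = τ.im := rfl
  have hre : (τ : ℂ).re = τ.re := rfl
  have him : (τ : ℂ).im = τ.im := rfl
  generalize hγ : toC (Matrix.SpecialLinearGroup.map (Int.castRingHom (RingInt m)) g) = γ at he
  have hf : factor (γ 1 0) (γ 1 1) (realEmbedding τ) =
      Complex.normSq (((g 1 0 : ℝ) : ℂ) * τ + ((g 1 1 : ℝ) : ℂ)) := by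
    rw [he, he, factor, hz, hζ, Complex.normSq_apply, Complex.normSq_apply, Complex.normSq_apply]
    simp
    ring
  apply H3.ext
  · rw [act_z, hf]
    change (((g • τ : UpperHalfPlane) : ℂ).re : ℂ) = _
    have hn : numer γ (realEmbedding τ) = ((((g 0 0 : ℝ) * τ.re + (g 0 1 : ℝ)) *
        ((g 1 0 : ℝ) * τ.re + (g 1 1 : ℝ)) + (g 0 0 : ℝ) * (g 1 0 : ℝ) * τ.im ^ 2 : ℝ) : ℂ) := by
      unfold numer
      rw [he, he, he, he, hz, hζ]
      simp only [map_add, map_mul, Complex.conj_ofReal]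
      push_cast
      ring
    rw [hn, ← Complex.ofReal_div]
    congr 1
    rw [hsm, Complex.div_re]
    simp
    ring
  · rw [act_ζ, hf]
    change ((g • τ : UpperHalfPlane) : ℂ).im = τ.im / _
    rw [hsm, Complex.div_im]
    rw [← sub_div]
    congr 1
    simp
    linear_combination τ.im * hd

lemma range_realEmbedding : Set.range realEmbedding = realHalfPlane := by
  ext p
  constructor
  · rintro ⟨τ, rfl⟩
    exact Complex.ofReal_im _
  · intro hp
    refine ⟨⟨⟨p.z.re, p.ζ⟩, p.ζ_pos⟩, ?_⟩
    apply H3.ext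
    · have hp : p.z.im = 0 := hp
      apply Complex.ext
      · exact Complex.ofReal_re _
      · rw [hp]; exact Complex.ofReal_im _
    · rfl

namespace Admissible

variable (H : Admissible m)
include H

lemma realFace_eq : realFace m = realEmbedding '' ModularGroup.fd := by
  have key : ∀ τ : UpperHalfPlane, InFd (realEmbedding τ) ↔ τ ∈ ModularGroup.fd := by
    intro τ
    have e : Complex.normSq (τ : ℂ) = τ.re ^ 2 + τ.im ^ 2 := by
      rw [Complex.normSq_apply]
      change τ.re * τ.re + τ.im * τ.im = _
      ring
    change ((τ.re : ℂ).im = 0 ∧ |τ.re| ≤ 1 / 2 ∧ 1 ≤ τ.re ^ 2 + τ.im ^ 2) ↔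
      1 ≤ Complex.normSq (τ : ℂ) ∧ |τ.re| ≤ 1 / 2
    rw [e, Complex.ofReal_im]
    tauto
  ext p
  rw [H.mem_realFace]
  constructor
  · intro hp
    obtain ⟨τ, rfl⟩ : p ∈ Set.range realEmbedding := range_realEmbedding ▸ hp.1
    exact ⟨τ, (key τ).1 hp, rfl⟩
  · rintro ⟨τ, hτ, rfl⟩
    exact (key τ).2 hτ

/-- Points of the parallelogram have Im z ≥ 0, so moving a point of the face in the direction -i
leaves the polyhedron at once. -/
lemma realFace_subset_frontier : realFace m ⊆ frontier (polyhedron m) := by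
  intro p hp
  refine ⟨subset_closure hp.1, fun hint => ?_⟩
  let f : ℝ → H3 := fun t => .ofCoord (p.z - t * Complex.I) p.ζ p.ζ_pos
  have hf : Continuous f := Continuous.subtype_mk (by fun_prop) _
  have h0 : f 0 = p := H3.ext (by simp [f, H3.ofCoord_z]) rfl
  have hev : ∀ᶠ t in nhdsWithin (0 : ℝ) (Set.Ioi 0), f t ∈ polyhedron m := by
    refine Filter.Eventually.filter_mono nhdsWithin_le_nhds (hf.continuousAt.eventually ?_)
    rw [h0]
    exact mem_interior_iff_mem_nhds.1 hint
  obtain ⟨t, ht, ht0⟩ := (hev.and self_mem_nhdsWithin).exists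
  obtain ⟨s, u, -, hu, -, hz⟩ := ht.1
  have him := congrArg Complex.im hz
  have hpi : p.z.im = 0 := hp.2
  simp [f, H3.ofCoord_z, hpi] at him
  have := mul_nonneg hu H.omega_im_pos.le
  have ht0 : (0 : ℝ) < t := ht0
  linarith

/-! ### The closure of the face and its edges -/

omit H in
lemma isClosed_realFace : IsClosed (realFace m) :=
  isClosed_polyhedron.inter
    (isClosed_eq (Complex.continuous_im.comp continuous_z) continuous_const)

lemma atInfinity_mem_closedRealFace {x : ℝ} (hx : |x| ≤ 1 / 2) :
    (atInfinity (x : ℂ) : BorelSerre m) ∈ closedRealFace m := by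
  refine atInfinity_mem_closure fun p hp hζ => H.mem_realFace.2 ⟨?_, ?_, ?_⟩
  · rw [hp, Complex.ofReal_im]
  · rw [hp, Complex.ofReal_re]; exact hx
  · nlinarith [sq_nonneg p.z.re]

lemma closedRealFace_eq :
    closedRealFace m = faceMap '' Metric.closedBall (0 : ℝ × ℝ) 1 := by
  ext y
  constructor
  · intro hy
    by_cases hin : y ∈ innerPart m
    · obtain ⟨p, rfl⟩ := hin
      obtain ⟨q, hq, e, -⟩ := exists_faceMap_eq (m := m)
        (H.mem_realFace.1 ((inner_mem_closure isClosed_realFace).1 hy))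
      exact ⟨q, hq, e⟩
    · by_cases hpl : y ∈ planeAtInfinity m
      · obtain ⟨z, rfl⟩ := hpl
        have hB : IsClosed {z : ℂ | z.im = 0 ∧ |z.re| ≤ 1 / 2} :=
          (isClosed_eq Complex.continuous_im continuous_const).inter
            (isClosed_le (Complex.continuous_re.abs) continuous_const)
        have hz := mem_of_atInfinity_mem_closure hB (A := realFace m) (fun p hp =>
          ⟨(H.mem_realFace.1 hp).1, (H.mem_realFace.1 hp).2.1⟩) hy
        have hre := abs_le.1 hz.2
        refine ⟨(2 * z.re, 1), mem_square.2
          ⟨⟨by simp only; linarith, by simp only; linarith⟩, by norm_num⟩, ?_⟩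
        rw [faceMap_top]
        congr 1
        apply Complex.ext
        · simp
        · simpa using hz.1.symm
      · obtain ⟨g, z, rfl, hg⟩ := mem_planeAtInfinity_or hin
        -- On the face ζ² ≥ 1 - 1/4, so 1/2 is a safe lower bound for the height.
        refine absurd hy (smul_atInfinity_notMem_closure_of_height (δ := 1 / 2) (by norm_num)
          (fun p hp => ?_) (hg hpl) z)
        have h1 := (H.mem_realFace.1 hp).2
        have h2 := abs_le.1 h1.1
        have h3 := p.ζ_pos
        nlinarith
  · rintro ⟨⟨x, y⟩, hq, rfl⟩
    by_cases h : y = 1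
    · subst h
      rw [faceMap_top]
      have := (mem_square.1 hq).1
      simp only at this
      exact H.atInfinity_mem_closedRealFace (abs_le.2 ⟨by linarith, by linarith⟩)
    · obtain ⟨p, e, hp, -⟩ := faceMap_inner (m := m) hq h
      rw [e]
      exact subset_closure ⟨p, H.mem_realFace.2 hp, rfl⟩

lemma faceCell_closedCell : H.faceCell.closedCell = closedRealFace m := by
  rw [H.closedRealFace_eq, ← image_discToSquare_closedBall, Set.image_image]
  rfl

lemma faceEdge_zero_apply (t : I) :
    H.faceEdge 0 t = (atInfinity (((1 - 2 * (t : ℝ)) / 2 : ℝ) : ℂ) : BorelSerre m) := by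
  have : squareLoop (((0 : Fin 5) : ℕ) + t) = (1 - 2 * (t : ℝ), 1) := by
    simpa using squareLoop_zero_one t.2.1 t.2.2
  rw [H.faceEdge_apply, this, faceMap_top]

lemma range_faceEdge_zero :
    Set.range (H.faceEdge 0) = closedRealFace m ∩ planeAtInfinity m := by
  ext y
  constructor
  · rintro ⟨t, rfl⟩
    refine ⟨?_, ?_⟩
    · rw [H.closedRealFace_eq]
      exact ⟨_, squareLoop_mem_closedBall 0 t, rfl⟩
    · rw [H.faceEdge_zero_apply]
      exact ⟨_, rfl⟩
  · rintro ⟨hy, z, rfl⟩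
    rw [H.closedRealFace_eq] at hy
    obtain ⟨⟨x, y⟩, hq, e⟩ := hy
    by_cases h : y = 1
    · subst h
      have := (mem_square.1 hq).1
      simp only at this
      refine ⟨⟨(1 - x) / 2, by linarith, by linarith⟩, ?_⟩
      rw [H.faceEdge_zero_apply, ← e, faceMap_top]
      congr 3
      ring
    · obtain ⟨p, e', -⟩ := faceMap_inner (m := m) hq h
      rw [e'] at e
      exact absurd e (inner_ne_atInfinity _ _)

lemma faceEdge_mem_innerPart (k : Fin 5) (hk : k ≠ 0) :
    H.faceEdge k '' Set.Ioo 0 1 ⊆ innerPart m := by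
  rintro _ ⟨t, ht, rfl⟩
  have hne : (squareLoop ((k : ℕ) + t)).2 ≠ 1 := by
    have h1 : (0 : ℝ) < t := ht.1
    have h2 : (t : ℝ) < 1 := ht.2
    have hk : 1 ≤ (k : ℕ) := Nat.one_le_iff_ne_zero.2 fun h => hk (Fin.ext h)
    have hk' : (1 : ℝ) ≤ (k : ℕ) := by exact_mod_cast hk
    have hk4 : ((k : ℕ) : ℝ) ≤ 4 := by exact_mod_cast Nat.lt_succ_iff.1 k.2
    rcases squareLoop_cases (squareLoop_mem k t).1 (squareLoop_mem k t).2 with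
      ⟨h3, h4, e⟩ | ⟨h3, h4, e⟩ | ⟨h3, h4, e⟩ | ⟨h3, h4, e⟩ <;> rw [e] <;> simp only <;> intro h <;>
      linarith
  obtain ⟨p, e, -⟩ := faceMap_inner (m := m) (squareLoop_mem_closedBall k t) hne
  exact ⟨p, e.symm⟩

end Admissible

/-! ### Side pairings of the face -/

lemma translation_smul_chartInfinity (w : RingInt m) (x : ℂ × NNReal) :
    translation w • (chartInfinity x : BorelSerre m) = chartInfinity (x.1 + intToComplex m w, x.2) := by
  have h00 : slToComplex (toK (translation w)) 0 0 = 1 := map_one (intToComplex m)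
  have h01 : slToComplex (toK (translation w)) 0 1 = intToComplex m w := rfl
  have h11 : slToComplex (toK (translation w)) 1 1 = 1 := map_one (intToComplex m)
  rw [smul_eq_toK, smul_chartInfinity_of_eq_zero (toK_lower_eq_zero.2 rfl), h00, h01, h11]
  simp

/-- The height in `faceMap` depends on x only through x², so the two vertical sides carry the same
heights. The same symmetry serves the inversion on the arc. -/
lemma translation_smul_faceMap (y : ℝ) :
    translation (1 : RingInt m) • (faceMap (-1, y) : BorelSerre m) = faceMap (1, y) := by
  unfold faceMap
  rw [translation_smul_chartInfinity]
  congr 1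
  refine Prod.ext ?_ ?_
  · simp only [map_one]
    push_cast
    norm_num
  · norm_num

lemma inversion_smul_faceMap {x : ℝ} (h : -1 ≤ x) (h' : x ≤ 1) :
    inversion m • (faceMap (-x, -1) : BorelSerre m) = faceMap (x, -1) := by
  obtain ⟨p, e, hp, hre, hζ, hN⟩ := faceMap_inner (m := m) (q := (-x, -1))
    (mem_square.2 ⟨⟨by simp only; linarith, by simp only; linarith⟩, by norm_num⟩) (by norm_num)
  obtain ⟨p', e', hp', hre', hζ', -⟩ := faceMap_inner (m := m) (q := (x, -1))
    (mem_square.2 ⟨⟨h, h'⟩, by norm_num⟩) (by norm_num)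
  rw [e, e', inversion_smul_inner hp (hN.2 rfl)]
  congr 1
  apply H3.ext
  · rw [H3.ofCoord_z, hp'.z_eq, hre, hre']
    simp only
    congr 1
    ring
  · rw [H3.ofCoord_ζ, hζ, hζ']
    simp only
    rw [neg_div, neg_sq]

namespace Admissible

variable (H : Admissible m)
include H

lemma translation_smul_faceEdge (t : I) :
    H.faceEdge 4 t = translation (1 : RingInt m) • H.faceEdge 1 (unitInterval.symm t) := by
  have h1 : squareLoop (((1 : Fin 5) : ℕ) + (unitInterval.symm t : I)) = (-1, 2 * (t : ℝ) - 1) := by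
    have h := t.2.1
    have h' := t.2.2
    rw [unitInterval.coe_symm_eq, squareLoop_one_two (by simp; linarith) (by simp; linarith)]
    ext <;> simp; ring
  have h4 : squareLoop (((4 : Fin 5) : ℕ) + t) = (1, 2 * (t : ℝ) - 1) := by
    have h := t.2.1
    have h' := t.2.2
    have e4 : (((4 : Fin 5) : ℕ) : ℝ) = 4 := by norm_cast
    rw [e4, squareLoop_four_five (by linarith) (by linarith)]
    ext <;> simp; ring
  rw [H.faceEdge_apply, H.faceEdge_apply, h1, h4, translation_smul_faceMap]

lemma inversion_smul_faceEdge (t : I) :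
    H.faceEdge 3 t = inversion m • H.faceEdge 2 (unitInterval.symm t) := by
  have h2 : squareLoop (((2 : Fin 5) : ℕ) + (unitInterval.symm t : I)) = (-(t : ℝ), -1) := by
    have h := t.2.1
    have h' := t.2.2
    have e2 : (((2 : Fin 5) : ℕ) : ℝ) = 2 := by norm_cast
    rw [unitInterval.coe_symm_eq, e2, squareLoop_two_four (by linarith) (by linarith)]
    ext <;> simp; ring
  have h3 : squareLoop (((3 : Fin 5) : ℕ) + t) = ((t : ℝ), -1) := by
    have h := t.2.1
    have h' := t.2.2
    have e3 : (((3 : Fin 5) : ℕ) : ℝ) = 3 := by norm_cast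
    rw [e3, squareLoop_two_four (by linarith) (by linarith)]
    ext <;> simp
  rw [H.faceEdge_apply, H.faceEdge_apply, h2, h3,
    inversion_smul_faceMap (by linarith [t.2.1]) t.2.2]

end Admissible

lemma exists_smul_symm {e e' : I → BorelSerre m} (γ : BianchiGroup m)
    (h : ∀ t, e' t = γ • e (unitInterval.symm t)) :
    ∃ γ : BianchiGroup m, ∀ t, e t = γ • e' (unitInterval.symm t) :=
  ⟨γ⁻¹, fun t => by rw [h, unitInterval.symm_symm, inv_smul_smul]⟩

/-! ## Chains -/

lemma proj_smul (γ : BianchiGroup m) (x : BorelSerre m) : proj (γ • x) = proj x :=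
  Quotient.sound ⟨γ, rfl⟩

lemma Edge.chain_add_chain_eq_zero {e e' : Edge m} (γ : BianchiGroup m)
    (h : ∀ t, e' t = γ • e (unitInterval.symm t)) : e'.chain + e.chain = 0 := by
  change QuotientAddGroup.mk (FreeAbelianGroup.of e' + FreeAbelianGroup.of e) = (0 : Chain1 m)
  rw [QuotientAddGroup.eq_zero_iff]
  refine AddSubgroup.subset_closure ⟨e, e', unitInterval.symmHomeomorph, fun t => ?_,
    .inr ⟨unitInterval.symm_zero, rfl⟩⟩
  rw [h, proj_smul]
  rfl

/-- The chain of an edge is detected by counting modulo 2 the edges which agree with it in the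
quotient up to reparametrization. -/
lemma Edge.chain_ne_zero (e : Edge m) : e.chain ≠ 0 := by
  classical
  let R : Edge m → Prop := fun e' => ∃ φ : I ≃ₜ I, ∀ t, proj (e' t) = proj (e (φ t))
  let f : FreeAbelianGroup (Edge m) →+ ZMod 2 :=
    FreeAbelianGroup.lift fun e' => if R e' then 1 else 0
  have hf : AddSubgroup.closure (edgeRelations m) ≤ f.ker := by
    rw [AddSubgroup.closure_le]
    rintro x ⟨e₁, e₂, φ, h, hx⟩
    have hR : R e₂ ↔ R e₁ := by
      constructor
      · rintro ⟨ψ, hψ⟩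
        refine ⟨φ.symm.trans ψ, fun t => ?_⟩
        rw [Homeomorph.trans_apply, ← hψ, h, Homeomorph.apply_symm_apply]
      · rintro ⟨ψ, hψ⟩
        exact ⟨φ.trans ψ, fun t => by rw [h, hψ, Homeomorph.trans_apply]⟩
    rcases hx with ⟨-, rfl⟩ | ⟨-, rfl⟩
    · simp [f, hR]
    · simp only [SetLike.mem_coe, AddMonoidHom.mem_ker, map_add, f, FreeAbelianGroup.lift_apply_of,
        hR]
      -- This is why the count is modulo 2: opposite edges have equal counts, whose sum must vanish.
      -- No orientation has to be tracked, even if an edge is identified with its own reverse.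
      exact CharTwo.add_self_eq_zero _
  intro h0
  have h1 : FreeAbelianGroup.of e ∈ f.ker := hf ((QuotientAddGroup.eq_zero_iff _).1 h0)
  have h2 : R e := ⟨Homeomorph.refl I, fun _ => rfl⟩
  simp [f, h2] at h1

namespace Admissible

variable (H : Admissible m)
include H

lemma faceCell_boundaryChain : H.faceCell.boundaryChain = (H.faceEdge 0).chain := by
  have h1 := Edge.chain_add_chain_eq_zero _ H.translation_smul_faceEdge
  have h2 := Edge.chain_add_chain_eq_zero _ H.inversion_smul_faceEdge
  change ∑ k : Fin 5, (H.faceEdge k).chain = _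
  rw [Fin.sum_univ_five]
  calc _ = (H.faceEdge 0).chain + ((H.faceEdge 4).chain + (H.faceEdge 1).chain) +
        ((H.faceEdge 3).chain + (H.faceEdge 2).chain) := by abel
    _ = _ := by rw [h1, h2, add_zero, add_zero]

lemma proj_faceEdge_zero : proj (H.faceEdge 0 0) = proj (H.faceEdge 0 1) := by
  have : H.faceEdge 0 0 = translation (1 : RingInt m) • H.faceEdge 0 1 := by
    rw [H.faceEdge_zero_apply, H.faceEdge_zero_apply, translation_smul_atInfinity, map_one]
    congr 1
    rw [Set.Icc.coe_zero, Set.Icc.coe_one]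
    push_cast
    norm_num
  rw [this, proj_smul]

lemma exists_pairing : ∃ pair : Fin 5 → Fin 5, ∀ k, k ≠ 0 →
    pair k ≠ 0 ∧ pair k ≠ k ∧ pair (pair k) = k ∧
    ∃ γ : BianchiGroup m, ∀ t : I,
      H.faceEdge (pair k) t = γ • H.faceEdge k (unitInterval.symm t) := by
  refine ⟨![0, 4, 3, 2, 1], fun k hk => ?_⟩
  fin_cases k
  · exact absurd rfl hk
  · exact ⟨by decide, by decide, rfl, _, H.translation_smul_faceEdge⟩
  · exact ⟨by decide, by decide, rfl, _, H.inversion_smul_faceEdge⟩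
  · exact ⟨by decide, by decide, rfl, exists_smul_symm _ H.inversion_smul_faceEdge⟩
  · exact ⟨by decide, by decide, rfl, exists_smul_symm _ H.translation_smul_faceEdge⟩

end Admissible

end Bianchi

end

/-! ### The main theorem -/

theorem mainTheorem6 (m : ℕ) (hm : Squarefree m)
    (hunits : ∀ u : (Bianchi.RingInt m)ˣ, u = 1 ∨ u = -1) :
    -- the real upper half-plane contains, equivariantly, the upper half-plane, and the face of the
    -- polyhedron in the real upper half-plane is the image of the fundamental domain of `SL₂(ℤ)`
    (∀ (g : Matrix.SpecialLinearGroup (Fin 2) ℤ) (τ : UpperHalfPlane),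
      (Bianchi.BorelSerre.inner (Bianchi.realEmbedding (g • τ)) : Bianchi.BorelSerre m) =
        (Matrix.SpecialLinearGroup.map (Int.castRingHom (Bianchi.RingInt m)) g) •
          Bianchi.BorelSerre.inner (Bianchi.realEmbedding τ)) ∧
    Set.range Bianchi.realEmbedding = Bianchi.realHalfPlane ∧
    Bianchi.realFace m = Bianchi.realEmbedding '' ModularGroup.fd ∧
    Bianchi.realFace m ⊆ frontier (Bianchi.polyhedron m) ∧
    -- the completed face is a 2-cell `F` of the induced cell structure, with a top edge `k₀`
    ∃ (n : ℕ) (F : Bianchi.PolygonalCell m n) (k₀ : Fin n),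
      F.closedCell = Bianchi.closedRealFace m ∧
      Set.range (F.edge k₀) = Bianchi.closedRealFace m ∩ Bianchi.planeAtInfinity m ∧
      -- all other edges lie in hyperbolic space (up to ideal end points), and appear in pairs
      -- with opposite orientations modulo the Bianchi group
      (∀ k, k ≠ k₀ → F.edge k '' Set.Ioo 0 1 ⊆ Bianchi.innerPart m) ∧
      (∃ pair : Fin n → Fin n, ∀ k, k ≠ k₀ →
        pair k ≠ k₀ ∧ pair k ≠ k ∧ pair (pair k) = k ∧
        ∃ γ : Bianchi.BianchiGroup m, ∀ t : unitInterval,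
          F.edge (pair k) t = γ • F.edge k (unitInterval.symm t)) ∧
      -- in the quotient, the boundary of `F` is the top edge, which is non-trivial
      F.boundaryChain = (F.edge k₀).chain ∧
      (F.edge k₀).chain ≠ 0 ∧
      -- the top edge is a loop in the torus attached at infinity
      (∀ t, Bianchi.proj (F.edge k₀ t) ∈ Bianchi.torusAtInfinity m) ∧
      Bianchi.proj (F.edge k₀ 0) = Bianchi.proj (F.edge k₀ 1) := by
  have H : Bianchi.Admissible m := ⟨hm, hunits⟩
  refine ⟨Bianchi.inner_realEmbedding_smul, Bianchi.range_realEmbedding, H.realFace_eq,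
    H.realFace_subset_frontier, 5, H.faceCell, 0, H.faceCell_closedCell, H.range_faceEdge_zero,
    H.faceEdge_mem_innerPart, H.exists_pairing, H.faceCell_boundaryChain,
    Bianchi.Edge.chain_ne_zero _, fun t => ?_, H.proj_faceEdge_zero⟩
  exact ⟨_, ⟨_, (H.faceEdge_zero_apply t).symm⟩, rfl⟩
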